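/- A tournament $T$ consists of a finite vertex set $V(T)$ and a set $A(T)$ of ordered pairs of distinct vertices (arcs) such that for all distinct $x,y$ exactly one of $(x,y),(y,x)$ lies in $A(T)$. A module of $T$ is a set $M\subseteq V(T)$ such that for all $x,y\in M$ and $v\in V(T)\setminus M$, $(v,x)\in A(T)$ if and only if $(v,y)\in A(T)$. The tournament $T$ is indecomposable if its only modules are $\varnothing$, the singletons, and $V(T)$. For $T$ with at least five vertices, $\delta(T)$ is the smallest number of arcs of $T$ whose reversal makes $T$ indecomposable, and for $m\ge 5$, $\delta(m)$ is the maximum of $\delta(U)$ over all $m$-vertex tournaments $U$. We say that $T$ has $\delta$-maximal decomposability if it has at least five vertices and $\delta(T)=\delta(|V(T)|)$. Let $\underline{k}$ be the transitive tournament on $\{0,\dots,k-1\}$ with arcs $(i,j)$ for $i<j$, and let $C_3$ be the tournament on $\{0,1,2\}$ with arcs $(0,1),(1,2),(2,0)$. The dual of a tournament is obtained by reversing all its arcs. For a tournament $T$ on $\{0,\dots,k-1\}$ and tournaments $H_0,\dots,H_{k-1}$, the lexicographic sum $T(H_0,\dots,H_{k-1})$ is the tournament on the disjoint union of the $V(H_i)$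 in which, for $x\in V(H_i)$ and $y\in V(H_j)$, the pair $(x,y)$ is an arc if and only if either $i=j$ and $(x,y)\in A(H_i)$, or $i\ne j$ and $(i,j)\in A(T)$. Write $T.H=T(H,\dots,H)$. **Theorem.** Let $n\ge 1$. A tournament has $4n+2$ vertices and $\delta$-maximal decomposability if and only if it is isomorphic to a tournament of at least one of the following forms, where $T_k$ denotes an arbitrary tournament on $\{0,\dots,k-1\}$: - (a) $T_{2n+1}.\underline{2}$; - (b) $C_3(\underline{1},\underline{1},T_{2n}.\underline{2})$; - (c) $\underline{2}(\underline{1},T_{2n+1}(\underline{1},\underline{2},\dots,\underline{2}))$ or its dual; - (d) $\underline{2}(\underline{1},T_{2n}(C_3,\underline{2},\dots,\underline{2}))$ or its dual; - (e) $\underline{3}(\underline{1},T_{2n+1}(\underline{1},\underline{1},\underline{2},\dots,\underline{2}),\underline{1})$; - (f) $\underline{3}(\underline{1},T_{2n}(C_3,\underline{1},\underline{2},\dots,\underline{2}),\underline{1})$; - (g) $\underline{3}(\underline{1},T_{2n-1}(C_3,C_3,\underline{2},\dots,\underline{2}),\underline{1})$, when $n\ge 2$. -/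

import Mathlib

/-- A tournament with vertex type `V`: for distinct `x`, `y`, exactly one of `(x, y)`, `(y, x)`
is an arc, and there are no loops. -/
@[ext]
structure Tournament (V : Type*) where
  Arc : V → V → Prop
  irrefl : ∀ x, ¬ Arc x x
  arc_iff : ∀ x y, x ≠ y → (Arc x y ↔ ¬ Arc y x)

/-- A tournament together with its vertex type. -/
abbrev BundledTournament := Σ V : Type, Tournament V

namespace Tournament

variable {V : Type*}

/-- The arc set `A(T)`. -/
def arcSet (T : Tournament V) : Set (V × V) := {p | T.Arc p.1 p.2}

/-- `T ≃ T'`: some bijection between the vertex sets preserves and reflects arcs. -/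
def Iso {W : Type*} (T : Tournament V) (T' : Tournament W) : Prop :=
  Nonempty (T.Arc ≃r T'.Arc)

/-- The dual tournament: all arcs are reversed. -/
def dual (T : Tournament V) : Tournament V where
  Arc x y := T.Arc y x
  irrefl := T.irrefl
  arc_iff x y h := T.arc_iff y x h.symm

/-- `M` is a module: every vertex outside `M` relates in the same way to all elements of `M`. -/
def IsModule (T : Tournament V) (M : Set V) : Prop :=
  ∀ x ∈ M, ∀ y ∈ M, ∀ v ∉ M, (T.Arc v x ↔ T.Arc v y)

/-- All modules are trivial. -/
def Indecomposable (T : Tournament V) : Prop :=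
  ∀ M : Set V, T.IsModule M → M = ∅ ∨ (∃ u, M = {u}) ∨ M = Set.univ

/-- `Inv(T, B)`: the arc set becomes `(A(T) \ B) ∪ B⋆`, where `B⋆` consists of the reversed
pairs of `B`. -/
def inv (T : Tournament V) (B : Finset (V × V)) (hB : (B : Set (V × V)) ⊆ T.arcSet) :
    Tournament V where
  Arc x y := (T.Arc x y ∧ (x, y) ∉ B) ∨ (y, x) ∈ B
  irrefl x := by
    rintro (⟨h, _⟩ | h)
    · exact T.irrefl x h
    · exact T.irrefl x (hB h)
  arc_iff x y hne := by
    have h := T.arc_iff x y hne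
    have h1 : (x, y) ∈ B → T.Arc x y := fun h => hB h
    have h2 : (y, x) ∈ B → T.Arc y x := fun h => hB h
    tauto

/-- The decomposability index `δ(T)`: the least number of arcs whose reversal makes `T`
indecomposable (meaningful when `T` has at least five vertices). -/
noncomputable def decompIndex (T : Tournament V) : ℕ :=
  sInf {m | ∃ (B : Finset (V × V)) (hB : (B : Set (V × V)) ⊆ T.arcSet),
    B.card = m ∧ (T.inv B hB).Indecomposable}

/-- `δ(n)`: the maximum of `δ(U)` over the (finitely many) tournaments `U` on `n` vertices. -/
noncomputable def maxDecompIndex (n : ℕ) : ℕ :=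
  sSup (Set.range fun U : Tournament (Fin n) => U.decompIndex)

/-- `T` has at least five vertices and `δ(T) = δ(v(T))`. -/
def HasMaximalDecomposability (T : Tournament V) : Prop :=
  5 ≤ Nat.card V ∧ T.decompIndex = maxDecompIndex (Nat.card V)

/-- The transitive tournament on `{0, …, n - 1}`, with arcs `(i, j)` for `i < j`. -/
def transitive (n : ℕ) : Tournament (Fin n) where
  Arc i j := i < j
  irrefl i := lt_irrefl i
  arc_iff i j h := by
    rw [not_lt]
    exact ⟨le_of_lt, fun h' => lt_of_le_of_ne h' h⟩

/-- The 3-cycle with arcs `(0, 1)`, `(1, 2)`, `(2, 0)`. -/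
def cycle3 : Tournament (Fin 3) where
  Arc i j := j = i + 1
  irrefl := by decide
  arc_iff := by decide

/-- The lexicographic sum of the tournaments `F i` over `T`. Its vertex set is the disjoint union
of the vertex sets of the `F i`; the pair `(⟨i, x⟩, ⟨j, y⟩)` is an arc when `(i, j)` is an arc of
`T`, or when `i = j` and `(x, y)` is an arc of `F i`. -/
def lexSum {I : Type} (T : Tournament I) (F : I → BundledTournament) : BundledTournament :=
  ⟨Σ i, (F i).1,
    { Arc := Sigma.Lex T.Arc fun i => (F i).2.Arc
      irrefl := by
        rintro ⟨i, x⟩ h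
        rcases Sigma.lex_iff.1 h with h | ⟨_, h⟩
        · exact T.irrefl i h
        · exact (F i).2.irrefl x h
      arc_iff := by
        rintro ⟨i, x⟩ ⟨j, y⟩ hne
        by_cases hij : i = j
        · subst hij
          have hxy : x ≠ y := fun h => hne (by rw [h])
          simpa [Sigma.lex_iff, T.irrefl] using (F i).2.arc_iff x y hxy
        · simpa [Sigma.lex_iff, hij, Ne.symm hij] using T.arc_iff i j hij }⟩

end Tournament

namespace BundledTournament

/-- The one-vertex tournament. -/
def one : BundledTournament := ⟨Fin 1, Tournament.transitive 1⟩

/-- The two-vertex tournament. -/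
def two : BundledTournament := ⟨Fin 2, Tournament.transitive 2⟩

/-- The 3-cycle. -/
def c3 : BundledTournament := ⟨Fin 3, Tournament.cycle3⟩

/-- The dual of a bundled tournament. -/
def dual (X : BundledTournament) : BundledTournament := ⟨X.1, X.2.dual⟩

end BundledTournament

namespace Tournament

open BundledTournament in
/-- For `L = [L₀, …, Lᵣ]`, the lexicographic sum `T(L₀, …, Lᵣ, 2, …, 2)`: the first vertices of `T`
are replaced by the members of `L`, and all the others by two-vertex tournaments. -/
def sumTwos {k : ℕ} (T : Tournament (Fin k)) (L : List BundledTournament) : BundledTournament :=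
  T.lexSum fun i => L.getD i two

end Tournament

/-!
A *nontrivial co-module* of a tournament is a nontrivial module or the complement of one, and a
*transversal* is a set of vertices that meets all of them. The theorem rests on the equality of the
largest number `k` of disjoint nontrivial co-modules and the least size of a transversal, and on
the formula `δ(T) = ⌈k / 2⌉` for tournaments on at least five vertices.

*Lower bound.* If reversing the arcs of `B` makes `T` indecomposable, then each nontrivial co-module
contains an endpoint of an arc of `B`, so that `k ≤ 2 |B|` (`HasPacking.le_decompIndex`).

*Min-max equality.* Two distinct minimal nontrivial co-modules intersect only if they are modules
`{a, b}` and `{b, c}`, with `a → b → c` or the reverse. Choosing a kernel of this acyclic relation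
gives disjoint minimal co-modules, and picking a suitable vertex in each gives a transversal
(`exists_packedTransversal`).

*Upper bound.* Let `x` and `y` lie in a transversal `X`. If no nontrivial co-module meets `X` in
exactly `{x, y}`, then after the arc between `x` and `y` is reversed, `X \ {x, y}` is a transversal
(`Hits.flipArc`). When `X` has at least four vertices, such a pair exists, because the three
ways of pairing four vertices cannot all be realized by co-modules (`not_three_pairings`). With
three vertices, one flip still reduces the transversal to two (`hasPairFlip_of_triple`), and with
two, one flip makes the tournament indecomposable (`Hits.exists_indecomposable`). Hence a
transversal with `k` vertices gives `δ(T) ≤ (k + 1) / 2` (`Hits.decompIndex_le`).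

*Extremal tournaments.* The one-vertex co-modules are formed by a source or a sink, so there are at
most two of them. Hence a packing in a tournament on `4n + 2` vertices has at most `2n + 2` members,
and `δ(4n + 2) = n + 1`. A tournament on `4n + 2` vertices is therefore extremal if and only if it
has `2n + 1` disjoint nontrivial co-modules. In such a packing by minimal co-modules, almost all
members are pairs: a minimal module with three elements is a 3-cycle, and none has four elements, as
no tournament on four vertices is indecomposable. Counting vertices according to the number of
sources and sinks in the packing (none for (a) and (b), one for (c) and (d), two for (e), (f)
and (g)) yields the forms (`MinPacking.forms`). Conversely, each form visibly contains such a
packing (`card_and_hasPacking_of_forms`).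
-/

namespace Tournament

variable {V : Type*}

lemma Arc.asymm {T : Tournament V} {x y : V} (h : T.Arc x y) : ¬ T.Arc y x := by
  have hne : x ≠ y := fun e => T.irrefl x (by rw [e] at h ⊢; exact h)
  exact (T.arc_iff x y hne).1 h

lemma Arc.ne {T : Tournament V} {x y : V} (h : T.Arc x y) : x ≠ y :=
  fun e => T.irrefl x (by rw [e] at h ⊢; exact h)

lemma arc_or_arc (T : Tournament V) {x y : V} (h : x ≠ y) : T.Arc x y ∨ T.Arc y x := by
  have := T.arc_iff x y h
  tauto

/-- Seen from its elements, a module is uniform towards each outside vertex. -/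
lemma IsModule.arc_left {T : Tournament V} {M : Set V} (hM : T.IsModule M) {x y v : V}
    (hx : x ∈ M) (hy : y ∈ M) (hv : v ∉ M) : T.Arc x v ↔ T.Arc y v := by
  have h := hM x hx y hy v hv
  have h1 := T.arc_iff v x (fun e => hv (e ▸ hx))
  have h2 := T.arc_iff v y (fun e => hv (e ▸ hy))
  tauto

/-- A module other than the trivial ones. -/
def IsNontrivialModule (T : Tournament V) (M : Set V) : Prop :=
  T.IsModule M ∧ M.Nontrivial ∧ Mᶜ.Nonempty

/-- A nontrivial co-module: a nontrivial module, or the complement of one. -/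
def IsComodule (T : Tournament V) (C : Set V) : Prop :=
  T.IsNontrivialModule C ∨ T.IsNontrivialModule Cᶜ

/-- `X` meets every nontrivial co-module. -/
def Hits (T : Tournament V) (X : Set V) : Prop :=
  ∀ M, T.IsNontrivialModule M → (M ∩ X).Nonempty ∧ (Mᶜ ∩ X).Nonempty

lemma IsComodule.compl {T : Tournament V} {C : Set V} (h : T.IsComodule C) : T.IsComodule Cᶜ := by
  rcases h with h | h
  · exact Or.inr (by rwa [compl_compl])
  · exact Or.inl h

lemma IsComodule.nonempty {T : Tournament V} {C : Set V} (h : T.IsComodule C) : C.Nonempty := by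
  rcases h with h | h
  · exact h.2.1.nonempty
  · simpa using h.2.2

lemma Hits.inter_nonempty {T : Tournament V} {X C : Set V} (hX : T.Hits X) (hC : T.IsComodule C) :
    (C ∩ X).Nonempty := by
  rcases hC with h | h
  · exact (hX C h).1
  · simpa using (hX _ h).2

lemma Hits.mono {T : Tournament V} {X Y : Set V} (hX : T.Hits X) (h : X ⊆ Y) : T.Hits Y :=
  fun M hM => ⟨(hX M hM).1.mono (Set.inter_subset_inter_right _ h),
    (hX M hM).2.mono (Set.inter_subset_inter_right _ h)⟩

lemma indecomposable_of_forall {T : Tournament V} (h : ∀ M, ¬ T.IsNontrivialModule M) :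
    T.Indecomposable := by
  intro M hM
  by_contra hcon
  push Not at hcon
  obtain ⟨h1, h2, h3⟩ := hcon
  refine h M ⟨hM, ?_, Set.nonempty_compl.2 h3⟩
  rcases M.subsingleton_or_nontrivial with hs | hn
  · rcases hs.eq_empty_or_singleton with he | ⟨u, hu⟩
    · exact absurd he h1.ne_empty
    · exact absurd hu (h2 u)
  · exact hn

lemma Indecomposable.not_nontrivialModule {T : Tournament V} (h : T.Indecomposable) (M : Set V) :
    ¬ T.IsNontrivialModule M := by
  rintro ⟨hM, hn, hc⟩
  rcases h M hM with rfl | ⟨u, rfl⟩ | rfl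
  · exact Set.not_nontrivial_empty hn
  · exact Set.not_nontrivial_singleton hn
  · simp at hc

/-! ### Duality -/

lemma isModule_dual {T : Tournament V} {M : Set V} : T.dual.IsModule M ↔ T.IsModule M := by
  constructor
  · intro h x hx y hy v hv
    exact IsModule.arc_left h hx hy hv
  · intro h x hx y hy v hv
    exact IsModule.arc_left h hx hy hv

lemma isNontrivialModule_dual {T : Tournament V} {M : Set V} :
    T.dual.IsNontrivialModule M ↔ T.IsNontrivialModule M := by
  simp [IsNontrivialModule, isModule_dual]

lemma isComodule_dual {T : Tournament V} {M : Set V} :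
    T.dual.IsComodule M ↔ T.IsComodule M := by
  simp [IsComodule, isNontrivialModule_dual]

lemma hits_dual {T : Tournament V} {X : Set V} : T.dual.Hits X ↔ T.Hits X := by
  simp [Hits, isNontrivialModule_dual]

/-! ### Operations on modules -/

lemma IsModule.inter {T : Tournament V} {M N : Set V} (hM : T.IsModule M) (hN : T.IsModule N) :
    T.IsModule (M ∩ N) := by
  intro a ha b hb v hv
  by_cases h : v ∈ M
  · exact hN a ha.2 b hb.2 v (fun h' => hv ⟨h, h'⟩)
  · exact hM a ha.1 b hb.1 v h

lemma IsModule.union {T : Tournament V} {M N : Set V} (hM : T.IsModule M) (hN : T.IsModule N)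
    (h : (M ∩ N).Nonempty) : T.IsModule (M ∪ N) := by
  obtain ⟨c, hcM, hcN⟩ := h
  have key : ∀ a ∈ M ∪ N, ∀ v ∉ M ∪ N, (T.Arc v a ↔ T.Arc v c) := by
    rintro a (ha | ha) v hv
    · exact hM a ha c hcM v (fun h' => hv (Or.inl h'))
    · exact hN a ha c hcN v (fun h' => hv (Or.inr h'))
  intro a ha b hb v hv
  rw [key a ha v hv, key b hb v hv]

lemma IsModule.diff {T : Tournament V} {M N : Set V} (hM : T.IsModule M) (hN : T.IsModule N)
    (h : (N \ M).Nonempty) : T.IsModule (M \ N) := by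
  obtain ⟨w, hwN, hwM⟩ := h
  intro a ha b hb v hv
  by_cases h : v ∈ M
  · have hvN : v ∈ N := by by_contra h'; exact hv ⟨h, h'⟩
    rw [hN.arc_left hvN hwN ha.2, hN.arc_left hvN hwN hb.2]
    exact hM a ha.1 b hb.1 w hwM
  · exact hM a ha.1 b hb.1 v h

lemma isModule_singleton (T : Tournament V) (v : V) : T.IsModule {v} := by
  rintro a rfl b rfl v _
  rfl

/-! ### Reversing one arc -/

/-- The tournament obtained by reversing the arc between `x` and `y`. -/
def flipArc (T : Tournament V) (x y : V) : Tournament V where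
  Arc a b := (T.Arc a b ∧ ¬ ((a = x ∧ b = y) ∨ (a = y ∧ b = x))) ∨
    (T.Arc b a ∧ ((a = x ∧ b = y) ∨ (a = y ∧ b = x)))
  irrefl a := by
    have := T.irrefl a
    tauto
  arc_iff a b h := by
    have := T.arc_iff a b h
    tauto

lemma flipArc_arc_of_ne {T : Tournament V} {x y a b : V}
    (h : ¬ ((a = x ∧ b = y) ∨ (a = y ∧ b = x))) : (T.flipArc x y).Arc a b ↔ T.Arc a b := by
  simp only [flipArc]; tauto

lemma flipArc_arc_right {T : Tournament V} {x y : V} :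
    (T.flipArc x y).Arc y x ↔ T.Arc x y := by
  simp only [flipArc]; tauto

lemma flipArc_comm (T : Tournament V) (x y : V) : T.flipArc x y = T.flipArc y x := by
  ext a b
  simp only [flipArc]; tauto

lemma dual_flipArc (T : Tournament V) (x y : V) : T.dual.flipArc x y = (T.flipArc x y).dual := by
  ext a b
  simp only [flipArc, dual]; tauto

lemma isModule_flipArc_iff {T : Tournament V} {x y : V} {M : Set V} (h : x ∈ M ↔ y ∈ M) :
    (T.flipArc x y).IsModule M ↔ T.IsModule M := by
  have key : ∀ a ∈ M, ∀ v ∉ M, ((T.flipArc x y).Arc v a ↔ T.Arc v a) := by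
    intro a ha v hv
    apply flipArc_arc_of_ne
    rintro (⟨rfl, rfl⟩ | ⟨rfl, rfl⟩)
    · exact hv (h.2 ha)
    · exact hv (h.1 ha)
  constructor
  · intro hM a ha b hb v hv
    rw [← key a ha v hv, ← key b hb v hv]; exact hM a ha b hb v hv
  · intro hM a ha b hb v hv
    rw [key a ha v hv, key b hb v hv]; exact hM a ha b hb v hv

lemma isNontrivialModule_flipArc_iff {T : Tournament V} {x y : V} {M : Set V}
    (h : x ∈ M ↔ y ∈ M) : (T.flipArc x y).IsNontrivialModule M ↔ T.IsNontrivialModule M := by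
  rw [IsNontrivialModule, isModule_flipArc_iff h, IsNontrivialModule]

/-- What it means for `T` that `M` is a module containing `x` but not `y` after the arc between
`x` and `y` has been reversed: all outside vertices other than `y` are uniform on `M`, and `y` is
related to the rest of `M` in the way opposite to its relation to `x`. -/
structure SplitModule (T : Tournament V) (x y : V) (M : Set V) : Prop where
  left_mem : x ∈ M
  right_notMem : y ∉ M
  uniform : ∀ v ∉ M, v ≠ y → ∀ a ∈ M, ∀ b ∈ M, (T.Arc v a ↔ T.Arc v b)
  opposite : ∀ a ∈ M, a ≠ x → (T.Arc y a ↔ T.Arc x y)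

lemma splitModule_of_flipArc {T : Tournament V} {x y : V} {M : Set V}
    (hM : (T.flipArc x y).IsModule M) (hx : x ∈ M) (hy : y ∉ M) : T.SplitModule x y M where
  left_mem := hx
  right_notMem := hy
  uniform v hv hvy a ha b hb := by
    have hvx : v ≠ x := fun e => hv (e ▸ hx)
    have := hM a ha b hb v hv
    rwa [flipArc_arc_of_ne (by tauto), flipArc_arc_of_ne (by tauto)] at this
  opposite a ha hax := by
    have := hM a ha x hx y hy
    rwa [flipArc_arc_right, flipArc_arc_of_ne] at this
    rintro (⟨rfl, -⟩ | ⟨-, e⟩)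
    · exact hy hx
    · exact hax e

namespace SplitModule

variable {T : Tournament V} {x y : V} {M : Set V}

lemma uniform_left (h : T.SplitModule x y M) {v : V} (hv : v ∉ M) (hvy : v ≠ y) {a b : V}
    (ha : a ∈ M) (hb : b ∈ M) : T.Arc a v ↔ T.Arc b v := by
  have h0 := h.uniform v hv hvy a ha b hb
  have h1 := T.arc_iff v a (fun e => hv (e ▸ ha))
  have h2 := T.arc_iff v b (fun e => hv (e ▸ hb))
  tauto

lemma ne (h : T.SplitModule x y M) : x ≠ y := fun e => h.right_notMem (e ▸ h.left_mem)

lemma dual (h : T.SplitModule x y M) : T.dual.SplitModule x y M where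
  left_mem := h.left_mem
  right_notMem := h.right_notMem
  uniform v hv hvy a ha b hb := h.uniform_left hv hvy ha hb
  opposite a ha hax := by
    have h0 := h.opposite a ha hax
    have h1 := T.arc_iff y a (fun e => h.right_notMem (e ▸ ha))
    have h2 := T.arc_iff x y h.ne
    simp only [Tournament.dual]
    tauto

/-- A module of the original tournament that contains `x` and not `y` meets `M` in `x` only. -/
lemma eq_of_mem_of_mem (h : T.SplitModule x y M) {C : Set V} (hC : T.IsModule C) (hx : x ∈ C)
    (hy : y ∉ C) {a : V} (haC : a ∈ C) (haM : a ∈ M) : a = x := by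
  by_contra hne
  have h1 := h.opposite a haM hne
  have h2 := hC a haC x hx y hy
  have h3 := T.arc_iff x y h.ne
  tauto

/-- A nontrivial module of the original tournament that contains `y` and not `x` meets `M`. -/
lemma exists_mem_inter (h : T.SplitModule x y M) (hM : M.Nontrivial) {C : Set V}
    (hC : T.IsModule C) (hCn : C.Nontrivial) (hy : y ∈ C) (hx : x ∉ C) : ∃ d ∈ M, d ∈ C := by
  by_contra hcon
  push Not at hcon
  obtain ⟨u, hu, hux⟩ := hM.exists_ne x
  obtain ⟨e, he, hey⟩ := hCn.exists_ne y
  have heM : e ∉ M := fun h' => hcon e h' he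
  have h1 := hC y hy e he u (hcon u hu)
  have h2 := hC y hy e he x hx
  have h3 := h.opposite u hu hux
  have h4 := h.uniform e heM hey u hu x h.left_mem
  have h5 := T.arc_iff y u (fun e' => h.right_notMem (e' ▸ hu))
  have h6 := T.arc_iff e u (fun e' => heM (e' ▸ hu))
  have h7 := T.arc_iff x e (fun e' => heM (e' ▸ h.left_mem))
  tauto

lemma isModule_union (h : T.SplitModule x y M) (hM : M.Nontrivial) {C D : Set V}
    (hC : T.IsModule C) (hD : T.IsModule D) (hDn : D.Nontrivial) (hxC : x ∈ C) (hyD : y ∈ D)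
    (hCD : Disjoint C D) : T.IsModule (M ∪ C ∪ D) := by
  obtain ⟨d, hdM, hdD⟩ := h.exists_mem_inter hM hD hDn hyD (Set.disjoint_left.1 hCD hxC)
  have key : ∀ a ∈ M ∪ C ∪ D, ∀ v ∉ M ∪ C ∪ D, (T.Arc v a ↔ T.Arc v x) := by
    intro a ha v hv
    simp only [Set.mem_union, not_or] at hv ha
    have hvy : v ≠ y := fun e => hv.2 (e ▸ hyD)
    rcases ha with (ha | ha) | ha
    · exact h.uniform v hv.1.1 hvy a ha x h.left_mem
    · exact hC a ha x hxC v hv.1.2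
    · rw [hD a ha d hdD v hv.2]
      exact h.uniform v hv.1.1 hvy d hdM x h.left_mem
  intro a ha b hb v hv
  rw [key a ha v hv, key b hb v hv]

lemma isModule_compl_union_of_compl_left (h : T.SplitModule x y M) (hM : M.Nontrivial)
    {C D : Set V} (hC : T.IsModule Cᶜ) (hD : T.IsComodule D) (hxC : x ∈ C) (hyD : y ∈ D)
    (hCD : Disjoint C D) : T.IsModule (M ∪ C ∪ D)ᶜ := by
  have hxD := Set.disjoint_left.1 hCD hxC
  have key : ∀ v ∈ M, v ∉ C → ∀ a ∈ (M ∪ C ∪ D)ᶜ, (T.Arc v a ↔ T.Arc x a) := by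
    intro v hv _ a ha
    simp only [Set.mem_compl_iff, Set.mem_union, not_or] at ha
    exact h.uniform_left ha.1.1 (fun e => ha.2 (e ▸ hyD)) hv h.left_mem
  have key2 : ∀ v ∈ M, ∀ a ∈ (M ∪ C ∪ D)ᶜ, ∀ b ∈ (M ∪ C ∪ D)ᶜ, (T.Arc v a ↔ T.Arc v b) := by
    intro v hv a ha b hb
    have hx' : T.Arc x a ↔ T.Arc x b :=
      hC a (fun h' => ha (by simp [h'])) b (fun h' => hb (by simp [h'])) x (by simpa using hxC)
    by_cases hvC : v ∈ C
    · exact hC a (fun h' => ha (by simp [h'])) b (fun h' => hb (by simp [h'])) v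
        (by simpa using hvC)
    · rw [key v hv hvC a ha, key v hv hvC b hb, hx']
  intro a ha b hb v hv
  rw [Set.mem_compl_iff, not_not] at hv
  rcases hv with (hv | hv) | hv
  · exact key2 v hv a ha b hb
  · exact hC a (fun h' => ha (by simp [h'])) b (fun h' => hb (by simp [h'])) v (by simpa using hv)
  · have haD : a ∉ D := fun h' => ha (by simp [h'])
    have hbD : b ∉ D := fun h' => hb (by simp [h'])
    rcases hD with hD | hD
    · obtain ⟨d, hdM, hdD⟩ := h.exists_mem_inter hM hD.1 hD.2.1 hyD hxD
      rw [hD.1.arc_left hv hdD haD, hD.1.arc_left hv hdD hbD]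
      exact key2 d hdM a ha b hb
    · exact hD.1 a haD b hbD v (by simpa using hv)

lemma isModule_compl_union_of_compl_right (h : T.SplitModule x y M) (hM : M.Nontrivial)
    {C D : Set V} (hC : T.IsModule C) (hD : T.IsModule Dᶜ) (hxC : x ∈ C) (hyD : y ∈ D)
    (hCD : Disjoint C D) : T.IsModule (M ∪ C ∪ D)ᶜ := by
  have hxD := Set.disjoint_left.1 hCD hxC
  obtain ⟨u, hu, hux⟩ := hM.exists_ne x
  have huD : u ∈ D := by
    by_contra h'
    exact hux (h.eq_of_mem_of_mem hD hxD (by simpa using hyD) h' hu)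
  have keyx : ∀ a ∈ (M ∪ C ∪ D)ᶜ, ∀ b ∈ (M ∪ C ∪ D)ᶜ, (T.Arc x a ↔ T.Arc x b) := by
    intro a ha b hb
    have e : ∀ a ∈ (M ∪ C ∪ D)ᶜ, (T.Arc x a ↔ T.Arc u a) := by
      intro a ha
      simp only [Set.mem_compl_iff, Set.mem_union, not_or] at ha
      exact h.uniform_left ha.1.1 (fun e => ha.2 (e ▸ hyD)) h.left_mem hu
    rw [e a ha, e b hb]
    exact hD a (fun h' => ha (by simp [h'])) b (fun h' => hb (by simp [h'])) u (by simpa using huD)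
  intro a ha b hb v hv
  rw [Set.mem_compl_iff, not_not] at hv
  have haC : a ∉ C := fun h' => ha (by simp [h'])
  have hbC : b ∉ C := fun h' => hb (by simp [h'])
  have hco : v ∈ D → (T.Arc v a ↔ T.Arc v b) := fun hv =>
    hD a (fun h' => ha (by simp [h'])) b (fun h' => hb (by simp [h'])) v (by simpa using hv)
  rcases hv with (hv | hv) | hv
  · by_cases hvD : v ∈ D
    · exact hco hvD
    · rw [h.eq_of_mem_of_mem hD hxD (by simpa using hyD) hvD hv]
      exact keyx a ha b hb
  · rw [hC.arc_left hv hxC haC, hC.arc_left hv hxC hbC]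
    exact keyx a ha b hb
  · exact hco hv

lemma isModule_diff (h : T.SplitModule x y M)
    {C D : Set V} (hC : T.IsComodule C) (hD : T.IsComodule D) (hxC : x ∈ C) (hyD : y ∈ D)
    (hCD : Disjoint C D) : T.IsModule (M \ (C ∪ D)) := by
  have hyC := Set.disjoint_right.1 hCD hyD
  have keyy : ∀ a ∈ M \ (C ∪ D), ∀ b ∈ M \ (C ∪ D), (T.Arc y a ↔ T.Arc y b) := by
    intro a ha b hb
    have hax : a ≠ x := fun e => ha.2 (Or.inl (e ▸ hxC))
    have hbx : b ≠ x := fun e => hb.2 (Or.inl (e ▸ hxC))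
    rw [h.opposite a ha.1 hax, h.opposite b hb.1 hbx]
  intro a ha b hb v hv
  have haC : a ∉ C := fun h' => ha.2 (Or.inl h')
  have hbC : b ∉ C := fun h' => hb.2 (Or.inl h')
  have haD : a ∉ D := fun h' => ha.2 (Or.inr h')
  have hbD : b ∉ D := fun h' => hb.2 (Or.inr h')
  by_cases hvM : v ∈ M
  · have hv' : v ∈ C ∪ D := by by_contra h'; exact hv ⟨hvM, h'⟩
    rcases hv' with hv' | hv'
    · rcases hC with hC | hC
      · rw [h.eq_of_mem_of_mem hC.1 hxC hyC hv' hvM]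
        obtain ⟨e, he, hex⟩ := hC.2.1.exists_ne x
        have heM : e ∉ M := fun h' => hex (h.eq_of_mem_of_mem hC.1 hxC hyC he h')
        rw [hC.1.arc_left hxC he haC, hC.1.arc_left hxC he hbC]
        exact h.uniform e heM (fun e' => hyC (e' ▸ he)) a ha.1 b hb.1
      · exact hC.1 a haC b hbC v (by simpa using hv')
    · rcases hD with hD | hD
      · rw [hD.1.arc_left hv' hyD haD, hD.1.arc_left hv' hyD hbD]
        exact keyy a ha b hb
      · exact hD.1 a haD b hbD v (by simpa using hv')
  · by_cases hvy : v = y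
    · rw [hvy]; exact keyy a ha b hb
    · exact h.uniform v hvM hvy a ha.1 b hb.1

/-- The union of `M` with disjoint co-modules around `x` and `y` is a module of the original
tournament or the complement of one. -/
lemma isModule_union_or_compl (h : T.SplitModule x y M) (hM : M.Nontrivial) {C D : Set V}
    (hC : T.IsComodule C) (hD : T.IsComodule D) (hxC : x ∈ C) (hyD : y ∈ D)
    (hCD : Disjoint C D) : T.IsModule (M ∪ C ∪ D) ∨ T.IsModule (M ∪ C ∪ D)ᶜ := by
  rcases hC with hC' | hC'
  · rcases hD with hD' | hD'
    · exact Or.inl (h.isModule_union hM hC'.1 hD'.1 hD'.2.1 hxC hyD hCD)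
    · exact Or.inr (h.isModule_compl_union_of_compl_right hM hC'.1 hD'.1 hxC hyD hCD)
  · exact Or.inr (h.isModule_compl_union_of_compl_left hM hC'.1 hD hxC hyD hCD)

end SplitModule

/-! ### Reversing an arc between two points of a transversal -/

/-- If `F ∩ X = {x, y}` for no nontrivial co-module `F`, a nontrivial module created by reversing
the arc between `x` and `y` is still met, as is its complement, by `X \ {x, y}`: otherwise
the union of that module with the co-modules isolating `x` and `y` would be such an `F`. -/
lemma SplitModule.hits {T : Tournament V} {X M : Set V} {x y u v : V} (h : T.SplitModule x y M)
    (hM : M.Nontrivial) (hx : x ∈ X) (hy : y ∈ X) (hu : u ∈ X \ {x, y})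
    (hv : v ∈ X \ {x, y}) (huv : u ≠ v) {C D : Set V} (hC : T.IsComodule C) (hD : T.IsComodule D)
    (hCD : Disjoint C D) (hCX : C ∩ X = {x}) (hDX : D ∩ X = {y})
    (hF : ∀ F, T.IsComodule F → F ∩ X ≠ {x, y}) :
    (M ∩ (X \ {x, y})).Nonempty ∧ (Mᶜ ∩ (X \ {x, y})).Nonempty := by
  have hxC : x ∈ C := (hCX.symm ▸ rfl : x ∈ C ∩ X).1
  have hyD : y ∈ D := (hDX.symm ▸ rfl : y ∈ D ∩ X).1
  have hC' : ∀ w ∈ X, w ∈ C → w = x := fun w hw hwC => by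
    have : w ∈ C ∩ X := ⟨hwC, hw⟩
    rwa [hCX] at this
  have hD' : ∀ w ∈ X, w ∈ D → w = y := fun w hw hwD => by
    have : w ∈ D ∩ X := ⟨hwD, hw⟩
    rwa [hDX] at this
  have hout : ∀ w ∈ X \ {x, y}, w ∉ C ∧ w ∉ D := by
    intro w hw
    simp only [Set.mem_sdiff, Set.mem_insert_iff, Set.mem_singleton_iff, not_or] at hw
    exact ⟨fun h' => hw.2.1 (hC' w hw.1 h'), fun h' => hw.2.2 (hD' w hw.1 h')⟩
  constructor
  · by_contra hemp
    have hMX : ∀ w ∈ X \ {x, y}, w ∉ M := fun w hw hwM => hemp ⟨w, hwM, hw⟩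
    have huF : u ∉ M ∪ C ∪ D := by
      have := hout u hu; have := hMX u hu; simp; tauto
    have hvF : v ∉ M ∪ C ∪ D := by
      have := hout v hv; have := hMX v hv; simp; tauto
    refine hF (M ∪ C ∪ D) ?_ ?_
    · rcases h.isModule_union_or_compl hM hC hD hxC hyD hCD with h1 | h1
      · exact Or.inl ⟨h1, ⟨x, by simp [hxC], y, by simp [hyD], h.ne⟩, ⟨u, huF⟩⟩
      · exact Or.inr ⟨h1, ⟨u, huF, v, hvF, huv⟩, ⟨x, by simp [hxC]⟩⟩
    · ext w
      constructor
      · rintro ⟨hw, hwX⟩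
        by_contra hw'
        have h1 := hout w ⟨hwX, hw'⟩
        have h2 := hMX w ⟨hwX, hw'⟩
        simp at hw; tauto
      · rintro (rfl | rfl)
        · exact ⟨by simp [hxC], hx⟩
        · exact ⟨by simp [hyD], hy⟩
  · by_contra hemp
    have hMX : ∀ w ∈ X \ {x, y}, w ∈ M := fun w hw => by
      by_contra hwM; exact hemp ⟨w, hwM, hw⟩
    have hG : ∀ w ∈ X \ {x, y}, w ∈ M \ (C ∪ D) := fun w hw =>
      ⟨hMX w hw, by have := hout w hw; simp; tauto⟩
    refine hF (M \ (C ∪ D))ᶜ (Or.inr ?_) ?_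
    · rw [compl_compl]
      exact ⟨h.isModule_diff hC hD hxC hyD hCD, ⟨u, hG u hu, v, hG v hv, huv⟩,
        ⟨x, fun h' => h'.2 (Or.inl hxC)⟩⟩
    · ext w
      constructor
      · rintro ⟨hw, hwX⟩
        by_contra hw'
        exact hw (hG w ⟨hwX, hw'⟩)
      · rintro (rfl | rfl)
        · exact ⟨fun h' => h'.2 (Or.inl hxC), hx⟩
        · exact ⟨fun h' => h'.2 (Or.inr hyD), hy⟩

/-- If no nontrivial co-module meets the transversal `X` in exactly `{x, y}`, then `X \ {x, y}` is
a transversal once the arc between `x` and `y` is reversed. -/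
lemma Hits.flipArc {T : Tournament V} {X : Set V} (hX : T.Hits X) {x y u v : V}
    (hx : x ∈ X) (hy : y ∈ X) (hu : u ∈ X \ {x, y})
    (hv : v ∈ X \ {x, y}) (huv : u ≠ v) {C D : Set V} (hC : T.IsComodule C) (hD : T.IsComodule D)
    (hCD : Disjoint C D) (hCX : C ∩ X = {x}) (hDX : D ∩ X = {y})
    (hF : ∀ F, T.IsComodule F → F ∩ X ≠ {x, y}) : (T.flipArc x y).Hits (X \ {x, y}) := by
  intro M hM
  by_cases hsep : x ∈ M ↔ y ∈ M
  · rw [isNontrivialModule_flipArc_iff hsep] at hM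
    have key : ∀ F, T.IsComodule F → (x ∈ F ↔ y ∈ F) → (F ∩ (X \ {x, y})).Nonempty := by
      intro F hFc hs
      by_contra hemp
      have hFX : ∀ w ∈ F, w ∈ X → w = x ∨ w = y := by
        intro w hw hwX
        by_contra hw'
        exact hemp ⟨w, hw, hwX, hw'⟩
      obtain ⟨w, hwF, hwX⟩ := hX.inter_nonempty hFc
      have hxF : x ∈ F ∧ y ∈ F := by
        rcases hFX w hwF hwX with rfl | rfl <;> tauto
      refine hF F hFc ?_
      ext w
      constructor
      · rintro ⟨h1, h2⟩; exact hFX w h1 h2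
      · rintro (rfl | rfl)
        · exact ⟨hxF.1, hx⟩
        · exact ⟨hxF.2, hy⟩
    exact ⟨key M (Or.inl hM) hsep, key Mᶜ (IsComodule.compl (Or.inl hM)) (not_congr hsep)⟩
  · by_cases hxM : x ∈ M
    · have hyM : y ∉ M := by tauto
      exact (splitModule_of_flipArc hM.1 hxM hyM).hits hM.2.1 hx hy hu hv huv hC hD hCD hCX hDX hF
    · have hyM : y ∈ M := by tauto
      rw [flipArc_comm] at hM
      rw [Set.pair_comm x y] at hu hv hF ⊢
      exact (splitModule_of_flipArc hM.1 hyM hxM).hits hM.2.1 hy hx hu hv huv hD hC hCD.symm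
        hDX hCX hF

lemma IsComodule.four_points {T : Tournament V} {F : Set V} (hF : T.IsComodule F) {a b c d : V}
    (ha : a ∈ F) (hb : b ∈ F) (hc : c ∉ F) (hd : d ∉ F) :
    ((T.Arc a c ↔ T.Arc b c) ∧ (T.Arc a d ↔ T.Arc b d)) ∨
      ((T.Arc a c ↔ T.Arc a d) ∧ (T.Arc b c ↔ T.Arc b d)) := by
  rcases hF with h | h
  · exact Or.inl ⟨h.1.arc_left ha hb hc, h.1.arc_left ha hb hd⟩
  · exact Or.inr ⟨h.1 c hc d hd a (by simpa using ha), h.1 c hc d hd b (by simpa using hb)⟩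

/-- The three ways of pairing four vertices cannot all be realized by co-modules. -/
lemma not_three_pairings {T : Tournament V} {x y z w : V} (hxy : x ≠ y) (hyz : y ≠ z)
    (hxz : x ≠ z) {F G H : Set V}
    (hF : T.IsComodule F) (hG : T.IsComodule G) (hH : T.IsComodule H)
    (hFx : x ∈ F) (hFy : y ∈ F) (hFz : z ∉ F) (hFw : w ∉ F)
    (hGx : x ∉ G) (hGy : y ∈ G) (hGz : z ∈ G) (hGw : w ∉ G)
    (hHx : x ∈ H) (hHy : y ∉ H) (hHz : z ∈ H) (hHw : w ∉ H) : False := by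
  have h1 := hF.four_points hFx hFy hFz hFw
  have h2 := hG.four_points hGy hGz hGx hGw
  have h3 := hH.four_points hHx hHz hHy hHw
  have a1 := T.arc_iff x y hxy
  have a2 := T.arc_iff y z hyz
  have a3 := T.arc_iff x z hxz
  rw [a2, a3] at h1
  rw [a1] at h3
  by_cases b1 : T.Arc y x <;> by_cases b2 : T.Arc z y <;> by_cases b3 : T.Arc z x <;>
    by_cases b4 : T.Arc x w <;> by_cases b5 : T.Arc y w <;> by_cases b6 : T.Arc z w <;>
    simp_all

/-! ### A transversal and a packing of the same size -/

/-- `C` is an inclusion-minimal nontrivial co-module. -/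
def IsMinComodule (T : Tournament V) (C : Set V) : Prop :=
  T.IsComodule C ∧ ∀ D, T.IsComodule D → D ⊆ C → D = C

lemma IsComodule.exists_minComodule [Finite V] {T : Tournament V} {C : Set V}
    (hC : T.IsComodule C) : ∃ D ⊆ C, T.IsMinComodule D := by
  obtain ⟨D, hDC, hD⟩ := (Set.toFinite {D | T.IsComodule D}).exists_le_minimal hC
  exact ⟨D, hDC, hD.1, fun E hE hED => le_antisymm hED (hD.2 hE hED)⟩

/-- The relation between `{a, b}` and `{b, c}` when these are minimal co-modules and
`a → b → c`. -/
def Precedes (T : Tournament V) (C D : Set V) : Prop :=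
  ∃ a b c, C = {a, b} ∧ D = {b, c} ∧ T.IsModule C ∧ T.IsModule D ∧
    T.Arc a b ∧ T.Arc b c ∧ T.Arc a c

lemma isComodule_of_isModule {T : Tournament V} {M : Set V} (h : T.IsModule M) {a b c : V}
    (ha : a ∈ M) (hb : b ∈ M) (hab : a ≠ b) (hc : c ∉ M) : T.IsComodule M :=
  Or.inl ⟨h, ⟨a, ha, b, hb, hab⟩, ⟨c, hc⟩⟩

lemma IsMinComodule.precedes_or {T : Tournament V} {C D : Set V} (hC : T.IsMinComodule C)
    (hD : T.IsMinComodule D) (hne : C ≠ D) (hCD : (C ∩ D).Nonempty) :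
    T.Precedes C D ∨ T.Precedes D C := by
  obtain ⟨b, hbC, hbD⟩ := hCD
  have hCsub : ¬ C ⊆ D := fun h => hne (hD.2 C hC.1 h)
  have hDsub : ¬ D ⊆ C := fun h => hne (hC.2 D hD.1 h).symm
  obtain ⟨a, haC, haD⟩ := Set.not_subset.1 hCsub
  obtain ⟨c, hcD, hcC⟩ := Set.not_subset.1 hDsub
  have hab : a ≠ b := fun e => haD (e ▸ hbD)
  have hbc : b ≠ c := fun e => hcC (e ▸ hbC)
  have hac : a ≠ c := fun e => haD (e ▸ hcD)
  obtain ⟨e, he⟩ : ∃ e, e ∉ C ∪ D := by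
    by_contra hcon
    push Not at hcon
    have hsub : Cᶜ ⊆ D := fun v hv => (hcon v).resolve_left hv
    have := hD.2 _ hC.1.compl hsub
    rw [← this] at hbD
    exact hbD hbC
  simp only [Set.mem_union, not_or] at he
  -- Mixed case: the part of the co-module outside the module would be a smaller co-module.
  have mixed : ∀ C D : Set V, T.IsModule C → T.IsModule Dᶜ → T.IsMinComodule D →
      (∃ b, b ∈ C ∧ b ∈ D) → (∃ a, a ∈ C ∧ a ∉ D) → (∃ c, c ∈ D ∧ c ∉ C) →
      (∃ e, e ∉ C ∧ e ∉ D) → False := by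
    rintro C D hCm hDm hD ⟨b, hbC, hbD⟩ ⟨a, haC, haD⟩ ⟨c, hcD, hcC⟩ ⟨e, heC, heD⟩
    have h1 : T.IsModule (C ∪ Dᶜ) := hCm.union hDm ⟨a, haC, haD⟩
    have h2 : T.IsComodule (C ∪ Dᶜ)ᶜ := (isComodule_of_isModule h1 (a := b) (b := e) (c := c)
      (Or.inl hbC) (Or.inr heD) (fun h => heC (h ▸ hbC)) (by simp [hcC, hcD])).compl
    have h3 := hD.2 _ h2 (by intro v; simp)
    rw [← h3] at hbD
    simp [hbC] at hbD
  rcases hC.1 with hCm | hCm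
  · rcases hD.1 with hDm | hDm
    · have small : ∀ {C : Set V} {M : Set V}, T.IsMinComodule C → M ⊆ C → T.IsModule M →
          ∀ z ∈ C, z ∉ M → ∀ p ∈ M, ∀ q ∈ M, p = q := by
        intro C M hC hMC hM z hz hzM p hp q hq
        by_contra hpq
        have := hC.2 M (isComodule_of_isModule hM hp hq hpq hzM) hMC
        rw [this] at hzM
        exact hzM hz
      have s1 := small hC Set.inter_subset_left (hCm.1.inter hDm.1) a haC (fun h => haD h.2)
      have s2 := small hC Set.sdiff_subset (hCm.1.diff hDm.1 ⟨c, hcD, hcC⟩) b hbC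
        (fun h => h.2 hbD)
      have s3 := small hD Set.sdiff_subset (hDm.1.diff hCm.1 ⟨a, haC, haD⟩) b hbD
        (fun h => h.2 hbC)
      have eC : C = {a, b} := by
        ext v
        constructor
        · intro hv
          by_cases hvD : v ∈ D
          · exact Or.inr (s1 v ⟨hv, hvD⟩ b ⟨hbC, hbD⟩)
          · exact Or.inl (s2 v ⟨hv, hvD⟩ a ⟨haC, haD⟩)
        · rintro (rfl | rfl) <;> assumption
      have eD : D = {b, c} := by
        ext v
        constructor
        · intro hv
          by_cases hvC : v ∈ C
          · exact Or.inl (s1 v ⟨hvC, hv⟩ b ⟨hbC, hbD⟩)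
          · exact Or.inr (s3 v ⟨hv, hvC⟩ c ⟨hcD, hcC⟩)
        · rintro (rfl | rfl) <;> assumption
      have h1 := hDm.1 b hbD c hcD a haD
      have h2 := hCm.1.arc_left haC hbC hcC
      rcases T.arc_or_arc hab with h | h
      · exact Or.inl ⟨a, b, c, eC, eD, hCm.1, hDm.1, h, h2.1 (h1.1 h), h1.1 h⟩
      · refine Or.inr ⟨c, b, a, by rw [eD, Set.pair_comm], by rw [eC, Set.pair_comm], hDm.1,
          hCm.1, ?_, h, ?_⟩
        · have h3 := T.arc_iff a b hab
          have h4 := T.arc_iff b c hbc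
          tauto
        · have h3 := T.arc_iff a b hab
          have h4 := T.arc_iff a c hac
          tauto
    · exact (mixed C D hCm.1 hDm.1 hD ⟨b, hbC, hbD⟩ ⟨a, haC, haD⟩ ⟨c, hcD, hcC⟩ ⟨e, he⟩).elim
  · rcases hD.1 with hDm | hDm
    · exact (mixed D C hDm.1 hCm.1 hC ⟨b, hbD, hbC⟩ ⟨c, hcD, hcC⟩ ⟨a, haC, haD⟩
        ⟨e, he.2, he.1⟩).elim
    · have h1 : T.IsModule (Cᶜ ∪ Dᶜ) := hCm.1.union hDm.1 ⟨e, he⟩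
      have h2 : T.IsComodule (C ∩ D) := by
        have := (isComodule_of_isModule h1 (a := a) (b := e) (c := b) (Or.inr haD)
          (Or.inl he.1) (fun h => he.1 (h ▸ haC)) (by simp [hbC, hbD])).compl
        rwa [← Set.compl_inter, compl_compl] at this
      have h3 := hC.2 _ h2 Set.inter_subset_left
      rw [← h3] at haC
      exact (haD haC.2).elim

/-- The number of vertices dominated by a member of `C`. -/
noncomputable def outCount (T : Tournament V) (C : Set V) : ℕ := {v | ∃ u ∈ C, T.Arc u v}.ncard

lemma Precedes.outCount_lt [Finite V] {T : Tournament V} {C D : Set V} (h : T.Precedes C D) :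
    T.outCount D < T.outCount C := by
  obtain ⟨a, b, c, rfl, rfl, hC, hD, hab, hbc, hac⟩ := h
  apply Set.ncard_lt_ncard _ (Set.toFinite _)
  have key : ∀ v, T.Arc b v → T.Arc a v := by
    intro v hv
    by_cases hva : v = a
    · exact absurd hv (by rw [hva]; exact hab.asymm)
    · exact (hC.arc_left (by simp) (by simp) (by simp [hva, hv.ne.symm])).1 hv
  refine ⟨?_, ?_⟩
  · rintro v ⟨u, (rfl | rfl), hv⟩
    · exact ⟨a, by simp, key v hv⟩
    · by_cases hvb : v = b
      · exact ⟨a, by simp, hvb ▸ hab⟩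
      · refine ⟨a, by simp, key v ?_⟩
        exact (hD.arc_left (by simp) (by simp) (by simp [hvb, hv.ne.symm])).1 hv
  · intro hsub
    obtain ⟨u, (rfl | rfl), hv⟩ := hsub (show b ∈ _ from ⟨a, by simp, hab⟩)
    · exact T.irrefl _ hv
    · exact hv.asymm hbc

/-- A packing of minimal co-modules together with a transversal that picks one vertex from each
of them. -/
structure PackedTransversal (T : Tournament V) (X : Set V) (P : V → Set V) : Prop where
  hits : T.Hits X
  mem : ∀ x ∈ X, x ∈ P x
  min : ∀ x ∈ X, T.IsMinComodule (P x)
  disj : ∀ x ∈ X, ∀ y ∈ X, x ≠ y → Disjoint (P x) (P y)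

lemma PackedTransversal.inter_eq {T : Tournament V} {X : Set V} {P : V → Set V}
    (h : T.PackedTransversal X P) {x : V} (hx : x ∈ X) : P x ∩ X = {x} := by
  ext w
  constructor
  · rintro ⟨hw, hwX⟩
    by_contra hne
    exact Set.disjoint_left.1 (h.disj x hx w hwX (Ne.symm hne)) hw (h.mem w hwX)
  · rintro rfl
    exact ⟨h.mem _ hx, hx⟩

/-- The packing is the kernel of the relation `Precedes`, and from each of its members `{a, b}`
that has a successor `{b, c}` the transversal takes the common vertex `b`. -/
theorem exists_packedTransversal [Finite V] (T : Tournament V) :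
    ∃ X P, T.PackedTransversal X P := by
  rcases isEmpty_or_nonempty V with hV | hV
  · exact ⟨∅, fun _ => ∅, fun M hM => (hV.false hM.2.1.nonempty.some).elim, by simp, by simp,
      by simp⟩
  let r : Set V → Set V → Prop := fun C D => T.Precedes C D
  have wf : WellFounded r := by
    refine Subrelation.wf (r := InvImage (· < ·) fun C => Nat.card V - T.outCount C) ?_
      (InvImage.wf _ wellFounded_lt)
    intro C D h
    have h1 := Precedes.outCount_lt h
    have h2 : T.outCount C ≤ Nat.card V := by
      rw [← Set.ncard_univ]; exact Set.ncard_le_ncard (Set.subset_univ _)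
    simp only [InvImage]; omega
  let K : Set V → Prop := wf.fix fun C ih => T.IsMinComodule C ∧ ∀ D (h : r D C), ¬ ih D h
  have hK : ∀ C, K C ↔ T.IsMinComodule C ∧ ∀ D, r D C → ¬ K D := by
    intro C
    have := wf.fix_eq (fun C ih => T.IsMinComodule C ∧ ∀ D (h : r D C), ¬ ih D h) C
    exact iff_of_eq this
  have hdisj : ∀ C D, K C → K D → C ≠ D → Disjoint C D := by
    intro C D hC hD hne
    rw [Set.disjoint_iff_inter_eq_empty, ← Set.not_nonempty_iff_eq_empty]
    intro h
    rcases ((hK C).1 hC).1.precedes_or ((hK D).1 hD).1 hne h with h | h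
    · exact ((hK D).1 hD).2 C h hC
    · exact ((hK C).1 hC).2 D h hD
  have hp : ∀ C, K C → ∃ p ∈ C, ∀ D, r C D → p ∈ D := by
    intro C hC
    by_cases h : ∃ D, r C D
    · obtain ⟨D, a, b, c, hCe, hDe, hCm, hDm, hab, hbc, hac⟩ := h
      refine ⟨b, by simp [hCe], ?_⟩
      rintro E ⟨a', b', c', hCe', hEe, -, -, hab', -, -⟩
      have hb : b = b' := by
        have ha' : b ∈ ({a', b'} : Set V) := by rw [← hCe', hCe]; simp
        have ha'' : a ∈ ({a', b'} : Set V) := by rw [← hCe', hCe]; simp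
        rcases ha' with h1 | h1
        · rcases ha'' with h2 | h2
          · exact absurd (h2.trans h1.symm) hab.ne
          · rw [h2, h1] at hab; exact absurd hab' hab.asymm
        · exact h1
      rw [hEe, hb]; simp
    · obtain ⟨p, hpC⟩ := ((hK C).1 hC).1.1.nonempty
      exact ⟨p, hpC, fun D hD => (h ⟨D, hD⟩).elim⟩
  choose! p hpC hpD using hp
  have hpinj : ∀ C D, K C → K D → p C = p D → C = D := by
    intro C D hC hD h
    by_contra hne
    exact Set.disjoint_left.1 (hdisj C D hC hD hne) (hpC C hC) (h ▸ hpC D hD)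
  have hex : ∀ x, ∃ C, x ∈ p '' {C | K C} → K C ∧ p C = x := by
    intro x
    by_cases h : x ∈ p '' {C | K C}
    · obtain ⟨C, hC, e⟩ := h
      exact ⟨C, fun _ => ⟨hC, e⟩⟩
    · exact ⟨∅, fun h' => (h h').elim⟩
  choose P hP using hex
  refine ⟨p '' {C | K C}, P, ?_, ?_, ?_, ?_⟩
  · have key : ∀ C, T.IsComodule C → (C ∩ p '' {C | K C}).Nonempty := by
      intro C hC
      obtain ⟨D, hDC, hD⟩ := hC.exists_minComodule
      by_cases hKD : K D
      · exact ⟨p D, hDC (hpC D hKD), D, hKD, rfl⟩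
      · rw [hK] at hKD
        push Not at hKD
        obtain ⟨E, hED, hKE⟩ := hKD hD
        exact ⟨p E, hDC (hpD E hKE D hED), E, hKE, rfl⟩
    intro M hM
    exact ⟨key M (Or.inl hM), key _ (IsComodule.compl (Or.inl hM))⟩
  · intro x hx
    obtain ⟨h1, h2⟩ := hP x hx
    have := hpC _ h1
    rwa [h2] at this
  · intro x hx
    exact ((hK _).1 (hP x hx).1).1
  · intro x hx y hy hne
    apply hdisj _ _ (hP x hx).1 (hP y hy).1
    intro e
    apply hne
    rw [← (hP x hx).2, ← (hP y hy).2, e]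

/-! ### Tournaments with a transversal of three vertices -/

lemma Hits.exists_mem_pair {T : Tournament V} {x y : V} (h : T.Hits {x, y}) {C : Set V}
    (hC : T.IsComodule C) : x ∈ C ∨ y ∈ C := by
  obtain ⟨w, hw, rfl | rfl⟩ := h.inter_nonempty hC
  · exact Or.inl hw
  · exact Or.inr hw

lemma Hits.exists_mem_triple {T : Tournament V} {x y z : V} (h : T.Hits {x, y, z}) {C : Set V}
    (hC : T.IsComodule C) : x ∈ C ∨ y ∈ C ∨ z ∈ C := by
  obtain ⟨w, hw, rfl | rfl | rfl⟩ := h.inter_nonempty hC <;> tauto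

lemma hits_pair {T : Tournament V} {x y : V}
    (h : ∀ M, T.IsNontrivialModule M → (x ∈ M ∨ y ∈ M) ∧ (x ∉ M ∨ y ∉ M)) : T.Hits {x, y} := by
  intro M hM
  obtain ⟨h1, h2⟩ := h M hM
  constructor
  · rcases h1 with h1 | h1
    · exact ⟨x, h1, by simp⟩
    · exact ⟨y, h1, by simp⟩
  · rcases h2 with h2 | h2
    · exact ⟨x, h2, by simp⟩
    · exact ⟨y, h2, by simp⟩

lemma Hits.flipArc_pair {T : Tournament V} {x y z : V} (hX : T.Hits {x, y, z})
    (h1 : ∀ M, M.Nontrivial → T.SplitModule x y M → z ∉ M)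
    (h2 : ∀ M, M.Nontrivial → T.SplitModule y x M → z ∈ M) :
    (T.flipArc x y).Hits {x, z} := by
  apply hits_pair
  intro M hM
  by_cases hx : x ∈ M <;> by_cases hy : y ∈ M
  · rw [isNontrivialModule_flipArc_iff (by tauto)] at hM
    have := hX.exists_mem_triple (IsComodule.compl (Or.inl hM))
    simp only [Set.mem_compl_iff] at this
    tauto
  · have := h1 M hM.2.1 (splitModule_of_flipArc hM.1 hx hy)
    tauto
  · rw [flipArc_comm] at hM
    have := h2 M hM.2.1 (splitModule_of_flipArc hM.1 hy hx)
    tauto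
  · rw [isNontrivialModule_flipArc_iff (by tauto)] at hM
    have := hX.exists_mem_triple (Or.inl hM)
    tauto

lemma Hits.flipArc_of_linear {T : Tournament V} {x y z : V} (hX : T.Hits {x, y, z})
    {A B C : Set V} (hx : x ∈ A) (hy : y ∈ C) (hz : z ∈ B) (hcov : ∀ v, v ∈ A ∨ v ∈ B ∨ v ∈ C)
    (hAB : ∀ a ∈ A, ∀ b ∈ B, T.Arc a b) (hBC : ∀ a ∈ B, ∀ b ∈ C, T.Arc a b)
    (hAC : ∀ a ∈ A, ∀ b ∈ C, T.Arc a b) : (T.flipArc x y).Hits {x, z} := by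
  apply hX.flipArc_pair
  · intro M _ h hzM
    exact ((h.opposite z hzM (hAB x hx z hz).ne.symm).2 (hAC x hx y hy)).asymm (hBC z hz y hy)
  · intro M hM h
    obtain ⟨u, hu, huy⟩ := hM.exists_ne y
    have hxu : ¬ T.Arc x u := fun h' => (hAC x hx y hy).asymm ((h.opposite u hu huy).1 h')
    have huA : u ∈ A := by
      rcases hcov u with h1 | h1 | h1
      · exact h1
      · exact absurd (hAB x hx u h1) hxu
      · exact absurd (hAC x hx u h1) hxu
    by_contra hzM
    have := h.uniform z hzM (hAB x hx z hz).ne.symm u hu y h.left_mem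
    exact (hAB u huA z hz).asymm (this.2 (hBC z hz y hy))

lemma not_splitModule_of_cyclic {T : Tournament V} {x y z : V} {A B C M : Set V}
    (hA : T.IsModule A) (hAn : A.Nontrivial) (hBn : B.Nontrivial)
    (hx : x ∈ A) (hy : y ∈ B) (hz : z ∈ C) (hcov : ∀ v, v ∈ A ∨ v ∈ B ∨ v ∈ C)
    (hAB : ∀ a ∈ A, ∀ b ∈ B, T.Arc a b) (hBC : ∀ a ∈ B, ∀ b ∈ C, T.Arc a b)
    (hCA : ∀ a ∈ C, ∀ b ∈ A, T.Arc a b) (hM : M.Nontrivial) : ¬ T.SplitModule x y M := by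
  intro h
  have hyA : y ∉ A := fun h' => T.irrefl y (hAB y h' y hy)
  have hMA : ∀ a ∈ A, a ∈ M → a = x := fun a ha haM => h.eq_of_mem_of_mem hA hx hyA ha haM
  obtain ⟨x', hx', hxx'⟩ := hAn.exists_ne x
  obtain ⟨u, hu, huy⟩ := hBn.exists_ne y
  have hMC : ∀ p ∈ C, p ∉ M := by
    intro p hp hpM
    by_cases huM : u ∈ M
    · have := h.uniform x' (fun h' => hxx' (hMA x' hx' h')) (hAB x' hx' y hy).ne u huM p hpM
      exact (this.1 (hAB x' hx' u hu)).asymm (hCA p hp x' hx')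
    · have := h.uniform u huM huy p hpM x h.left_mem
      exact (hAB x hx u hu).asymm (this.1 (hBC u hu p hp))
  obtain ⟨m, hm, hmx⟩ := hM.exists_ne x
  have hmB : m ∈ B := by
    rcases hcov m with h1 | h1 | h1
    · exact absurd (hMA m h1 hm) hmx
    · exact h1
    · exact absurd hm (hMC m h1)
  have := h.uniform z (hMC z hz) (hBC y hy z hz).ne.symm m hm x h.left_mem
  exact (hBC m hmB z hz).asymm (this.2 (hCA z hz x hx))

lemma Hits.flipArc_of_cyclic {T : Tournament V} {x y z : V} (hX : T.Hits {x, y, z})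
    {A B C : Set V} (hA : T.IsModule A) (hB : T.IsModule B) (hAn : A.Nontrivial)
    (hBn : B.Nontrivial) (hx : x ∈ A) (hy : y ∈ B) (hz : z ∈ C)
    (hcov : ∀ v, v ∈ A ∨ v ∈ B ∨ v ∈ C)
    (hAB : ∀ a ∈ A, ∀ b ∈ B, T.Arc a b) (hBC : ∀ a ∈ B, ∀ b ∈ C, T.Arc a b)
    (hCA : ∀ a ∈ C, ∀ b ∈ A, T.Arc a b) : (T.flipArc x y).Hits {x, z} := by
  apply hX.flipArc_pair
  · intro M hM h
    exact (not_splitModule_of_cyclic hA hAn hBn hx hy hz hcov hAB hBC hCA hM h).elim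
  · intro M hM h
    exact (not_splitModule_of_cyclic (T := T.dual) (isModule_dual.2 hB) hBn hAn hy hx hz
      (fun v => by have := hcov v; tauto) (fun a ha b hb => hAB b hb a ha)
      (fun a ha b hb => hCA b hb a ha) (fun a ha b hb => hBC b hb a ha) hM h.dual).elim

lemma Hits.flipArc_of_module_union {T : Tournament V} {x y z n : V} (hX : T.Hits {x, y, z})
    {A B : Set V} (hAB : ∀ a ∈ A, ∀ b ∈ B, T.Arc a b) (hN : T.IsModule (A ∪ B)) (hx : x ∈ A)
    (hy : y ∈ B) (hz : z ∉ A ∪ B) (hn : n ∈ A) (hnx : T.Arc n x) :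
    (T.flipArc z x).Hits {z, y} := by
  have hxy := hAB x hx y hy
  have hX' : T.Hits {z, x, y} := by
    convert hX using 1
    ext; simp; tauto
  apply hX'.flipArc_pair
  · intro M _ h hyM
    have hyz : y ≠ z := fun e => hz (e ▸ Or.inr hy)
    have hzx := (h.opposite y hyM hyz).1 hxy
    have hnz : n ≠ z := fun e => hz (e ▸ Or.inl hn)
    have hnM : n ∉ M := fun h' => hnx.asymm ((h.opposite n h' hnz).2 hzx)
    have h1 := h.uniform n hnM hnx.ne y hyM z h.left_mem
    have h2 := hN n (Or.inl hn) x (Or.inl hx) z hz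
    exact (h1.1 (hAB n hn y hy)).asymm (h2.2 hzx)
  · intro M hM h
    obtain ⟨u, hu, hux⟩ := hM.exists_ne x
    have hMN : ∀ a ∈ A ∪ B, a ∈ M → a = x := fun a ha haM =>
      h.eq_of_mem_of_mem hN (Or.inl hx) hz ha haM
    have huN : u ∉ A ∪ B := fun h' => hux (hMN u h' hu)
    have hnM : n ∉ M := fun h' => hnx.ne (hMN n (Or.inl hn) h')
    have hnz : n ≠ z := fun e => hz (e ▸ Or.inl hn)
    have hyz : y ≠ z := fun e => hz (e ▸ Or.inr hy)
    by_contra hyM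
    have h1 := (h.uniform n hnM hnz x h.left_mem u hu).1 hnx
    have h2 := (hN.arc_left (Or.inl hn) (Or.inr hy) huN).1 h1
    exact hxy.asymm ((h.uniform y hyM hyz x h.left_mem u hu).2 h2)

/-- Some flip leaves a transversal of two vertices. -/
def HasPairFlip (T : Tournament V) : Prop := ∃ a b p q, (T.flipArc a b).Hits {p, q}

lemma hasPairFlip_dual {T : Tournament V} : T.dual.HasPairFlip ↔ T.HasPairFlip := by
  simp [HasPairFlip, dual_flipArc, hits_dual]

lemma IsModule.arc_or_arc {T : Tournament V} {A B : Set V} (hA : T.IsModule A)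
    (hB : T.IsModule B) (hAB : Disjoint A B) :
    (∀ a ∈ A, ∀ b ∈ B, T.Arc a b) ∨ (∀ b ∈ B, ∀ a ∈ A, T.Arc b a) := by
  by_contra hcon
  push Not at hcon
  obtain ⟨⟨a, ha, b, hb, h1⟩, b', hb', a', ha', h2⟩ := hcon
  have hne : ∀ a ∈ A, ∀ b ∈ B, a ≠ b := fun a ha b hb e =>
    Set.disjoint_left.1 hAB ha (e ▸ hb)
  have h3 := T.arc_iff a b (hne a ha b hb)
  have h4 := hA a ha a' ha' b (Set.disjoint_right.1 hAB hb)
  have h5 := hB.arc_left hb hb' (Set.disjoint_left.1 hAB ha')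
  tauto

lemma isModule_of_compl_of_compl {T : Tournament V} {C D : Set V} (hC : T.IsModule Cᶜ)
    (hD : T.IsModule Dᶜ) (hCD : Disjoint C D) (hne : D.Nonempty) : T.IsModule C := by
  have h : T.IsModule (Dᶜ \ Cᶜ) := hD.diff hC (by
    obtain ⟨d, hd⟩ := hne
    exact ⟨d, Set.disjoint_right.1 hCD hd, by simpa using hd⟩)
  convert h using 1
  ext v
  have := @Set.disjoint_left _ C D
  simp only [Set.mem_sdiff, Set.mem_compl_iff, not_not]
  constructor
  · intro hv; exact ⟨this.1 hCD hv, hv⟩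
  · exact fun h => h.2

lemma hasPairFlip_of_not_isModule_aux {T : Tournament V} {x y z : V} (hX : T.Hits {x, y, z})
    {A B : Set V} (hAB : ∀ a ∈ A, ∀ b ∈ B, T.Arc a b) (hN : T.IsModule (A ∪ B))
    (hAn : A.Nontrivial) (hBn : B.Nontrivial) (hx : x ∈ A)
    (hy : y ∈ B) (hz : z ∉ A ∪ B) : T.HasPairFlip := by
  by_cases h1 : ∃ n ∈ A, T.Arc n x
  · obtain ⟨n, hn, hnx⟩ := h1
    exact ⟨z, x, z, y, hX.flipArc_of_module_union hAB hN hx hy hz hn hnx⟩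
  by_cases h2 : ∃ n ∈ B, T.Arc y n
  · obtain ⟨n, hn, hnx⟩ := h2
    have hX' : T.dual.Hits {y, x, z} := by
      rw [hits_dual]; convert hX using 1
      ext; simp; tauto
    refine hasPairFlip_dual.1 ⟨z, y, z, x, hX'.flipArc_of_module_union
      (fun b hb a ha => hAB a ha b hb) (isModule_dual.2 (by rwa [Set.union_comm])) hy hx
      (by rwa [Set.union_comm]) hn hnx⟩
  -- Otherwise `x` is the source and `y` the sink of the module, and removing them leaves a module
  -- that avoids the transversal.
  exfalso
  push Not at h1 h2
  have hxa : ∀ a ∈ A ∪ B, a ≠ x → T.Arc x a := by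
    rintro a (ha | ha) hne
    · exact (T.arc_or_arc hne).resolve_left (h1 a ha)
    · exact hAB x hx a ha
  have hya : ∀ a ∈ A ∪ B, a ≠ y → T.Arc a y := by
    rintro a (ha | ha) hne
    · exact hAB a ha y hy
    · exact (T.arc_or_arc hne).resolve_right (h2 a ha)
  obtain ⟨a, ha, hax⟩ := hAn.exists_ne x
  obtain ⟨b, hb, hby⟩ := hBn.exists_ne y
  have hmod : T.IsModule ((A ∪ B) \ {x, y}) := by
    intro p hp q hq v hv
    simp only [Set.mem_sdiff, Set.mem_insert_iff, Set.mem_singleton_iff, not_or] at hp hq hv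
    by_cases hvN : v ∈ A ∪ B
    · by_cases hvx : v = x
      · rw [hvx]
        exact iff_of_true (hxa p hp.1 hp.2.1) (hxa q hq.1 hq.2.1)
      · have hvy : v = y := by tauto
        rw [hvy]
        exact iff_of_false (hya p hp.1 hp.2.2).asymm (hya q hq.1 hq.2.2).asymm
    · exact hN p hp.1 q hq.1 v hvN
  have hya' : ∀ a ∈ A, a ≠ y := fun a ha => (hAB a ha y hy).ne
  have hxb' : ∀ b ∈ B, b ≠ x := fun b hb => (hAB x hx b hb).ne.symm
  have hco := isComodule_of_isModule hmod (a := a) (b := b) (c := x)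
    ⟨Or.inl ha, by simp [hax, hya' a ha]⟩ ⟨Or.inr hb, by simp [hby, hxb' b hb]⟩
    (hAB a ha b hb).ne (by simp)
  rcases hX.exists_mem_triple hco with h | h | h
  · exact h.2 (by simp)
  · exact h.2 (by simp)
  · exact hz h.1

lemma hasPairFlip_of_not_isModule {T : Tournament V} {x y z : V} (hX : T.Hits {x, y, z})
    {A B C : Set V} (hA : T.IsComodule A) (hB : T.IsComodule B) (hC : T.IsComodule C)
    (hAB : Disjoint A B) (hAC : Disjoint A C) (hBC : Disjoint B C)
    (hx : x ∈ A) (hy : y ∈ B) (hz : z ∈ C) (hcov : ∀ v, v ∈ A ∨ v ∈ B ∨ v ∈ C)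
    (hCm : ¬ T.IsModule C) : T.HasPairFlip := by
  have hC' : T.IsModule Cᶜ := by
    rcases hC with h | h
    · exact absurd h.1 hCm
    · exact h.1
  have hA' : T.IsNontrivialModule A := by
    rcases hA with h | h
    · exact h
    · exact absurd (isModule_of_compl_of_compl hC' h.1 hAC.symm ⟨x, hx⟩) hCm
  have hB' : T.IsNontrivialModule B := by
    rcases hB with h | h
    · exact h
    · exact absurd (isModule_of_compl_of_compl hC' h.1 hBC.symm ⟨y, hy⟩) hCm
  have hN : A ∪ B = Cᶜ := by
    ext v
    have h1 := hcov v
    have h2 := @Set.disjoint_left _ A C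
    have h3 := @Set.disjoint_left _ B C
    simp only [Set.mem_union, Set.mem_compl_iff]
    constructor
    · rintro (h | h)
      · exact h2.1 hAC h
      · exact h3.1 hBC h
    · tauto
  rcases hA'.1.arc_or_arc hB'.1 hAB with h | h
  · exact hasPairFlip_of_not_isModule_aux hX h (by rwa [hN]) hA'.2.1 hB'.2.1 hx hy
      (by rw [hN]; simpa using hz)
  · have hX' : T.Hits {y, x, z} := by
      convert hX using 1
      ext; simp; tauto
    exact hasPairFlip_of_not_isModule_aux hX' h (by rwa [Set.union_comm, hN])
      hB'.2.1 hA'.2.1 hy hx (by rw [Set.union_comm, hN]; simpa using hz)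

lemma nontrivial_of_cyclic {T : Tournament V} {x y z : V} {A : Set V} (hA : T.IsComodule A)
    (hx : x ∈ A) (hy : y ∉ A) (hz : z ∉ A) (hxy : T.Arc x y) (hzx : T.Arc z x) :
    A.Nontrivial := by
  rcases hA with h | h
  · exact h.2.1
  · exact absurd ((h.1 y hy z hz x (by simpa using hx)).1 hxy) hzx.asymm

/-- A transversal with three vertices can be shortened by a flip, if it comes from a packing.
If the packing misses a vertex `w`, then adding `w` to the transversal leads back to the case of
four vertices; otherwise the packing is a partition of the vertex set. -/
lemma hasPairFlip_of_triple {T : Tournament V} {x y z : V} (hX : T.Hits {x, y, z})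
    {A B C : Set V} (hA : T.IsComodule A) (hB : T.IsComodule B) (hC : T.IsComodule C)
    (hAB : Disjoint A B) (hAC : Disjoint A C) (hBC : Disjoint B C)
    (hx : x ∈ A) (hy : y ∈ B) (hz : z ∈ C) : T.HasPairFlip := by
  have xB := Set.disjoint_left.1 hAB hx
  have xC := Set.disjoint_left.1 hAC hx
  have yA := Set.disjoint_right.1 hAB hy
  have yC := Set.disjoint_left.1 hBC hy
  have zA := Set.disjoint_right.1 hAC hz
  have zB := Set.disjoint_right.1 hBC hz
  have hxy : x ≠ y := fun e => xB (e ▸ hy)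
  have hxz : x ≠ z := fun e => xC (e ▸ hz)
  have hyz : y ≠ z := fun e => yC (e ▸ hz)
  by_cases hcov : ∀ v, v ∈ A ∨ v ∈ B ∨ v ∈ C
  · have hX1 : T.Hits {y, z, x} := by convert hX using 1; ext; simp; tauto
    have hX2 : T.Hits {z, x, y} := by convert hX using 1; ext; simp; tauto
    by_cases mC : T.IsModule C
    swap
    · exact hasPairFlip_of_not_isModule hX hA hB hC hAB hAC hBC hx hy hz hcov mC
    by_cases mA : T.IsModule A
    swap
    · exact hasPairFlip_of_not_isModule hX1 hB hC hA hBC hAB.symm hAC.symm hy hz hx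
        (fun v => by have := hcov v; tauto) mA
    by_cases mB : T.IsModule B
    swap
    · exact hasPairFlip_of_not_isModule hX2 hC hA hB hAC.symm hBC.symm hAB hz hx hy
        (fun v => by have := hcov v; tauto) mB
    have hX3 : T.Hits {y, x, z} := by convert hX using 1; ext; simp; tauto
    have hX4 : T.Hits {z, y, x} := by convert hX using 1; ext; simp; tauto
    have hX5 : T.Hits {x, z, y} := by convert hX using 1; ext; simp; tauto
    rcases mA.arc_or_arc mB hAB with h1 | h1 <;> rcases mB.arc_or_arc mC hBC with h2 | h2 <;>
      rcases mA.arc_or_arc mC hAC with h3 | h3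
    · exact ⟨_, _, _, _, hX5.flipArc_of_linear hx hz hy hcov h1 h2 h3⟩
    · exact ⟨_, _, _, _, hX.flipArc_of_cyclic mA mB
        (nontrivial_of_cyclic hA hx yA zA (h1 x hx y hy) (h3 z hz x hx))
        (nontrivial_of_cyclic hB hy zB xB (h2 y hy z hz) (h1 x hx y hy)) hx hy hz hcov h1 h2 h3⟩
    · exact ⟨_, _, _, _, hX.flipArc_of_linear hx hy hz
        (fun v => by have := hcov v; tauto) h3 h2 h1⟩
    · exact ⟨_, _, _, _, hX4.flipArc_of_linear hz hy hx
        (fun v => by have := hcov v; tauto) h3 h1 h2⟩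
    · exact ⟨_, _, _, _, hX1.flipArc_of_linear hy hz hx
        (fun v => by have := hcov v; tauto) h1 h3 h2⟩
    · exact ⟨_, _, _, _, hX3.flipArc_of_linear hy hx hz
        (fun v => by have := hcov v; tauto) h2 h3 h1⟩
    · exact ⟨_, _, _, _, hX3.flipArc_of_cyclic mB mA
        (nontrivial_of_cyclic hB hy xB zB (h1 y hy x hx) (h2 z hz y hy))
        (nontrivial_of_cyclic hA hx zA yA (h3 x hx z hz) (h1 y hy x hx)) hy hx hz
        (fun v => by have := hcov v; tauto) h1 h3 h2⟩
    · exact ⟨_, _, _, _, hX2.flipArc_of_linear hz hx hy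
        (fun v => by have := hcov v; tauto) h2 h1 h3⟩
  · push Not at hcov
    obtain ⟨w, wA, wB, wC⟩ := hcov
    have hxw : x ≠ w := fun e => wA (e ▸ hx)
    have hyw : y ≠ w := fun e => wB (e ▸ hy)
    have hzw : z ≠ w := fun e => wC (e ▸ hz)
    have hX4 : T.Hits {x, y, z, w} := hX.mono (by
      intro v; simp; tauto)
    have iA : A ∩ {x, y, z, w} = {x} := by
      ext v; simp only [Set.mem_inter_iff, Set.mem_insert_iff, Set.mem_singleton_iff]
      constructor
      · rintro ⟨hv, rfl | rfl | rfl | rfl⟩ <;> tauto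
      · rintro rfl; tauto
    have iB : B ∩ {x, y, z, w} = {y} := by
      ext v; simp only [Set.mem_inter_iff, Set.mem_insert_iff, Set.mem_singleton_iff]
      constructor
      · rintro ⟨hv, rfl | rfl | rfl | rfl⟩ <;> tauto
      · rintro rfl; tauto
    have iC : C ∩ {x, y, z, w} = {z} := by
      ext v; simp only [Set.mem_inter_iff, Set.mem_insert_iff, Set.mem_singleton_iff]
      constructor
      · rintro ⟨hv, rfl | rfl | rfl | rfl⟩ <;> tauto
      · rintro rfl; tauto
    have hmem : ∀ (F : Set V) (p q : V), F ∩ {x, y, z, w} = {p, q} →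
        ∀ v, v = x ∨ v = y ∨ v = z ∨ v = w → (v ∈ F ↔ v = p ∨ v = q) := by
      intro F p q hF v hv
      have := Set.ext_iff.1 hF v
      simp only [Set.mem_inter_iff, Set.mem_insert_iff, Set.mem_singleton_iff] at this
      exact ⟨fun h => this.1 ⟨h, hv⟩, fun h => (this.2 h).1⟩
    have hnot : ∀ (F : Set V) (p q : V), F ∩ {x, y, z, w} = {p, q} →
        ∀ v, v = x ∨ v = y ∨ v = z ∨ v = w → v ≠ p → v ≠ q → v ∉ F :=
      fun F p q hF v hv hp hq h => ((hmem F p q hF v hv).1 h).elim hp hq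
    by_cases b1 : ∀ F, T.IsComodule F → F ∩ {x, y, z, w} ≠ {x, y}
    · refine ⟨x, y, z, w, (hX4.flipArc (u := z) (v := w) (by simp) (by simp) ?_ ?_ hzw hA hB hAB
        iA iB b1).mono ?_⟩
      · simp [hxz.symm, hyz.symm]
      · simp [hxw.symm, hyw.symm]
      · intro v; simp; tauto
    by_cases b2 : ∀ F, T.IsComodule F → F ∩ {x, y, z, w} ≠ {y, z}
    · refine ⟨y, z, x, w, (hX4.flipArc (u := x) (v := w) (by simp) (by simp) ?_ ?_ hxw hB hC hBC
        iB iC b2).mono ?_⟩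
      · simp [hxz, hxy]
      · simp [hyw.symm, hzw.symm]
      · intro v; simp; tauto
    by_cases b3 : ∀ F, T.IsComodule F → F ∩ {x, y, z, w} ≠ {x, z}
    · refine ⟨x, z, y, w, (hX4.flipArc (u := y) (v := w) (by simp) (by simp) ?_ ?_ hyw hA hC hAC
        iA iC b3).mono ?_⟩
      · simp [hxy.symm, hyz]
      · simp [hxw.symm, hzw.symm]
      · intro v; simp; tauto
    exfalso
    push Not at b1 b2 b3
    obtain ⟨F, hF, eF⟩ := b1
    obtain ⟨G, hG, eG⟩ := b2
    obtain ⟨H, hH, eH⟩ := b3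
    have mF := hmem F x y eF
    have mG := hmem G y z eG
    have mH := hmem H x z eH
    have nF := hnot F x y eF
    have nG := hnot G y z eG
    have nH := hnot H x z eH
    exact not_three_pairings (w := w) hxy hyz hxz hF hG hH
      ((mF x (by simp)).2 (by simp)) ((mF y (by simp)).2 (by simp))
      (nF z (by simp) hxz.symm hyz.symm) (nF w (by simp) hxw.symm hyw.symm)
      (nG x (by simp) hxy hxz)
      ((mG y (by simp)).2 (by simp)) ((mG z (by simp)).2 (by simp))
      (nG w (by simp) hyw.symm hzw.symm)
      ((mH x (by simp)).2 (by simp))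
      (nH y (by simp) hxy.symm hyz)
      ((mH z (by simp)).2 (by simp))
      (nH w (by simp) hxw.symm hzw.symm)

/-! ### Tournaments with a transversal of two vertices -/

lemma indecomposable_flipArc {T : Tournament V} {x y : V}
    (h0 : ∀ M, T.IsNontrivialModule M → (x ∈ M ↔ y ∈ M) → False)
    (h1 : ∀ M, (T.flipArc x y).IsNontrivialModule M → T.SplitModule x y M → False)
    (h2 : ∀ M, (T.flipArc x y).IsNontrivialModule M → T.SplitModule y x M → False) :
    (T.flipArc x y).Indecomposable := by
  apply indecomposable_of_forall
  intro M hM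
  by_cases h : x ∈ M ↔ y ∈ M
  · exact h0 M ((isNontrivialModule_flipArc_iff h).1 hM) h
  · by_cases hx : x ∈ M
    · exact h1 M hM (splitModule_of_flipArc hM.1 hx (by tauto))
    · have hM' := hM.1
      rw [flipArc_comm] at hM'
      exact h2 M hM (splitModule_of_flipArc hM' (by tauto) hx)

lemma Hits.separates {T : Tournament V} {x y : V} (h : T.Hits {x, y}) {M : Set V}
    (hM : T.IsNontrivialModule M) : (x ∈ M ∧ y ∉ M) ∨ (y ∈ M ∧ x ∉ M) := by
  have h1 := h.exists_mem_pair (Or.inl hM)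
  have h2 := h.exists_mem_pair (IsComodule.compl (Or.inl hM))
  simp only [Set.mem_compl_iff] at h2
  tauto

lemma not_splitModule_of_disjoint {T : Tournament V} {x y : V} (hX : T.Hits {x, y}) {C D : Set V}
    (hC : T.IsNontrivialModule C) (hD : T.IsNontrivialModule D) (hCD : Disjoint C D)
    (hx : x ∈ C) (hy : y ∈ D) (harc : ∀ a ∈ C, ∀ b ∈ D, T.Arc a b) {M : Set V}
    (hM : M.Nontrivial) (h : T.SplitModule x y M) : False := by
  have hyC : y ∉ C := Set.disjoint_right.1 hCD hy
  obtain ⟨d, hdM, hdD⟩ := h.exists_mem_inter hM hD.1 hD.2.1 hy (Set.disjoint_left.1 hCD hx)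
  have hG := h.isModule_union hM hC.1 hD.1 hD.2.1 hx hy hCD
  have hcov : ∀ v, v ∈ M ∪ C ∪ D := by
    intro v
    by_contra hv
    have := hX.separates (M := M ∪ C ∪ D)
      ⟨hG, ⟨x, by simp [hx], y, by simp [hy], h.ne⟩, ⟨v, hv⟩⟩
    simp [hx, hy] at this
  -- Every vertex of `C` other than `x` dominates everything outside `C \ {x}`.
  have hdom : ∀ c ∈ C, c ≠ x → ∀ a, a ∉ C \ {x} → T.Arc c a := by
    intro c hc hcx a ha
    have hcM : c ∉ M := fun h' => hcx (h.eq_of_mem_of_mem hC.1 hx hyC hc h')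
    have hMc : ∀ m ∈ M, T.Arc c m := fun m hm =>
      (h.uniform c hcM (fun e => hyC (e ▸ hc)) m hm d hdM).2 (harc c hc d hdD)
    by_cases hax : a = x
    · exact hMc a (hax ▸ h.left_mem)
    · have haC : a ∉ C := fun h' => ha ⟨h', hax⟩
      rcases hcov a with (h' | h') | h'
      · exact hMc a h'
      · exact absurd h' haC
      · exact harc c hc a h'
  obtain ⟨c, hc, hcx⟩ := hC.2.1.exists_ne x
  have hmod : T.IsModule (C \ {x})ᶜ := by
    intro a ha b hb v hv
    rw [Set.mem_compl_iff, not_not] at hv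
    exact iff_of_true (hdom v hv.1 hv.2 a ha) (hdom v hv.1 hv.2 b hb)
  have := hX.separates (M := (C \ {x})ᶜ)
    ⟨hmod, ⟨x, by simp, y, by simp [hyC], h.ne⟩, ⟨c, by simp [hc, hcx]⟩⟩
  simp [hyC] at this

lemma Hits.indecomposable_flipArc_of_disjoint {T : Tournament V} {x y : V} (hX : T.Hits {x, y})
    {C D : Set V} (hC : T.IsNontrivialModule C) (hD : T.IsNontrivialModule D)
    (hCD : Disjoint C D) : (T.flipArc x y).Indecomposable := by
  wlog hxC : x ∈ C generalizing C D
  · have h1 := hX.separates hC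
    have h2 := hX.separates hD
    refine this hD hC hCD.symm ?_
    have := @Set.disjoint_left _ C D
    tauto
  have hyC : y ∉ C := by have := hX.separates hC; tauto
  have hyD : y ∈ D := by
    have h2 := hX.separates hD
    have := @Set.disjoint_left _ C D
    tauto
  have hX' : T.Hits {y, x} := by rwa [Set.pair_comm]
  apply indecomposable_flipArc
  · intro M hM h
    have := hX.separates hM
    tauto
  · intro M hM h
    rcases hC.1.arc_or_arc hD.1 hCD with h' | h'
    · exact not_splitModule_of_disjoint hX hC hD hCD hxC hyD h' hM.2.1 h
    · exact not_splitModule_of_disjoint (hits_dual.2 hX) (isNontrivialModule_dual.2 hC)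
        (isNontrivialModule_dual.2 hD) hCD hxC hyD (fun a ha b hb => h' b hb a ha) hM.2.1 h.dual
  · intro M hM h
    rcases hC.1.arc_or_arc hD.1 hCD with h' | h'
    · exact not_splitModule_of_disjoint (hits_dual.2 hX') (isNontrivialModule_dual.2 hD)
        (isNontrivialModule_dual.2 hC) hCD.symm hyD hxC (fun a ha b hb => h' b hb a ha)
        hM.2.1 h.dual
    · exact not_splitModule_of_disjoint hX' hD hC hCD.symm hyD hxC h' hM.2.1 h

/-! #### A source -/

/-- Reversing an arc from a source `y` to `p` creates no nontrivial module except possibly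
`{y, d}`, where `p` is the only vertex other than `y` that dominates `d`. -/
lemma SplitModule.source {T : Tournament V} {y p : V} (hy : ∀ v, v ≠ y → T.Arc y v) {M : Set V}
    (hM : M.Nontrivial) (h : T.SplitModule y p M)
    (hnot : ∀ L, T.IsNontrivialModule L → y ∉ L → p ∈ L) :
    ∃ d, d ≠ y ∧ T.Arc p d ∧ ∀ n, n ≠ y → n ≠ p → n ≠ d → T.Arc d n := by
  obtain ⟨d, hd, hdy⟩ := hM.exists_ne y
  have hpL : ∀ u ∈ M, u ≠ y → T.Arc p u := fun u hu huy =>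
    (h.opposite u hu huy).2 (hy p h.ne.symm)
  have hout : ∀ n, n ∉ M → n ≠ p → ∀ u ∈ M, T.Arc u n := fun n hn hnp u hu =>
    (h.uniform_left hn hnp hu h.left_mem).2 (hy n (fun e => hn (e ▸ h.left_mem)))
  have hmod : T.IsModule (M \ {y}) := by
    intro a ha b hb v hv
    by_cases hvy : v = y
    · rw [hvy]; exact iff_of_true (hy a ha.2) (hy b hb.2)
    · have hvM : v ∉ M := fun h' => hv ⟨h', hvy⟩
      by_cases hvp : v = p
      · rw [hvp]; exact iff_of_true (hpL a ha.1 ha.2) (hpL b hb.1 hb.2)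
      · exact h.uniform v hvM hvp a ha.1 b hb.1
  refine ⟨d, hdy, hpL d hd hdy, fun n hny hnp hnd => ?_⟩
  by_cases hnM : n ∈ M
  · have := hnot (M \ {y}) ⟨hmod, ⟨d, ⟨hd, hdy⟩, n, ⟨hnM, hny⟩, hnd.symm⟩, ⟨y, by simp⟩⟩ (by simp)
    exact absurd this.1 h.right_notMem
  · exact hout n hnM hnp d hd

lemma SplitModule.not_source {T : Tournament V} {y p : V} (hy : ∀ v, v ≠ y → T.Arc y v)
    {M : Set V} (hM : M.Nontrivial) (h : T.SplitModule p y M) : False := by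
  obtain ⟨u, hu, hup⟩ := hM.exists_ne p
  have h1 := (h.opposite u hu hup).1 (hy u (fun e => h.right_notMem (e ▸ hu)))
  exact h1.asymm (hy p h.ne)

/-- Among the vertices other than `y`, of which there are at least four, some `p` is not the only
dominator of any other one. -/
lemma exists_not_unique_dominator [Finite V] (T : Tournament V) (y : V) (hV : 5 ≤ Nat.card V) :
    ∃ p, p ≠ y ∧ ¬ ∃ d, d ≠ y ∧ T.Arc p d ∧ ∀ n, n ≠ y → n ≠ p → n ≠ d → T.Arc d n := by
  by_contra hcon
  push Not at hcon
  have new : ∀ S : Set V, S.ncard ≤ 4 → ∃ v, v ∉ S := by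
    intro S hS
    by_contra h
    push Not at h
    have : S = Set.univ := Set.eq_univ_of_forall h
    rw [this, Set.ncard_univ] at hS
    omega
  obtain ⟨p, hp⟩ := new {y} (by simp)
  simp only [Set.mem_singleton_iff] at hp
  obtain ⟨d, hdy, hpd, hd⟩ := hcon p hp
  have key : ∀ a, a ≠ y → a ≠ p → a ≠ d → T.Arc a p ∧
      ∀ n, n ≠ y → n ≠ a → n ≠ p → T.Arc p n := by
    intro a hay hap had
    obtain ⟨e, hey, hae, he⟩ := hcon a hay
    have hda := hd a hay hap had
    have hed : e ≠ d := fun e' => hda.asymm (e' ▸ hae)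
    by_cases hep : e = p
    · subst hep; exact ⟨hae, he⟩
    · exact absurd (hd e hey hep hed) (he d hdy had.symm hed.symm).asymm
  have c3 : ({y, p, d} : Set V).ncard ≤ 4 :=
    (Set.ncard_insert_le _ _).trans (by
      have := Set.ncard_insert_le p ({d} : Set V)
      simp at this
      omega)
  obtain ⟨a, ha⟩ := new {y, p, d} c3
  have c4 : ({a, y, p, d} : Set V).ncard ≤ 4 := by
    have h1 := Set.ncard_insert_le a ({y, p, d} : Set V)
    have h2 := Set.ncard_insert_le y ({p, d} : Set V)
    have h3 := Set.ncard_insert_le p ({d} : Set V)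
    simp at h3; omega
  obtain ⟨b, hb⟩ := new {a, y, p, d} c4
  simp only [Set.mem_insert_iff, Set.mem_singleton_iff, not_or] at ha hb
  have h1 := key a ha.1 ha.2.1 ha.2.2
  have h2 := key b hb.2.1 hb.2.2.1 hb.2.2.2
  exact h2.1.asymm (h1.2 b hb.2.1 hb.1 hb.2.2.1)

lemma Hits.exists_indecomposable_of_source [Finite V] {T : Tournament V} {x y : V}
    (hX : T.Hits {x, y}) (hV : 5 ≤ Nat.card V) (hxy : x ≠ y) (hy : ∀ v, v ≠ y → T.Arc y v) :
    ∃ a b, (T.flipArc a b).Indecomposable := by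
  by_cases hC : ∃ C, T.IsNontrivialModule C ∧ y ∉ C ∧ C ≠ {y}ᶜ
  · obtain ⟨C, hC, hyC, hCN⟩ := hC
    have hxC : x ∈ C := by have := hX.separates hC; tauto
    refine ⟨y, x, indecomposable_flipArc ?_ ?_ ?_⟩
    · intro M hM h
      have := hX.separates hM
      tauto
    · intro M hM h
      obtain ⟨d, hdy, hxd, hd⟩ := h.source hy hM.2.1 (fun L hL hyL => by
        have := hX.separates hL
        tauto)
      have hdC : d ∈ C := by
        by_contra hdC
        obtain ⟨c, hc, hcx⟩ := hC.2.1.exists_ne x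
        have h1 := (hC.1.arc_left hxC hc hdC).1 hxd
        exact h1.asymm (hd c (fun e => hyC (e ▸ hc)) hcx (fun e => hdC (e ▸ hc)))
      have hCdom : ∀ n, n ∉ C → n ≠ y → ∀ c ∈ C, T.Arc c n := fun n hn hny c hc =>
        (hC.1.arc_left hc hdC hn).2
          (hd n hny (fun e => hn (e ▸ hxC)) (fun e => hn (e ▸ hdC)))
      obtain ⟨n, hn, hny⟩ : ∃ n, n ∉ C ∧ n ≠ y := by
        by_contra hcon
        push Not at hcon
        apply hCN
        ext v
        simp only [Set.mem_compl_iff, Set.mem_singleton_iff]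
        refine ⟨fun hv e => hyC (e ▸ hv), fun hv => ?_⟩
        by_contra hv'
        exact hv (hcon v hv')
      have hmod : T.IsModule (insert y C) := by
        have key : ∀ v ∉ insert y C, ∀ a ∈ insert y C, ¬ T.Arc v a := by
          intro v hv a ha
          simp only [Set.mem_insert_iff, not_or] at hv
          apply Arc.asymm
          rcases ha with rfl | ha
          · exact hy v hv.1
          · exact hCdom v hv.2 hv.1 a ha
        intro a ha b hb v hv
        exact iff_of_false (key v hv a ha) (key v hv b hb)
      have := hX.separates (M := insert y C)
        ⟨hmod, ⟨x, by simp [hxC], y, by simp, hxy⟩, ⟨n, by simp [hn, hny]⟩⟩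
      simp [hxC] at this
    · intro M hM h
      exact h.not_source hy hM.2.1
  · push Not at hC
    obtain ⟨p, hpy, hp⟩ := exists_not_unique_dominator T y hV
    refine ⟨y, p, indecomposable_flipArc ?_ ?_ ?_⟩
    · intro M hM h
      by_cases hyM : y ∈ M
      · -- The complement of `{y}` is a module, and so are its intersection with `M` and the
        -- complement of `M`; one of the two is a proper nontrivial submodule.
        have hxM : x ∉ M := by have := hX.separates hM; tauto
        have hN : T.IsModule {y}ᶜ := by
          intro a ha b hb v hv
          rw [Set.mem_compl_iff, not_not] at hv
          rw [hv]
          exact iff_of_true (hy a ha) (hy b hb)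
        have h1 : T.IsModule ({y}ᶜ \ M) := hN.diff hM.1 ⟨y, hyM, by simp⟩
        have h2 : T.IsModule ({y}ᶜ ∩ M) := hN.inter hM.1
        have e1 : ∀ q, q ∉ M → q = x := by
          intro q hq
          by_contra hqx
          have hqy : q ≠ y := fun e => hq (e ▸ hyM)
          have := hC _ ⟨h1, ⟨q, ⟨hqy, hq⟩, x, ⟨hxy, hxM⟩, hqx⟩, ⟨y, by simp⟩⟩ (by simp)
          have hpp : p ∈ ({y}ᶜ : Set V) := hpy
          rw [← this] at hpp
          exact hpp.2 (h.1 hyM)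
        have e2 : ∃ q, q ≠ y ∧ q ≠ p ∧ q ∈ M := by
          by_contra hcon
          push Not at hcon
          have hsub : (Set.univ : Set V) ⊆ {x, y, p} := by
            intro v _
            by_cases hvM : v ∈ M
            · by_cases hvy : v = y
              · simp [hvy]
              · by_cases hvp : v = p
                · simp [hvp]
                · exact absurd hvM (hcon v hvy hvp)
            · simp [e1 v hvM]
          have h3 := Set.ncard_le_ncard hsub (Set.toFinite _)
          have h4 := Set.ncard_insert_le x ({y, p} : Set V)
          have h5 := Set.ncard_insert_le y ({p} : Set V)
          rw [Set.ncard_univ] at h3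
          simp at h5; omega
        obtain ⟨q, hqy, hqp, hqM⟩ := e2
        have := hC _ ⟨h2, ⟨q, ⟨hqy, hqM⟩, p, ⟨hpy, h.1 hyM⟩, hqp⟩, ⟨y, by simp⟩⟩ (by simp)
        have hxx : x ∈ ({y}ᶜ : Set V) := hxy
        rw [← this] at hxx
        exact hxM hxx.2
      · have := hC M hM hyM
        have hpp : p ∈ ({y}ᶜ : Set V) := hpy
        rw [← this] at hpp
        exact hyM (h.2 hpp)
    · intro M hM h
      refine hp (h.source hy hM.2.1 (fun L hL hyL => ?_))
      rw [hC L hL hyL]; exact hpy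
    · intro M hM h
      exact h.not_source hy hM.2.1

/-! #### A unique maximal nontrivial module -/

lemma not_splitModule_into_module {T : Tournament V} {N : Set V} {x w : V}
    (hN : T.IsNontrivialModule N) (hall : ∀ M, T.IsNontrivialModule M → M ⊆ N ∧ x ∈ M)
    (hD : ∀ w, ∃ u, u ∉ N ∧ u ≠ w) (hN3 : ∀ c, ∃ n ∈ N, n ≠ c ∧ n ≠ x) (hx : x ∈ N)
    (hw : w ∉ N) {M : Set V} (hM : M.Nontrivial) (h : T.SplitModule w x M) : False := by
  obtain ⟨c, hcM, hcN⟩ := h.exists_mem_inter hM hN.1 hN.2.1 hx hw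
  have hMN : T.IsModule (M ∩ N) := by
    intro a ha b hb v hv
    by_cases hvN : v ∈ N
    · have hvM : v ∉ M := fun h' => hv ⟨h', hvN⟩
      by_cases hvx : v = x
      · have hne : ∀ a ∈ N, a ≠ w := fun a ha e => hw (e ▸ ha)
        rw [hvx, h.opposite a ha.1 (hne a ha.2), h.opposite b hb.1 (hne b hb.2)]
      · exact h.uniform v hvM hvx a ha.1 b hb.1
    · exact hN.1 a ha.2 b hb.2 v hvN
  have huniq : ∀ a ∈ M, a ∈ N → a = c := by
    intro a haM haN
    by_contra hac
    have := (hall _ ⟨hMN, ⟨a, ⟨haM, haN⟩, c, ⟨hcM, hcN⟩, hac⟩,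
      ⟨x, fun h' => h.right_notMem h'.1⟩⟩).2
    exact h.right_notMem this.1
  obtain ⟨n, hnN, hnc, hnx⟩ := hN3 c
  have hnM : n ∉ M := fun h' => hnc (huniq n h' hnN)
  have honly : ∀ u ∈ M, u ∉ N → u = w := by
    intro u huM huN
    by_contra huw
    have h1 := h.uniform_left hnM hnx huM h.left_mem
    have h2 := hN.1 n hnN x hx w hw
    have h3 := hN.1 n hnN x hx u huN
    have h4 := h.opposite u huM huw
    have h5 := T.arc_iff x u (fun e => huN (e ▸ hx))
    tauto
  have hmod : T.IsModule (M ∪ N) := by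
    have key : ∀ a ∈ M ∪ N, ∀ v ∉ M ∪ N, (T.Arc v a ↔ T.Arc v c) := by
      intro a ha v hv
      simp only [Set.mem_union, not_or] at hv
      rcases ha with ha | ha
      · exact h.uniform v hv.1 (fun e => hv.2 (e ▸ hx)) a ha c hcM
      · exact hN.1 a ha c hcN v hv.2
    intro a ha b hb v hv
    rw [key a ha v hv, key b hb v hv]
  obtain ⟨u, huN, huw⟩ := hD w
  have := (hall (M ∪ N) ⟨hmod, hN.2.1.mono Set.subset_union_right, ⟨u, ?_⟩⟩).1
    (Or.inl h.left_mem)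
  · exact hw this
  · rintro (h' | h')
    · exact huw (honly u h' huN)
    · exact huN h'

lemma not_splitModule_out_of_module {T : Tournament V} {N : Set V} {x w : V}
    (hN : T.IsNontrivialModule N) (hall : ∀ M, T.IsNontrivialModule M → x ∈ M)
    (hN3 : ∀ c, ∃ n ∈ N, n ≠ c ∧ n ≠ x) (hx : x ∈ N)
    (hw : w ∉ N) {M : Set V} (hM : M.Nontrivial) (h : T.SplitModule x w M) : False := by
  have hMN : ∀ a ∈ N, a ∈ M → a = x := fun a ha haM => h.eq_of_mem_of_mem hN.1 hx hw ha haM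
  obtain ⟨u, huM, hux⟩ := hM.exists_ne x
  have huN : u ∉ N := fun h' => hux (hMN u h' huM)
  have key : ∀ n ∈ N, n ≠ x → (T.Arc x n ↔ T.Arc u x) := by
    intro n hn hnx
    have hnM : n ∉ M := fun h' => hnx (hMN n hn h')
    have h1 := h.uniform_left hnM (fun e => hw (e ▸ hn)) h.left_mem huM
    have h2 := hN.1 n hn x hx u huN
    rw [h1, h2]
  obtain ⟨n, hn, hnx, -⟩ := hN3 x
  obtain ⟨n', hn', hnn', hnx'⟩ := hN3 n
  have hmod : T.IsModule (N \ {x}) := by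
    intro a ha b hb v hv
    by_cases hvN : v ∈ N
    · have hvx : v = x := by by_contra h'; exact hv ⟨hvN, h'⟩
      rw [hvx, key a ha.1 ha.2, key b hb.1 hb.2]
    · exact hN.1 a ha.1 b hb.1 v hvN
  exact (hall _ ⟨hmod, ⟨n, ⟨hn, hnx⟩, n', ⟨hn', hnx'⟩, hnn'.symm⟩, ⟨x, by simp⟩⟩).2 rfl

/-- A tournament whose only nontrivial module is a pair `{p, q}`: after reversing the arc
between `p` and an outside vertex `w`, a nontrivial module can only arise because `p` has become a
source or sink (the first alternative) or a twin of an outside vertex `u`. -/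
lemma bad_of_pair {T : Tournament V} {p q w : V} (hpq : p ≠ q)
    (hN : T.IsModule {p, q}) (hall : ∀ M, T.IsNontrivialModule M → M = {p, q})
    (hwp : w ≠ p) (hwq : w ≠ q) (hbad : ¬ (T.flipArc w p).Indecomposable) :
    ((∀ v, v ≠ p → v ≠ q → v ≠ w → (T.Arc p v ↔ T.Arc p q)) ∧ (T.Arc p w ↔ ¬ T.Arc p q)) ∨
    ∃ u, u ≠ p ∧ u ≠ q ∧ u ≠ w ∧ (∀ v, v ≠ p → v ≠ q → v ≠ u → v ≠ w → (T.Arc u v ↔ T.Arc p v)) ∧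
      (T.Arc u w ↔ ¬ T.Arc p w) ∧ (T.Arc u q ↔ T.Arc p q) := by
  by_contra hcon
  rw [not_or] at hcon
  obtain ⟨hc1, hc2⟩ := hcon
  have hw : w ∉ ({p, q} : Set V) := by simp [hwp, hwq]
  refine hbad (indecomposable_flipArc ?_ ?_ ?_)
  · intro M hM h
    rw [hall M hM] at h
    simp [hwp, hwq] at h
  · intro M hM h
    obtain ⟨c, hcM, hcN⟩ := h.exists_mem_inter hM.2.1 hN ⟨p, by simp, q, by simp, hpq⟩
      (by simp) hw
    have hqM : q ∈ M := by
      rcases hcN with rfl | rfl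
      · exact absurd hcM h.right_notMem
      · exact hcM
    have hmod : T.IsModule (M ∪ {p, q}) := by
      have key : ∀ a ∈ M ∪ {p, q}, ∀ v ∉ M ∪ {p, q}, (T.Arc v a ↔ T.Arc v q) := by
        intro a ha v hv
        simp only [Set.mem_union, not_or] at hv
        rcases ha with ha | ha
        · exact h.uniform v hv.1 (fun e => hv.2 (by simp [e])) a ha q hqM
        · exact hN a ha q (by simp) v hv.2
      intro a ha b hb v hv
      rw [key a ha v hv, key b hb v hv]
    have hMall : ∀ v, v ≠ p → v ∈ M := by
      intro v hvp
      by_contra hvM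
      have hv : v ∉ M ∪ {p, q} := by
        simp only [Set.mem_union, Set.mem_insert_iff, Set.mem_singleton_iff, not_or]
        exact ⟨hvM, hvp, fun e => hvM (e ▸ hqM)⟩
      have := hall _ ⟨hmod, ⟨p, by simp, q, by simp, hpq⟩, ⟨v, hv⟩⟩
      exact hw (this ▸ Or.inl h.left_mem)
    have hq := h.opposite q hqM hwq.symm
    refine hc1 ⟨fun v hvp hvq hvw => ?_, ?_⟩
    · rw [h.opposite v (hMall v hvp) hvw, hq]
    · have := T.arc_iff p w hwp.symm
      rw [hq, this]
  · intro M hM h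
    have hMN : ∀ a ∈ ({p, q} : Set V), a ∈ M → a = p := fun a ha haM =>
      h.eq_of_mem_of_mem hN (by simp) hw ha haM
    have hqM : q ∉ M := fun h' => hpq (hMN q (by simp) h').symm
    have hmod : T.IsModule (M \ {p}) := by
      have hq : ∀ a ∈ M \ {p}, ∀ b ∈ M \ {p}, (T.Arc q a ↔ T.Arc q b) := fun a ha b hb =>
        h.uniform q hqM hwq.symm a ha.1 b hb.1
      intro a ha b hb v hv
      by_cases hvM : v ∈ M
      · have hvp : v = p := by by_contra h'; exact hv ⟨hvM, h'⟩
        have hne : ∀ a ∈ M \ {p}, a ∉ ({p, q} : Set V) := by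
          rintro a ha (rfl | rfl)
          · exact ha.2 rfl
          · exact hqM ha.1
        rw [hvp, hN.arc_left (x := p) (y := q) (by simp) (by simp) (hne a ha),
          hN.arc_left (x := p) (y := q) (by simp) (by simp) (hne b hb)]
        exact hq a ha b hb
      · by_cases hvw : v = w
        · rw [hvw, h.opposite a ha.1 ha.2, h.opposite b hb.1 hb.2]
        · exact h.uniform v hvM hvw a ha.1 b hb.1
    obtain ⟨u, huM, hup⟩ := hM.2.1.exists_ne p
    have hMu : ∀ a ∈ M, a ≠ p → a = u := by
      intro a ha hap
      by_contra hau
      have := hall _ ⟨hmod, ⟨a, ⟨ha, hap⟩, u, ⟨huM, hup⟩, hau⟩, ⟨p, by simp⟩⟩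
      have hp : p ∈ ({p, q} : Set V) := by simp
      rw [← this] at hp
      exact hp.2 rfl
    have huw : u ≠ w := fun e => h.right_notMem (e ▸ huM)
    refine hc2 ⟨u, hup, fun e => hqM (e ▸ huM), huw, ?_, ?_, ?_⟩
    · intro v hvp hvq hvu hvw
      exact h.uniform_left (fun h' => hvu (hMu v h' hvp)) hvw huM h.left_mem
    · have h1 := h.opposite u huM hup
      have h2 := T.arc_iff u w huw
      rw [h2, h1]
    · exact h.uniform_left hqM hwq.symm huM h.left_mem

/-- There are `2(|V| - 2)` arcs between the pair and the other vertices, but by `bad_of_pair`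
at most `|V| - 1` of them are bad, since each source, sink or twin determines the arc. -/
lemma exists_indecomposable_of_pair [Finite V] {T : Tournament V} {p q : V}
    (hV : 5 ≤ Nat.card V) (hpq : p ≠ q)
    (hN : T.IsModule {p, q}) (hall : ∀ M, T.IsNontrivialModule M → M = {p, q}) :
    ∃ a b, (T.flipArc a b).Indecomposable := by
  by_contra hcon
  push Not at hcon
  let D := {v : V // v ∉ ({p, q} : Set V)}
  let e : Bool → V := fun b => if b then p else q
  have hgen : ∀ (w : D) (b : Bool), ∃ o : Option D,
      match o with
      | none => (∀ v : D, v ≠ w → (T.Arc p v ↔ T.Arc (e b) (e !b))) ∧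
          (T.Arc p w ↔ ¬ T.Arc (e b) (e !b))
      | some u => u ≠ w ∧ (∀ v : D, v ≠ u → v ≠ w → (T.Arc u v ↔ T.Arc p v)) ∧
          (T.Arc u w ↔ ¬ T.Arc p w) ∧ (T.Arc u p ↔ T.Arc (e b) (e !b)) := by
    rintro ⟨w, hw⟩ b
    have hw' := hw
    simp only [Set.mem_insert_iff, Set.mem_singleton_iff, not_or] at hw'
    have hN' : ∀ v ∉ ({p, q} : Set V), (T.Arc (e b) v ↔ T.Arc p v) := fun v hv =>
      hN.arc_left (by cases b <;> simp [e]) (by simp) hv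
    have hN'' : ∀ v ∉ ({p, q} : Set V), (T.Arc v (e !b) ↔ T.Arc v p) := fun v hv =>
      hN _ (by cases b <;> simp [e]) _ (by simp) v hv
    have hset : ({e b, e !b} : Set V) = {p, q} := by
      cases b
      · simp [e, Set.pair_comm]
      · simp [e]
    have hne : ∀ v : D, v.1 ≠ e b ∧ v.1 ≠ e !b := by
      rintro ⟨v, hv⟩
      simp only [Set.mem_insert_iff, Set.mem_singleton_iff, not_or] at hv
      cases b <;> simp [e, hv]
    have h := bad_of_pair (T := T) (p := e b) (q := e !b) (w := w)
      (by cases b <;> simp [e, hpq, hpq.symm]) (by rwa [hset]) (by rwa [hset])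
      (hne ⟨w, hw⟩).1 (hne ⟨w, hw⟩).2 (hcon _ _)
    rcases h with ⟨h1, h2⟩ | ⟨u, hu1, hu2, huw, h1, h2, h3⟩
    · refine ⟨none, fun v hvw => ?_, ?_⟩
      · rw [← hN' v v.2]
        exact h1 v (hne v).1 (hne v).2 (fun e' => hvw (Subtype.ext e'))
      · rw [← hN' w hw]; exact h2
    · have hu : u ∉ ({p, q} : Set V) := by rw [← hset]; simp [hu1, hu2]
      refine ⟨some ⟨u, hu⟩, fun e' => huw (congrArg Subtype.val e'), fun v hvu hvw => ?_, ?_, ?_⟩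
      · rw [← hN' v v.2]
        exact h1 v (hne v).1 (hne v).2 (fun e' => hvu (Subtype.ext e'))
          (fun e' => hvw (Subtype.ext e'))
      · rw [← hN' w hw]; exact h2
      · rw [← hN'' u hu]; exact h3
  choose f hf using hgen
  have hcardD : Nat.card D + 2 = Nat.card V := by
    have h1 := Set.ncard_add_ncard_compl ({p, q} : Set V)
    rw [Set.ncard_pair hpq] at h1
    have h2 : Nat.card D = ({p, q}ᶜ : Set V).ncard := rfl
    omega
  have hpq' : ∀ b b' : Bool, b ≠ b' → (T.Arc (e b) (e !b) ↔ ¬ T.Arc (e b') (e !b')) := by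
    have h1 := T.arc_iff p q hpq
    intro b b' hb
    cases b <;> cases b' <;> simp [e] at hb ⊢ <;> tauto
  have hinj : Function.Injective (fun x : D × Bool => f x.1 x.2) := by
    rintro ⟨w, b⟩ ⟨w', b'⟩ heq
    simp only at heq
    have h1 := hf w b
    have h2 := hf w' b'
    rw [← heq] at h2
    rcases ho : f w b with _ | u
    · rw [ho] at h1 h2
      simp only at h1 h2
      have hb : b = b' := by
        by_contra hb
        obtain ⟨v, hv⟩ : ∃ v : D, v ∉ ({w, w'} : Set D) := by
          by_contra hall'
          push Not at hall'
          have h3 : ({w, w'} : Set D) = Set.univ := Set.eq_univ_of_forall hall'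
          have h4 := Set.ncard_insert_le w ({w'} : Set D)
          rw [h3, Set.ncard_univ] at h4
          simp at h4; omega
        simp only [Set.mem_insert_iff, Set.mem_singleton_iff, not_or] at hv
        have h3 := h1.1 v hv.1
        have h4 := h2.1 v hv.2
        have h5 := hpq' b b' hb
        tauto
      subst hb
      by_contra hww
      have hww' : w ≠ w' := fun e' => hww (by rw [e'])
      have h3 := h2.1 w hww'
      tauto
    · rw [ho] at h1 h2
      simp only at h1 h2
      have hb : b = b' := by
        by_contra hb
        have h5 := hpq' b b' hb
        tauto
      subst hb
      by_contra hww
      have hww' : w ≠ w' := fun e' => hww (by rw [e'])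
      have h3 := h2.2.1 w h1.1.symm hww'
      tauto
  have hle := Nat.card_le_card_of_injective _ hinj
  rw [Nat.card_prod, Nat.card_eq_fintype_card (α := Bool), Fintype.card_bool,
    Finite.card_option] at hle
  omega

/-- A decomposable tournament with a transversal of two vertices becomes indecomposable after
a single flip. -/
theorem Hits.exists_indecomposable [Finite V] {T : Tournament V} {x y : V}
    (hX : T.Hits {x, y}) (hV : 5 ≤ Nat.card V) {N₀ : Set V} (hN₀ : T.IsNontrivialModule N₀) :
    ∃ a b, (T.flipArc a b).Indecomposable := by
  by_cases hdisj : ∃ C D, T.IsNontrivialModule C ∧ T.IsNontrivialModule D ∧ Disjoint C D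
  · obtain ⟨C, D, hC, hD, hCD⟩ := hdisj
    exact ⟨x, y, hX.indecomposable_flipArc_of_disjoint hC hD hCD⟩
  push Not at hdisj
  obtain ⟨N, -, hNmax⟩ := (Set.toFinite {N | T.IsNontrivialModule N}).exists_le_maximal hN₀
  have hN : T.IsNontrivialModule N := hNmax.1
  wlog hxN : x ∈ N generalizing x y
  · exact this (x := y) (y := x) (by rwa [Set.pair_comm]) (by have := hX.separates hN; tauto)
  have hyN : y ∉ N := by have := hX.separates hN; tauto
  have hxy : x ≠ y := fun e => hyN (e ▸ hxN)
  by_cases hD : ∀ v, v ∉ N → v = y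
  · have hNy : ∀ v, v ≠ y → v ∈ N := fun v hv => by by_contra h; exact hv (hD v h)
    by_cases hyx : T.Arc y x
    · exact hX.exists_indecomposable_of_source hV hxy fun v hv =>
        (hN.1 v (hNy v hv) x hxN y hyN).2 hyx
    · obtain ⟨a, b, hab⟩ := (hits_dual.2 hX).exists_indecomposable_of_source hV hxy
        fun v hv => (hN.1.arc_left (hNy v hv) hxN hyN).2
          ((T.arc_or_arc hxy).resolve_right hyx)
      refine ⟨a, b, fun M hM => ?_⟩
      rw [dual_flipArc] at hab
      exact hab M (isModule_dual.2 hM)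
  push Not at hD
  obtain ⟨y', hy'N, hyy'⟩ := hD
  have hall : ∀ M, T.IsNontrivialModule M → M ⊆ N := by
    intro M hM
    by_contra hsub
    obtain ⟨c, hcM, hcN⟩ := Set.not_disjoint_iff.1 (hdisj M N hM hN)
    have hcov : ∀ v, v ∉ N → v ∈ M := by
      intro v hvN
      by_contra hvM
      have hun : T.IsNontrivialModule (M ∪ N) :=
        ⟨hM.1.union hN.1 ⟨c, hcM, hcN⟩, hN.2.1.mono Set.subset_union_right, ⟨v, by simp [hvM, hvN]⟩⟩
      exact hsub (Set.subset_union_left.trans (hNmax.2 hun Set.subset_union_right))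
    obtain ⟨n, hnM⟩ := hM.2.2
    have hnN : n ∈ N := by by_contra h; exact hnM (hcov n h)
    have hDm : T.IsModule Nᶜ := by
      intro a ha b hb v hv
      rw [Set.mem_compl_iff, not_not] at hv
      rw [hN.1.arc_left hv hnN ha, hN.1.arc_left hv hnN hb]
      exact hM.1 a (hcov a ha) b (hcov b hb) n hnM
    exact hdisj N Nᶜ hN ⟨hDm, ⟨y, hyN, y', hy'N, hyy'.symm⟩, ⟨x, by simpa using hxN⟩⟩
      disjoint_compl_right
  have hxM : ∀ M, T.IsNontrivialModule M → x ∈ M := by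
    intro M hM
    have h1 := hX.separates hM
    have h2 : y ∉ M := fun h => hyN (hall M hM h)
    tauto
  by_cases hN3 : ∀ c, ∃ n ∈ N, n ≠ c ∧ n ≠ x
  · refine ⟨x, y, indecomposable_flipArc ?_ ?_ ?_⟩
    · intro M hM h
      have := hX.separates hM
      tauto
    · intro M hM h
      exact not_splitModule_out_of_module hN hxM hN3 hxN hyN hM.2.1 h
    · intro M hM h
      refine not_splitModule_into_module hN (fun M hM => ⟨hall M hM, hxM M hM⟩) ?_ hN3 hxN hyN
        hM.2.1 h
      intro w
      by_cases hwy : w = y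
      · exact ⟨y', hy'N, fun e => hyy' (e.trans hwy)⟩
      · exact ⟨y, hyN, Ne.symm hwy⟩
  · push Not at hN3
    obtain ⟨c, hc⟩ := hN3
    obtain ⟨q, hq, hqx⟩ := hN.2.1.exists_ne x
    have hNeq : N = {x, q} := by
      ext v
      constructor
      · intro hv
        by_cases hvx : v = x
        · exact Or.inl hvx
        · right
          by_cases hvc : v = c
          · by_cases hqc : q = c
            · rw [hvc, ← hqc]; rfl
            · exact absurd (hc q hq hqc) hqx
          · exact absurd (hc v hv hvc) hvx
      · rintro (rfl | rfl) <;> assumption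
    refine exists_indecomposable_of_pair hV hqx.symm (hNeq ▸ hN.1) (fun M hM => ?_)
    rw [← hNeq]
    refine Set.Subset.antisymm (hall M hM) ?_
    intro v hv
    rw [hNeq] at hv
    obtain ⟨m, hm, hmx⟩ := hM.2.1.exists_ne x
    have hmN := hall M hM hm
    rw [hNeq] at hmN
    rcases hv with rfl | rfl
    · exact hxM M hM
    · rcases hmN with h | h
      · exact absurd h hmx
      · rwa [← h]

/-! ### Bounds for the decomposability index -/

/-- The arcs of `T` that are reversed in `T'`. -/
def reversedArcs (T T' : Tournament V) : Set (V × V) := {p | T.Arc p.1 p.2 ∧ ¬ T'.Arc p.1 p.2}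

lemma exists_inv_eq [Finite V] (T T' : Tournament V) :
    ∃ (B : Finset (V × V)) (hB : (B : Set (V × V)) ⊆ T.arcSet),
      B.card = (T.reversedArcs T').ncard ∧ T.inv B hB = T' := by
  have hfin := Set.toFinite (T.reversedArcs T')
  have hmem : ∀ a b, (a, b) ∈ hfin.toFinset ↔ T.Arc a b ∧ ¬ T'.Arc a b := fun a b => by
    simp [reversedArcs]
  refine ⟨hfin.toFinset, fun p hp => ((hmem p.1 p.2).1 hp).1,
    (Set.ncard_eq_toFinset_card _ hfin).symm, ?_⟩
  ext a b
  simp only [inv, hmem]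
  by_cases hab : a = b
  · subst hab
    have h1 := T.irrefl a
    have h2 := T'.irrefl a
    tauto
  · have h1 := T.arc_iff a b hab
    have h2 := T'.arc_iff a b hab
    tauto

lemma ncard_reversedArcs_flipArc_le (T : Tournament V) (x y : V) :
    (T.reversedArcs (T.flipArc x y)).ncard ≤ 1 := by
  have h : ∃ p, T.reversedArcs (T.flipArc x y) ⊆ {p} := by
    have key : ∀ p ∈ T.reversedArcs (T.flipArc x y), T.Arc p.1 p.2 ∧
        ((p.1 = x ∧ p.2 = y) ∨ (p.1 = y ∧ p.2 = x)) := by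
      rintro p ⟨h1, h2⟩
      refine ⟨h1, ?_⟩
      by_contra h
      exact h2 ((flipArc_arc_of_ne h).2 h1)
    by_cases hxy : T.Arc x y
    · refine ⟨(x, y), fun p hp => ?_⟩
      obtain ⟨h1, ⟨h2, h3⟩ | ⟨h2, h3⟩⟩ := key p hp
      · exact Prod.ext h2 h3
      · rw [h2, h3] at h1; exact absurd hxy h1.asymm
    · refine ⟨(y, x), fun p hp => ?_⟩
      obtain ⟨h1, ⟨h2, h3⟩ | ⟨h2, h3⟩⟩ := key p hp
      · rw [h2, h3] at h1; exact absurd h1 hxy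
      · exact Prod.ext h2 h3
  obtain ⟨p, hp⟩ := h
  exact (Set.ncard_le_ncard hp (Set.finite_singleton p)).trans (Set.ncard_singleton p).le

lemma ncard_reversedArcs_le [Finite V] (T : Tournament V) (x y : V) (T' : Tournament V) :
    (T.reversedArcs T').ncard ≤ ((T.flipArc x y).reversedArcs T').ncard + 1 := by
  have h : T.reversedArcs T' ⊆
      T.reversedArcs (T.flipArc x y) ∪ (T.flipArc x y).reversedArcs T' := by
    rintro p ⟨h1, h2⟩
    by_cases h : (T.flipArc x y).Arc p.1 p.2
    · exact Or.inr ⟨h, h2⟩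
    · exact Or.inl ⟨h1, h⟩
  have h1 := Set.ncard_le_ncard h (Set.toFinite _)
  have h2 := Set.ncard_union_le (T.reversedArcs (T.flipArc x y)) ((T.flipArc x y).reversedArcs T')
  have h3 := ncard_reversedArcs_flipArc_le T x y
  omega

lemma PackedTransversal.ncard_le [Finite V] {T : Tournament V} {X Y : Set V} {P : V → Set V}
    (h : T.PackedTransversal X P) (hY : T.Hits Y) : X.ncard ≤ Y.ncard := by
  have hex : ∀ x, ∃ y, x ∈ X → y ∈ P x ∧ y ∈ Y := by
    intro x
    by_cases hx : x ∈ X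
    · obtain ⟨y, hy⟩ := hY.inter_nonempty (h.min x hx).1
      exact ⟨y, fun _ => hy⟩
    · exact ⟨x, fun h' => absurd h' hx⟩
  choose f hf using hex
  refine Set.ncard_le_ncard_of_injOn f (fun x hx => (hf x hx).2) ?_ (Set.toFinite _)
  intro x hx x' hx' e
  by_contra hne
  exact Set.disjoint_left.1 (h.disj x hx x' hx' hne) (hf x hx).1 (e ▸ (hf x' hx').1)

/-- A transversal with at least four vertices loses two of them in a suitable flip. -/
lemma PackedTransversal.exists_flipArc [Finite V] {T : Tournament V} {X : Set V} {P : V → Set V}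
    (h : T.PackedTransversal X P) (hX : 4 ≤ X.ncard) :
    ∃ x y Y, (T.flipArc x y).Hits Y ∧ Y.ncard + 2 ≤ X.ncard := by
  have new : ∀ S : Set V, S.ncard ≤ 3 → ∃ v ∈ X, v ∉ S := by
    intro S hS
    exact Set.exists_mem_notMem_of_ncard_lt_ncard (by omega)
  have c1 : ∀ a : V, ({a} : Set V).ncard ≤ 1 := fun a => (Set.ncard_singleton a).le
  have c2 : ∀ a b : V, ({a, b} : Set V).ncard ≤ 2 := fun a b =>
    (Set.ncard_insert_le _ _).trans (by have := c1 b; omega)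
  have c3 : ∀ a b c : V, ({a, b, c} : Set V).ncard ≤ 3 := fun a b c =>
    (Set.ncard_insert_le _ _).trans (by have := c2 b c; omega)
  obtain ⟨x, hx, -⟩ := new ∅ (by simp)
  obtain ⟨y, hy, hyx⟩ := new {x} ((c1 x).trans (by norm_num))
  obtain ⟨z, hz, hzz⟩ := new {x, y} ((c2 x y).trans (by norm_num))
  obtain ⟨w, hw, hww⟩ := new {x, y, z} (c3 x y z)
  simp only [Set.mem_insert_iff, Set.mem_singleton_iff, not_or] at hyx hzz hww
  have step : ∀ x y u v, x ∈ X → y ∈ X → u ∈ X → v ∈ X → x ≠ y → u ≠ x → u ≠ y → v ≠ x → v ≠ y →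
      u ≠ v → (∀ F, T.IsComodule F → F ∩ X ≠ {x, y}) →
      ∃ x y Y, (T.flipArc x y).Hits Y ∧ Y.ncard + 2 ≤ X.ncard := by
    intro x y u v hx hy hu hv hxy hux huy hvx hvy huv hF
    refine ⟨x, y, X \ {x, y}, h.hits.flipArc hx hy (u := u) (v := v) (by simp [hu, hux, huy])
      (by simp [hv, hvx, hvy]) huv (h.min x hx).1 (h.min y hy).1 (h.disj x hx y hy hxy)
      (h.inter_eq hx) (h.inter_eq hy) hF, ?_⟩
    have hsub : ({x, y} : Set V) ⊆ X := by rintro v (rfl | rfl) <;> assumption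
    have h1 := Set.ncard_sdiff_add_ncard_of_subset hsub (Set.toFinite _)
    rw [Set.ncard_pair hxy] at h1
    omega
  by_contra hcon
  have b1 : ∃ F, T.IsComodule F ∧ F ∩ X = {x, y} := by
    by_contra hF
    push Not at hF
    exact hcon (step x y z w hx hy hz hw (Ne.symm hyx) hzz.1 hzz.2 hww.1 hww.2.1
      (Ne.symm hww.2.2) hF)
  have b2 : ∃ F, T.IsComodule F ∧ F ∩ X = {y, z} := by
    by_contra hF
    push Not at hF
    exact hcon (step y z x w hy hz hx hw (Ne.symm hzz.2) (Ne.symm hyx) (Ne.symm hzz.1) hww.2.1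
      hww.2.2 (Ne.symm hww.1) hF)
  have b3 : ∃ F, T.IsComodule F ∧ F ∩ X = {x, z} := by
    by_contra hF
    push Not at hF
    exact hcon (step x z y w hx hz hy hw (Ne.symm hzz.1) hyx (Ne.symm hzz.2) hww.1
      hww.2.2 (Ne.symm hww.2.1) hF)
  obtain ⟨F, hF, eF⟩ := b1
  obtain ⟨G, hG, eG⟩ := b2
  obtain ⟨H, hH, eH⟩ := b3
  have hmem : ∀ (F : Set V) (p q : V), F ∩ X = {p, q} → ∀ v ∈ X, (v ∈ F ↔ v = p ∨ v = q) := by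
    intro F p q hF v hv
    have := Set.ext_iff.1 hF v
    simp only [Set.mem_inter_iff, Set.mem_insert_iff, Set.mem_singleton_iff] at this
    exact ⟨fun h => this.1 ⟨h, hv⟩, fun h => (this.2 h).1⟩
  have mF := hmem F x y eF
  have mG := hmem G y z eG
  have mH := hmem H x z eH
  exact not_three_pairings (w := w) (Ne.symm hyx) (Ne.symm hzz.2) (Ne.symm hzz.1) hF hG hH
    ((mF x hx).2 (by simp)) ((mF y hy).2 (by simp))
    (fun h => by have := (mF z hz).1 h; tauto)
    (fun h => by have := (mF w hw).1 h; tauto)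
    (fun h => by have := (mG x hx).1 h; grind)
    ((mG y hy).2 (by simp)) ((mG z hz).2 (by simp))
    (fun h => by have := (mG w hw).1 h; tauto)
    ((mH x hx).2 (by simp))
    (fun h => by have := (mH y hy).1 h; grind)
    ((mH z hz).2 (by simp))
    (fun h => by have := (mH w hw).1 h; tauto)

/-- A tournament with a transversal of `k` vertices becomes indecomposable after at most
`⌈k / 2⌉` flips. -/
theorem Hits.exists_indecomposable_le [Finite V] (hV : 5 ≤ Nat.card V) (k : ℕ) :
    ∀ (T : Tournament V) (Y : Set V), T.Hits Y → Y.ncard ≤ k →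
      ∃ T' : Tournament V, T'.Indecomposable ∧ (T.reversedArcs T').ncard ≤ (k + 1) / 2 := by
  induction k using Nat.strong_induction_on with
  | _ k ih =>
  intro T Y hY hYk
  by_cases hdec : ∃ N, T.IsNontrivialModule N
  swap
  · push Not at hdec
    refine ⟨T, indecomposable_of_forall hdec, ?_⟩
    have : T.reversedArcs T = ∅ := by ext p; simp [reversedArcs]
    simp [this]
  obtain ⟨N, hN⟩ := hdec
  obtain ⟨X, P, hXP⟩ := exists_packedTransversal T
  have hXk := (hXP.ncard_le hY).trans hYk
  obtain ⟨a, haN, haX⟩ := (hXP.hits N hN).1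
  obtain ⟨b, hbN, hbX⟩ := (hXP.hits N hN).2
  have hab : a ≠ b := fun e => hbN (e ▸ haN)
  have h2 : 2 ≤ X.ncard := by
    rw [← Set.ncard_pair hab]
    apply Set.ncard_le_ncard _ (Set.toFinite _)
    rintro v (rfl | rfl) <;> assumption
  rcases (by omega : X.ncard = 2 ∨ X.ncard = 3 ∨ 4 ≤ X.ncard) with hc | hc | hc
  · obtain ⟨x, y, -, rfl⟩ := Set.ncard_eq_two.1 hc
    obtain ⟨a, b, hi⟩ := hXP.hits.exists_indecomposable hV hN
    refine ⟨_, hi, (ncard_reversedArcs_flipArc_le T a b).trans ?_⟩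
    omega
  · obtain ⟨x, y, z, hxy, hxz, hyz, rfl⟩ := Set.ncard_eq_three.1 hc
    have hx : x ∈ ({x, y, z} : Set V) := by simp
    have hy : y ∈ ({x, y, z} : Set V) := by simp
    have hz : z ∈ ({x, y, z} : Set V) := by simp
    obtain ⟨a, b, p, q, hpq⟩ := hasPairFlip_of_triple hXP.hits (hXP.min x hx).1 (hXP.min y hy).1
      (hXP.min z hz).1 (hXP.disj x hx y hy hxy) (hXP.disj x hx z hz hxz)
      (hXP.disj y hy z hz hyz) (hXP.mem x hx) (hXP.mem y hy) (hXP.mem z hz)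
    have hle : ({p, q} : Set V).ncard ≤ 2 :=
      (Set.ncard_insert_le _ _).trans (by simp)
    obtain ⟨T', hT', hle'⟩ := ih 2 (by omega) _ _ hpq hle
    refine ⟨T', hT', (ncard_reversedArcs_le T a b T').trans ?_⟩
    omega
  · obtain ⟨x, y, Z, hZ, hZX⟩ := hXP.exists_flipArc hc
    obtain ⟨T', hT', hle'⟩ := ih (k - 2) (by omega) _ _ hZ (by omega)
    refine ⟨T', hT', (ncard_reversedArcs_le T x y T').trans ?_⟩
    omega

lemma Hits.decompIndex_le [Finite V] (hV : 5 ≤ Nat.card V) {T : Tournament V} {Y : Set V}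
    (hY : T.Hits Y) : T.decompIndex ≤ (Y.ncard + 1) / 2 := by
  obtain ⟨T', hT', hle⟩ := hY.exists_indecomposable_le hV _ _ _ le_rfl
  obtain ⟨B, hB, hcard, hinv⟩ := exists_inv_eq T T'
  refine le_trans (Nat.sInf_le ⟨B, hB, rfl, ?_⟩) (hcard.le.trans hle)
  rwa [hinv]

lemma exists_decompIndex_eq [Finite V] (hV : 5 ≤ Nat.card V) (T : Tournament V) :
    ∃ (B : Finset (V × V)) (hB : (B : Set (V × V)) ⊆ T.arcSet),
      B.card = T.decompIndex ∧ (T.inv B hB).Indecomposable := by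
  have hU : T.Hits Set.univ := fun M hM => by simpa using ⟨hM.2.1.nonempty, hM.2.2⟩
  obtain ⟨T', hT', -⟩ := hU.exists_indecomposable_le hV _ _ _ le_rfl
  obtain ⟨B, hB, -, hinv⟩ := exists_inv_eq T T'
  exact Nat.sInf_mem (s := {m | ∃ (B : Finset (V × V)) (hB : (B : Set (V × V)) ⊆ T.arcSet),
    B.card = m ∧ (T.inv B hB).Indecomposable}) ⟨_, B, hB, rfl, by rwa [hinv]⟩

/-- `T` has `k` pairwise disjoint nontrivial co-modules. -/
def HasPacking (T : Tournament V) (k : ℕ) : Prop :=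
  ∃ P : Fin k → Set V, (∀ i, T.IsComodule (P i)) ∧ Pairwise fun i j => Disjoint (P i) (P j)

/-- Each member of a packing contains an endpoint of a reversed arc. -/
lemma HasPacking.le_of_indecomposable {T : Tournament V} {k : ℕ} (h : T.HasPacking k)
    {B : Finset (V × V)} {hB : (B : Set (V × V)) ⊆ T.arcSet}
    (hi : (T.inv B hB).Indecomposable) : k ≤ 2 * B.card := by
  obtain ⟨P, hP, hdisj⟩ := h
  have nosep : ∀ M, T.IsNontrivialModule M → (∀ p ∈ B, p.1 ∈ M ↔ p.2 ∈ M) → False := by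
    intro M hM hsep
    refine hi.not_nontrivialModule M ⟨?_, hM.2⟩
    have key : ∀ a ∈ M, ∀ v ∉ M, ((T.inv B hB).Arc v a ↔ T.Arc v a) := by
      intro a ha v hv
      have h1 : (v, a) ∉ B := fun h => hv ((hsep _ h).2 ha)
      have h2 : (a, v) ∉ B := fun h => hv ((hsep _ h).1 ha)
      simp [inv, h1, h2]
    intro a ha b hb v hv
    rw [key a ha v hv, key b hb v hv]
    exact hM.1 a ha b hb v hv
  have hex : ∀ i, ∃ f : B × Bool, (if f.2 then f.1.1.1 else f.1.1.2) ∈ P i := by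
    intro i
    have : ∃ p ∈ B, p.1 ∈ P i ∨ p.2 ∈ P i := by
      by_contra hcon
      push Not at hcon
      rcases hP i with h | h
      · exact nosep _ h fun p hp => iff_of_false (hcon p hp).1 (hcon p hp).2
      · exact nosep _ h fun p hp => iff_of_true (hcon p hp).1 (hcon p hp).2
    obtain ⟨p, hp, h1 | h1⟩ := this
    · exact ⟨(⟨p, hp⟩, true), by simpa using h1⟩
    · exact ⟨(⟨p, hp⟩, false), by simpa using h1⟩
  choose f hf using hex
  have hinj : Function.Injective f := by
    intro i j e
    by_contra hne
    exact Set.disjoint_left.1 (hdisj hne) (hf i) (e ▸ hf j)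
  have := Fintype.card_le_of_injective f hinj
  simp at this
  omega

lemma HasPacking.le_decompIndex [Finite V] (hV : 5 ≤ Nat.card V) {T : Tournament V} {k : ℕ}
    (h : T.HasPacking k) : k ≤ 2 * T.decompIndex := by
  obtain ⟨B, hB, hcard, hi⟩ := exists_decompIndex_eq hV T
  rw [← hcard]
  exact h.le_of_indecomposable hi

/-! ### The maximum of the decomposability index -/

lemma ncard_singleton_comodules_le {T : Tournament V} {S : Set V}
    (hS : ∀ x ∈ S, T.IsComodule {x}) : S.ncard ≤ 2 := by
  have hmod : ∀ x ∈ S, T.IsModule {x}ᶜ := by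
    intro x hx
    rcases hS x hx with h | h
    · exact absurd h.2.1 Set.not_nontrivial_singleton
    · exact h.1
  by_contra hcon
  obtain ⟨x, y, z, hx, hy, hz, hxy, hxz, hyz⟩ := (Set.two_lt_ncard_iff (by
    by_contra h; exact hcon (by rw [Set.Infinite.ncard h]; norm_num))).1 (not_le.1 hcon)
  have h1 := hmod x hx y hxy.symm z hxz.symm x (by simp)
  have h2 := hmod y hy x hxy z hyz.symm y (by simp)
  have h3 := hmod z hz x hxz y hyz z (by simp)
  have a1 := T.arc_iff x y hxy
  have a2 := T.arc_iff x z hxz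
  have a3 := T.arc_iff y z hyz
  tauto

lemma sum_ncard_eq_ncard_biUnion [Finite V] (X : Finset V) (P : V → Set V)
    (hdisj : ∀ x ∈ X, ∀ y ∈ X, x ≠ y → Disjoint (P x) (P y)) :
    ∑ x ∈ X, (P x).ncard = (⋃ x ∈ X, P x).ncard := by
  classical
  have := Fintype.ofFinite V
  have h1 : (⋃ x ∈ X, P x) = ((X.biUnion fun x => (P x).toFinite.toFinset : Finset V) : Set V) := by
    ext v; simp
  rw [h1, Set.ncard_coe_finset, Finset.card_biUnion]
  · exact Finset.sum_congr rfl fun x _ => Set.ncard_eq_toFinset_card _ _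
  · intro x hx y hy hne
    rw [Function.onFun, Finset.disjoint_left]
    intro v
    simp only [Set.Finite.mem_toFinset]
    exact fun h => Set.disjoint_left.1 (hdisj x hx y hy hne) h

/-- A packing of minimal co-modules with distinguished vertices. -/
structure MinPacking (T : Tournament V) (X : Finset V) (P : V → Set V) : Prop where
  mem : ∀ x ∈ X, x ∈ P x
  min : ∀ x ∈ X, T.IsMinComodule (P x)
  disj : ∀ x ∈ X, ∀ y ∈ X, x ≠ y → Disjoint (P x) (P y)

lemma MinPacking.eq_singleton {T : Tournament V} {X : Finset V} {P : V → Set V}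
    (h : T.MinPacking X P) {x : V} (hx : x ∈ X) (h1 : (P x).ncard = 1) : P x = {x} := by
  obtain ⟨a, ha⟩ := Set.ncard_eq_one.1 h1
  have := h.mem x hx
  rw [ha] at this ⊢
  rw [this]

lemma MinPacking.ncard_pos [Finite V] {T : Tournament V} {X : Finset V} {P : V → Set V}
    (h : T.MinPacking X P) {x : V} (hx : x ∈ X) : 0 < (P x).ncard :=
  (Set.ncard_pos (Set.toFinite _)).2 ⟨x, h.mem x hx⟩

lemma MinPacking.card_singletons_le [Finite V] {T : Tournament V} {X : Finset V} {P : V → Set V}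
    (h : T.MinPacking X P) : (X.filter fun x => (P x).ncard = 1).card ≤ 2 := by
  rw [← Set.ncard_coe_finset]
  apply ncard_singleton_comodules_le (T := T)
  intro x hx
  simp only [Finset.coe_filter, Set.mem_ofPred_eq] at hx
  rw [← h.eq_singleton hx.1 hx.2]
  exact (h.min x hx.1).1

lemma MinPacking.card_le [Finite V] {T : Tournament V} {X : Finset V} {P : V → Set V}
    (h : T.MinPacking X P) : 2 * X.card ≤ Nat.card V + 2 := by
  have h1 := sum_ncard_eq_ncard_biUnion X P h.disj
  have h2 : (⋃ x ∈ X, P x).ncard ≤ Nat.card V := by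
    rw [← Set.ncard_univ]; exact Set.ncard_le_ncard (Set.subset_univ _)
  have h3 := h.card_singletons_le
  have h4 : ∑ x ∈ X, 2 ≤ ∑ x ∈ X, ((P x).ncard + if (P x).ncard = 1 then 1 else 0) := by
    apply Finset.sum_le_sum
    intro x hx
    have := h.ncard_pos hx
    split_ifs <;> omega
  rw [Finset.sum_add_distrib, ← Finset.card_filter] at h4
  simp at h4
  omega

lemma exists_minPacking [Finite V] (hV : 5 ≤ Nat.card V) (T : Tournament V) :
    ∃ X P, T.MinPacking X P ∧ T.decompIndex ≤ (X.card + 1) / 2 := by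
  obtain ⟨X, P, h⟩ := exists_packedTransversal T
  have hfin := X.toFinite
  refine ⟨hfin.toFinset, P, ⟨fun x hx => h.mem x (by simpa using hx),
    fun x hx => h.min x (by simpa using hx),
    fun x hx y hy => h.disj x (by simpa using hx) y (by simpa using hy)⟩, ?_⟩
  rw [← Set.ncard_eq_toFinset_card _ hfin]
  exact h.hits.decompIndex_le hV

lemma decompIndex_le_of_card [Finite V] {n : ℕ} (hn : 1 ≤ n) (hV : Nat.card V = 4 * n + 2)
    (T : Tournament V) : T.decompIndex ≤ n + 1 := by
  obtain ⟨X, P, h, hle⟩ := exists_minPacking (by omega) T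
  have := h.card_le
  omega

lemma hasPacking_transitive {n : ℕ} (hn : 1 ≤ n) :
    (transitive (4 * n + 2)).HasPacking (2 * n + 1) := by
  have hmem : ∀ (i : Fin (2 * n + 1)) (v : Fin (4 * n + 2)),
      v ∈ {v : Fin (4 * n + 2) | v.1 / 2 = i.1} ↔ v.1 / 2 = i.1 := fun _ _ => Iff.rfl
  refine ⟨fun i => {v | v.1 / 2 = i.1}, fun i => ?_, ?_⟩
  · have hi := i.2
    refine isComodule_of_isModule (a := ⟨2 * i.1, by omega⟩) (b := ⟨2 * i.1 + 1, by omega⟩)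
      (c := ⟨(2 * i.1 + 2) % (4 * n + 2), Nat.mod_lt _ (by omega)⟩) ?_ ?_ ?_ ?_ ?_
    · intro a ha b hb v hv
      rw [hmem] at ha hb hv
      simp only [transitive, Fin.lt_def]
      omega
    · rw [hmem]; simp
    · rw [hmem]; simp; omega
    · simp
    · rw [hmem]
      by_cases h : 2 * i.1 + 2 < 4 * n + 2
      · simp only [Nat.mod_eq_of_lt h]; omega
      · have : 2 * i.1 + 2 = 4 * n + 2 := by omega
        simp only [this, Nat.mod_self]; omega
  · intro i j hij
    rw [Set.disjoint_left]
    intro v hv hv'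
    rw [hmem] at hv hv'
    exact hij (Fin.ext (hv.symm.trans hv'))

lemma maxDecompIndex_eq {n : ℕ} (hn : 1 ≤ n) : maxDecompIndex (4 * n + 2) = n + 1 := by
  have hle : ∀ U : Tournament (Fin (4 * n + 2)), U.decompIndex ≤ n + 1 :=
    fun U => decompIndex_le_of_card hn (by simp) U
  apply le_antisymm
  · refine csSup_le ⟨_, ⟨transitive _, rfl⟩⟩ ?_
    rintro _ ⟨U, rfl⟩
    exact hle U
  · have h1 := (hasPacking_transitive hn).le_decompIndex (by simp; omega)
    have h2 : (transitive (4 * n + 2)).decompIndex ≤ maxDecompIndex (4 * n + 2) :=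
      le_csSup ⟨n + 1, by rintro _ ⟨U, rfl⟩; exact hle U⟩ ⟨transitive _, rfl⟩
    omega

lemma hasMaximalDecomposability_of_hasPacking [Finite V] {n : ℕ} (hn : 1 ≤ n)
    (hV : Nat.card V = 4 * n + 2) {T : Tournament V} (h : T.HasPacking (2 * n + 1)) :
    T.HasMaximalDecomposability := by
  refine ⟨by omega, ?_⟩
  rw [hV, maxDecompIndex_eq hn]
  have h1 := h.le_decompIndex (by omega)
  have h2 := decompIndex_le_of_card hn hV T
  omega

lemma HasMaximalDecomposability.exists_minPacking [Finite V] {n : ℕ} (hn : 1 ≤ n)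
    (hV : Nat.card V = 4 * n + 2) {T : Tournament V} (h : T.HasMaximalDecomposability) :
    ∃ X P, T.MinPacking X P ∧ X.card = 2 * n + 1 := by
  obtain ⟨X, P, hX, hle⟩ := Tournament.exists_minPacking h.1 T
  have h2 := h.2
  rw [hV, maxDecompIndex_eq hn] at h2
  obtain ⟨Y, hYX, hY⟩ := Finset.exists_subset_card_eq (show 2 * n + 1 ≤ X.card by omega)
  exact ⟨Y, P, ⟨fun x hx => hX.mem x (hYX hx), fun x hx => hX.min x (hYX hx),
    fun x hx y hy => hX.disj x (hYX hx) y (hYX hy)⟩, hY⟩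

/-! ### Isomorphisms with lexicographic sums -/

/-- The subtournament induced on a set of vertices. -/
def induce (T : Tournament V) (W : Set V) : Tournament W where
  Arc a b := T.Arc a b
  irrefl a := T.irrefl a
  arc_iff a b h := T.arc_iff a b fun e => h (Subtype.ext e)

lemma induce_iso_of_map {T : Tournament V} {W : Set V} {I : Type*} {R : Tournament I} (f : I → V)
    (hinj : Function.Injective f) (hW : ∀ v, v ∈ W ↔ ∃ i, f i = v)
    (harc : ∀ i j, T.Arc (f i) (f j) ↔ R.Arc i j) : (T.induce W).Iso R := by
  let g : I → W := fun i => ⟨f i, (hW _).2 ⟨i, rfl⟩⟩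
  have hg : Function.Bijective g := by
    refine ⟨fun i j h => hinj (congrArg Subtype.val h), ?_⟩
    rintro ⟨v, hv⟩
    obtain ⟨i, hi⟩ := (hW v).1 hv
    exact ⟨i, Subtype.ext hi⟩
  have e : R.Arc ≃r (T.induce W).Arc := ⟨Equiv.ofBijective g hg, fun {i j} => harc i j⟩
  exact ⟨e.symm⟩

lemma iso_of_induce_univ {T : Tournament V} {W : Type*} {R : Tournament W}
    (h : (T.induce Set.univ).Iso R) : T.Iso R := by
  obtain ⟨e⟩ := h
  exact ⟨RelIso.trans (⟨(Equiv.Set.univ V).symm, Iff.rfl⟩ : T.Arc ≃r (T.induce Set.univ).Arc) e⟩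

lemma iso_dual {T : Tournament V} {W : Type*} {R : Tournament W}
    (h : T.dual.Iso R) : T.Iso R.dual := by
  obtain ⟨e⟩ := h
  exact ⟨⟨e.toEquiv, fun {a b} => e.map_rel_iff⟩⟩

/-- A partition of `W` into sets indexed by the vertices of `R`, compatible with `R`, presents the
tournament on `W` as a lexicographic sum over `R`. -/
lemma induce_iso_lexSum {T : Tournament V} {W : Set V} {I : Type} (R : Tournament I)
    (F : I → BundledTournament) (c : I → Set V) (hW : ∀ v, v ∈ W ↔ ∃ i, v ∈ c i)
    (hdisj : ∀ i j, i ≠ j → Disjoint (c i) (c j))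
    (harc : ∀ i j, i ≠ j → ∀ a ∈ c i, ∀ b ∈ c j, (T.Arc a b ↔ R.Arc i j))
    (hiso : ∀ i, (T.induce (c i)).Iso (F i).2) : (T.induce W).Iso (R.lexSum F).2 := by
  have φ : ∀ i, (T.induce (c i)).Arc ≃r (F i).2.Arc := fun i => (hiso i).some
  refine induce_iso_of_map (I := Σ i, (F i).1) (fun p => ((φ p.1).symm p.2).1) ?_ ?_ ?_
  · rintro ⟨i, x⟩ ⟨j, y⟩ h
    by_cases hij : i = j
    · subst hij
      have hxy : x = y := (φ i).symm.injective (Subtype.ext h)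
      rw [hxy]
    · exact (Set.disjoint_left.1 (hdisj i j hij) ((φ i).symm x).2 (by
        simp only at h; rw [h]; exact ((φ j).symm y).2)).elim
  · intro v
    rw [hW]
    constructor
    · rintro ⟨i, hi⟩
      exact ⟨⟨i, φ i ⟨v, hi⟩⟩, by simp⟩
    · rintro ⟨⟨i, x⟩, rfl⟩
      exact ⟨i, ((φ i).symm x).2⟩
  · rintro ⟨i, x⟩ ⟨j, y⟩
    change _ ↔ Sigma.Lex _ _ _ _
    rw [Sigma.lex_iff]
    by_cases hij : i = j
    · subst hij
      have h1 : (T.induce (c i)).Arc ((φ i).symm x) ((φ i).symm y) ↔ (F i).2.Arc x y :=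
        (φ i).symm.map_rel_iff
      have h2 := R.irrefl i
      simp only [h2, false_or, exists_true_left]
      exact h1
    · have h1 := harc i j hij _ ((φ i).symm x).2 _ ((φ j).symm y).2
      simp only [h1, hij, IsEmpty.exists_iff, or_false]

lemma induce_iso_one {T : Tournament V} (a : V) : (T.induce {a}).Iso BundledTournament.one.2 := by
  refine induce_iso_of_map (I := Fin 1) (fun _ => a) (Function.injective_of_subsingleton _)
    (fun v => ?_) (fun i j => ?_)
  · simp [eq_comm]
  · have : i = j := Subsingleton.elim _ _
    subst this
    exact iff_of_false (T.irrefl a) (lt_irrefl i)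

lemma induce_iso_two {T : Tournament V} {S : Set V} (hS : S.ncard = 2) :
    (T.induce S).Iso BundledTournament.two.2 := by
  obtain ⟨a, b, hab, rfl⟩ := Set.ncard_eq_two.1 hS
  wlog h : T.Arc a b generalizing a b
  · rw [Set.pair_comm]
    exact this b a hab.symm (by rwa [Set.pair_comm]) ((T.arc_or_arc hab).resolve_left h)
  refine induce_iso_of_map (I := Fin 2) ![a, b] ?_ ?_ ?_
  · intro i j
    fin_cases i <;> fin_cases j <;> simp [hab, hab.symm]
  · intro v
    simp [Fin.exists_fin_two, eq_comm]
  · intro i j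
    change _ ↔ i < j
    fin_cases i <;> fin_cases j <;> simp [T.irrefl, h, h.asymm]

lemma induce_iso_c3 {T : Tournament V} {a b c : V} (hab : T.Arc a b) (hbc : T.Arc b c)
    (hca : T.Arc c a) : (T.induce {a, b, c}).Iso BundledTournament.c3.2 := by
  have h1 := hab.ne
  have h2 := hbc.ne
  have h3 := hca.ne
  refine induce_iso_of_map (I := Fin 3) ![a, b, c] ?_ ?_ ?_
  · intro i j
    fin_cases i <;> fin_cases j <;> simp [h1, h2, h3, h1.symm, h2.symm, h3.symm]
  · intro v
    simp [Fin.exists_fin_succ, eq_comm]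
  · intro i j
    change _ ↔ j = i + 1
    fin_cases i <;> fin_cases j <;>
      simp [T.irrefl, hab, hbc, hca, hab.asymm, hbc.asymm, hca.asymm]

open BundledTournament in
/-- A partition of `W` into modules, all of them pairs except those listed in `l`, presents the
tournament on `W` in the form `sumTwos`. -/
lemma exists_induce_iso_sumTwos {T : Tournament V} {W : Set V} (Lb : Finset V)
    (c : V → Set V) (hW : ∀ v, v ∈ W ↔ ∃ x ∈ Lb, v ∈ c x) (hmem : ∀ x ∈ Lb, x ∈ c x)
    (hdisj : ∀ x ∈ Lb, ∀ y ∈ Lb, x ≠ y → Disjoint (c x) (c y))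
    (hmod : ∀ x ∈ Lb, T.IsModule (c x)) (l : List V) (hl : l.Nodup) (hlL : ∀ x ∈ l, x ∈ Lb)
    (L : List BundledTournament) (hlen : l.length = L.length)
    (hiso : ∀ i (h : i < l.length), (T.induce (c l[i])).Iso (L.getD i two).2)
    (htwo : ∀ x ∈ Lb, x ∉ l → (c x).ncard = 2) {k : ℕ} (hk : Lb.card = k) :
    ∃ R : Tournament (Fin k), (T.induce W).Iso (R.sumTwos L).2 := by
  classical
  set ll := l ++ (Lb.filter fun x => x ∉ l).toList with hll
  have hllmem : ∀ x, x ∈ ll ↔ x ∈ Lb := by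
    intro x
    simp only [hll, List.mem_append, Finset.mem_toList, Finset.mem_filter]
    have := hlL x
    tauto
  have hnd : ll.Nodup := by
    rw [hll, List.nodup_append]
    refine ⟨hl, Finset.nodup_toList _, ?_⟩
    intro a ha b hb e
    simp only [Finset.mem_toList, Finset.mem_filter] at hb
    exact hb.2 (e ▸ ha)
  have hlen' : ll.length = k := by
    rw [← hk, ← List.toFinset_card_of_nodup hnd]
    congr 1
    ext x
    rw [List.mem_toFinset, hllmem]
  subst hlen'
  have hLb : ∀ i : Fin ll.length, ll[i] ∈ Lb := fun i => (hllmem _).1 (List.getElem_mem _)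
  have hinj : ∀ i j : Fin ll.length, ll[i] = ll[j] → i = j := fun i j h =>
    Fin.ext ((hnd.getElem_inj_iff).1 h)
  let R : Tournament (Fin ll.length) :=
    { Arc := fun i j => T.Arc ll[i] ll[j]
      irrefl := fun i => T.irrefl _
      arc_iff := fun i j h => T.arc_iff _ _ fun e => h (hinj i j e) }
  refine ⟨R, induce_iso_lexSum R _ (fun i => c ll[i]) ?_ ?_ ?_ ?_⟩
  · intro v
    rw [hW]
    constructor
    · rintro ⟨x, hx, hv⟩
      obtain ⟨i, hi, rfl⟩ := List.mem_iff_getElem.1 ((hllmem x).2 hx)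
      exact ⟨⟨i, hi⟩, hv⟩
    · rintro ⟨i, hi⟩
      exact ⟨_, hLb i, hi⟩
  · intro i j hij
    exact hdisj _ (hLb i) _ (hLb j) fun e => hij (hinj i j e)
  · intro i j hij a ha b hb
    have hd := hdisj _ (hLb i) _ (hLb j) fun e => hij (hinj i j e)
    rw [(hmod _ (hLb i)).arc_left ha (hmem _ (hLb i)) (Set.disjoint_right.1 hd hb)]
    exact hmod _ (hLb j) b hb _ (hmem _ (hLb j)) _
      (Set.disjoint_left.1 hd (hmem _ (hLb i)))
  · intro i
    by_cases hi : i.1 < l.length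
    · have e : ll[i.1]'i.2 = l[i.1] := List.getElem_append_left hi
      change (T.induce (c (ll[i.1]'i.2))).Iso _
      rw [e]
      exact hiso i.1 hi
    · rw [List.getD_eq_default _ _ (by omega)]
      apply induce_iso_two
      apply htwo _ (hLb i)
      intro hmem'
      obtain ⟨j, hj, he⟩ := List.mem_iff_getElem.1 hmem'
      have e : ll[j]'(by simp [hll]; omega) = l[j] := List.getElem_append_left hj
      have := (hnd.getElem_inj_iff (hi := by simp [hll]; omega) (hj := i.2)).1 (e.trans he)
      omega

/-! ### Small minimal co-modules -/

lemma IsMinComodule.not_submodule {T : Tournament V} {C : Set V} (hC : T.IsMinComodule C)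
    (hm : T.IsModule C) {M : Set V} (hMC : M ⊆ C) {a b c : V} (ha : a ∈ M) (hb : b ∈ M)
    (hab : a ≠ b) (hcC : c ∈ C) (hcM : c ∉ M)
    (h : ∀ v ∈ C, v ∉ M → ∀ x ∈ M, T.Arc v x ↔ T.Arc v a) : False := by
  have hmod : T.IsModule M := by
    intro x hx y hy v hv
    by_cases hvC : v ∈ C
    · rw [h v hvC hv x hx, h v hvC hv y hy]
    · exact hm x (hMC hx) y (hMC hy) v hvC
  have := hC.2 M (isComodule_of_isModule hmod ha hb hab hcM) hMC
  rw [this] at hcM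
  exact hcM hcC

lemma IsMinComodule.iso_c3 {T : Tournament V} {C : Set V} (hC : T.IsMinComodule C)
    (hm : T.IsModule C) (h3 : C.ncard = 3) : (T.induce C).Iso BundledTournament.c3.2 := by
  obtain ⟨a, b, c, hab, hac, hbc, rfl⟩ := Set.ncard_eq_three.1 h3
  wlog h : T.Arc a b generalizing a b
  · rw [Set.insert_comm] at hC hm h3 ⊢
    exact this b a hab.symm hbc hac hC hm h3 ((T.arc_or_arc hab).resolve_left h)
  have pair : ∀ {p q r : V}, ({p, q, r} : Set V) = {a, b, c} → p ≠ q → r ≠ p → r ≠ q →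
      (T.Arc r q ↔ T.Arc r p) → False := by
    intro p q r hset hpq hrp hrq hr
    rw [← hset] at hC hm
    refine hC.not_submodule hm (M := {p, q}) (a := p) (b := q) (c := r) ?_ (by simp) (by simp) hpq
      (by simp) (by simp [hrp, hrq]) ?_
    · intro v; simp; tauto
    · intro v hv hvM x hx
      have hvr : v = r := by simp at hv hvM; tauto
      rcases hx with rfl | rfl
      · rfl
      · rw [hvr]; exact hr
  have n1 := pair (p := a) (q := b) (r := c) rfl hab hac.symm hbc.symm
  have n2 := pair (p := b) (q := c) (r := a) (by ext; simp; tauto) hbc hab hac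
  have a1 := T.arc_iff a b hab
  have a2 := T.arc_iff a c hac
  have a3 := T.arc_iff b c hbc
  exact induce_iso_c3 h (by tauto) (by tauto)

lemma four_vertices {q₁ q₂ q₃ q₄ q₅ q₆ : Prop}
    (p₁ : (q₄ ↔ q₂) → (q₅ ↔ q₃) → False) (p₂ : (¬ q₄ ↔ q₁) → (q₆ ↔ q₃) → False)
    (p₃ : (¬ q₅ ↔ q₁) → (¬ q₆ ↔ q₂) → False) (p₄ : (¬ q₂ ↔ ¬ q₁) → (q₆ ↔ q₅) → False)
    (p₅ : (¬ q₃ ↔ ¬ q₁) → (¬ q₆ ↔ q₄) → False) (p₆ : (¬ q₃ ↔ ¬ q₂) → (¬ q₅ ↔ ¬ q₄) → False)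
    (t₁ : (q₅ ↔ q₃) → (q₆ ↔ q₃) → False) (t₂ : (q₄ ↔ q₂) → (¬ q₆ ↔ q₂) → False)
    (t₃ : (¬ q₄ ↔ q₁) → (¬ q₅ ↔ q₁) → False) (t₄ : (¬ q₂ ↔ ¬ q₁) → (¬ q₃ ↔ ¬ q₁) → False) :
    False := by
  by_cases b1 : q₁ <;> by_cases b2 : q₂ <;> by_cases b3 : q₃ <;>
    by_cases b4 : q₄ <;> by_cases b5 : q₅ <;> by_cases b6 : q₆ <;>
    simp_all

/-- A minimal module with four elements would induce an indecomposable tournament, but there is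
none on four vertices. -/
lemma IsMinComodule.ncard_ne_four {T : Tournament V} {C : Set V} (hC : T.IsMinComodule C)
    (hm : T.IsModule C) : C.ncard ≠ 4 := by
  intro h4
  obtain ⟨a, b, c, d, hab, hac, had, hbc, hbd, hcd, hCe⟩ := Set.ncard_eq_four.1 h4
  have ha : a ∈ C := by simp [hCe]
  have hb : b ∈ C := by simp [hCe]
  have hc : c ∈ C := by simp [hCe]
  have hd : d ∈ C := by simp [hCe]
  have hall : ∀ v ∈ C, v = a ∨ v = b ∨ v = c ∨ v = d := fun v hv => by simpa [hCe] using hv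
  have pair : ∀ {p q r s : V}, p ∈ C → q ∈ C → r ∈ C →
      (∀ v ∈ C, v = p ∨ v = q ∨ v = r ∨ v = s) → p ≠ q → r ≠ p → r ≠ q →
      (T.Arc r q ↔ T.Arc r p) → (T.Arc s q ↔ T.Arc s p) → False := by
    intro p q r s hp hq hr hset hpq hrp hrq h1 h2
    refine hC.not_submodule hm (M := {p, q}) (a := p) (b := q) (c := r) ?_ (by simp) (by simp) hpq
      hr (by simp [hrp, hrq]) ?_
    · rintro v (rfl | rfl) <;> assumption
    · rintro v hv hvM x (rfl | rfl)
      · rfl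
      · rcases hset v hv with rfl | rfl | rfl | rfl
        · simp at hvM
        · simp at hvM
        · exact h1
        · exact h2
  have triple : ∀ {p q r s : V}, p ∈ C → q ∈ C → r ∈ C → s ∈ C →
      (∀ v ∈ C, v = p ∨ v = q ∨ v = r ∨ v = s) → p ≠ q → s ≠ p → s ≠ q →
      s ≠ r → (T.Arc s q ↔ T.Arc s p) → (T.Arc s r ↔ T.Arc s p) → False := by
    intro p q r s hp hq hr hs hset hpq hsp hsq hsr h1 h2
    refine hC.not_submodule hm (M := {p, q, r}) (a := p) (b := q) (c := s) ?_ (by simp) (by simp)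
      hpq hs (by simp [hsp, hsq, hsr]) ?_
    · rintro v (rfl | rfl | rfl) <;> assumption
    · intro v hv hvM x hx
      have hvs : v = s := by
        rcases hset v hv with rfl | rfl | rfl | rfl
        · simp at hvM
        · simp at hvM
        · simp at hvM
        · rfl
      rw [hvs]
      rcases hx with rfl | rfl | rfl
      · rfl
      · exact h1
      · exact h2
  have p1 := pair (s := d) ha hb hc
    (fun v hv => by rcases hall v hv with rfl | rfl | rfl | rfl <;> simp)
    hab hac.symm hbc.symm
  have p2 := pair (s := d) ha hc hb
    (fun v hv => by rcases hall v hv with rfl | rfl | rfl | rfl <;> simp)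
    hac hab.symm hbc
  have p3 := pair (s := c) ha hd hb
    (fun v hv => by rcases hall v hv with rfl | rfl | rfl | rfl <;> simp)
    had hab.symm hbd
  have p4 := pair (s := d) hb hc ha
    (fun v hv => by rcases hall v hv with rfl | rfl | rfl | rfl <;> simp)
    hbc hab hac
  have p5 := pair (s := c) hb hd ha
    (fun v hv => by rcases hall v hv with rfl | rfl | rfl | rfl <;> simp)
    hbd hab had
  have p6 := pair (s := b) hc hd ha
    (fun v hv => by rcases hall v hv with rfl | rfl | rfl | rfl <;> simp)
    hcd hac had
  have t1 := triple ha hb hc hd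
    (fun v hv => by rcases hall v hv with rfl | rfl | rfl | rfl <;> simp)
    hab had.symm hbd.symm hcd.symm
  have t2 := triple ha hb hd hc
    (fun v hv => by rcases hall v hv with rfl | rfl | rfl | rfl <;> simp)
    hab hac.symm hbc.symm hcd
  have t3 := triple ha hc hd hb
    (fun v hv => by rcases hall v hv with rfl | rfl | rfl | rfl <;> simp)
    hac hab.symm hbc hbd
  have t4 := triple hb hc hd ha
    (fun v hv => by rcases hall v hv with rfl | rfl | rfl | rfl <;> simp)
    hbc hab hac had
  have a1 := T.arc_iff a b hab
  have a2 := T.arc_iff a c hac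
  have a3 := T.arc_iff a d had
  have a4 := T.arc_iff b c hbc
  have a5 := T.arc_iff b d hbd
  have a6 := T.arc_iff c d hcd
  rw [a4] at p2
  rw [a5, a6] at p3
  rw [a2, a1] at p4
  rw [a3, a1, a6] at p5
  rw [a3, a2, a5, a4] at p6
  rw [a6] at t2
  rw [a4, a5] at t3
  rw [a2, a1, a3] at t4
  exact four_vertices p1 p2 p3 p4 p5 p6 t1 t2 t3 t4

/-! ### Tournaments that are almost covered by disjoint pairs -/

open BundledTournament in
/-- If disjoint minimal modules cover a set `W` with `|W| = 2|Q| + e` and `e ≤ 2`, then they are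
pairs except for `i` three-cycles, and they miss `j` vertices, where `i + j = e`. -/
lemma MinPacking.exists_induce_iso_sumTwos [Finite V] {T : Tournament V} {Q : Finset V}
    {P : V → Set V} (h : T.MinPacking Q P) (hmod : ∀ x ∈ Q, T.IsModule (P x))
    (hn : ∀ x ∈ Q, 2 ≤ (P x).ncard) {W : Set V} (hW : ∀ x ∈ Q, P x ⊆ W) {e : ℕ} (he : e ≤ 2)
    (hWcard : W.ncard = 2 * Q.card + e) :
    ∃ i j, i + j = e ∧ i ≤ Q.card ∧ ∃ R : Tournament (Fin (Q.card + j)),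
      (T.induce W).Iso (R.sumTwos (List.replicate i c3 ++ List.replicate j one)).2 := by
  classical
  have := Fintype.ofFinite V
  set U : Finset V := Finset.univ.filter fun v => v ∈ W ∧ ∀ x ∈ Q, v ∉ P x with hU
  have hUmem : ∀ v, v ∈ U ↔ v ∈ W ∧ ∀ x ∈ Q, v ∉ P x := fun v => by simp [hU]
  have hUQ : ∀ v ∈ U, v ∉ Q := fun v hv hvQ => ((hUmem v).1 hv).2 v hvQ (h.mem v hvQ)
  -- The number of missed vertices is the excess of `W` over the total size of the packing.
  have hsum : ∑ x ∈ Q, (P x).ncard + U.card = W.ncard := by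
    rw [sum_ncard_eq_ncard_biUnion Q P h.disj, ← Set.ncard_coe_finset U, ← Set.ncard_union_eq]
    · congr 1
      ext v
      simp only [Set.mem_union, Set.mem_iUnion, Finset.mem_coe, hUmem]
      constructor
      · rintro (⟨x, hx, hv⟩ | hv)
        · exact hW x hx hv
        · exact hv.1
      · intro hv
        by_cases hc : ∃ x ∈ Q, v ∈ P x
        · obtain ⟨x, hx, hv'⟩ := hc
          exact Or.inl ⟨x, hx, hv'⟩
        · push Not at hc
          exact Or.inr ⟨hv, hc⟩
    · rw [Set.disjoint_left]
      intro v hv hvU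
      simp only [Set.mem_iUnion] at hv
      obtain ⟨x, hx, hv⟩ := hv
      exact ((hUmem v).1 hvU).2 x hx hv
  have hsum2 : ∑ x ∈ Q, ((P x).ncard - 2) + U.card = e := by
    have : ∑ x ∈ Q, ((P x).ncard - 2) + ∑ x ∈ Q, 2 = ∑ x ∈ Q, (P x).ncard := by
      rw [← Finset.sum_add_distrib]
      exact Finset.sum_congr rfl fun x hx => Nat.sub_add_cancel (hn x hx)
    simp at this
    omega
  have hsize : ∀ x ∈ Q, (P x).ncard = 2 ∨ (P x).ncard = 3 := by
    intro x hx
    have h1 := Finset.single_le_sum (f := fun x => (P x).ncard - 2) (fun _ _ => Nat.zero_le _) hx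
    have h2 := (h.min x hx).ncard_ne_four (hmod x hx)
    have h3 := hn x hx
    omega
  set B := Q.filter fun x => (P x).ncard = 3 with hB
  have hBcard : B.card + U.card = e := by
    rw [← hsum2, hB, Finset.card_filter]
    congr 1
    refine Finset.sum_congr rfl fun x hx => ?_
    rcases hsize x hx with h' | h' <;> simp [h']
  have hBmem : ∀ x, x ∈ B ↔ x ∈ Q ∧ (P x).ncard = 3 := fun x => by simp [hB]
  let c : V → Set V := fun l => if l ∈ Q then P l else {l}
  have hcQ : ∀ x ∈ Q, c x = P x := fun x hx => if_pos hx
  have hcU : ∀ x ∈ U, c x = {x} := fun x hx => if_neg (hUQ x hx)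
  have hdQU : Disjoint Q U := Finset.disjoint_right.2 hUQ
  refine ⟨B.card, U.card, hBcard, Finset.card_le_card (Finset.filter_subset _ _), ?_⟩
  refine Tournament.exists_induce_iso_sumTwos (Q ∪ U) c ?_ ?_ ?_ ?_ (B.toList ++ U.toList) ?_ ?_ _
    ?_ ?_ ?_ (Finset.card_union_of_disjoint hdQU)
  · intro v
    constructor
    · intro hv
      by_cases hc : ∃ x ∈ Q, v ∈ P x
      · obtain ⟨x, hx, hv'⟩ := hc
        exact ⟨x, Finset.mem_union_left _ hx, by rwa [hcQ x hx]⟩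
      · push Not at hc
        have hvU : v ∈ U := (hUmem v).2 ⟨hv, hc⟩
        exact ⟨v, Finset.mem_union_right _ hvU, by rw [hcU v hvU]; rfl⟩
    · rintro ⟨x, hx, hv⟩
      rcases Finset.mem_union.1 hx with hx | hx
      · rw [hcQ x hx] at hv
        exact hW x hx hv
      · rw [hcU x hx] at hv
        rw [hv]
        exact ((hUmem x).1 hx).1
  · intro x hx
    rcases Finset.mem_union.1 hx with hx | hx
    · rw [hcQ x hx]; exact h.mem x hx
    · rw [hcU x hx]; rfl
  · intro x hx y hy hxy
    rcases Finset.mem_union.1 hx with hx | hx <;> rcases Finset.mem_union.1 hy with hy | hy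
    · rw [hcQ x hx, hcQ y hy]; exact h.disj x hx y hy hxy
    · rw [hcQ x hx, hcU y hy, Set.disjoint_singleton_right]
      exact ((hUmem y).1 hy).2 x hx
    · rw [hcU x hx, hcQ y hy, Set.disjoint_singleton_left]
      exact ((hUmem x).1 hx).2 y hy
    · rw [hcU x hx, hcU y hy, Set.disjoint_singleton]
      exact hxy
  · intro x hx
    rcases Finset.mem_union.1 hx with hx | hx
    · rw [hcQ x hx]; exact hmod x hx
    · rw [hcU x hx]; exact isModule_singleton T x
  · rw [List.nodup_append]
    refine ⟨Finset.nodup_toList _, Finset.nodup_toList _, ?_⟩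
    intro a ha b hb e
    rw [Finset.mem_toList] at ha hb
    exact hUQ b hb (e ▸ ((hBmem a).1 ha).1)
  · intro x hx
    simp only [List.mem_append, Finset.mem_toList] at hx
    rcases hx with hx | hx
    · exact Finset.mem_union_left _ ((hBmem x).1 hx).1
    · exact Finset.mem_union_right _ hx
  · simp
  · intro i hi
    rw [List.getD_eq_getElem _ _ (by simpa using hi)]
    by_cases hiB : i < B.card
    · rw [List.getElem_append_left (by simpa using hiB),
        List.getElem_append_left (by simpa using hiB), List.getElem_replicate]
      have hx : B.toList[i]'(by simpa using hiB) ∈ B := Finset.mem_toList.1 (List.getElem_mem _)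
      have hx' := (hBmem _).1 hx
      rw [hcQ _ hx'.1]
      exact (h.min _ hx'.1).iso_c3 (hmod _ hx'.1) hx'.2
    · have hle : B.toList.length ≤ i := by simpa using hiB
      rw [List.getElem_append_right hle,
        List.getElem_append_right (by simpa using hiB), List.getElem_replicate]
      have hx : U.toList[i - B.toList.length]'(by simp at hi hle ⊢; omega) ∈ U :=
        Finset.mem_toList.1 (List.getElem_mem _)
      rw [hcU _ hx]
      exact induce_iso_one _
  · intro x hx hxl
    simp only [List.mem_append, Finset.mem_toList, not_or] at hxl
    have hxQ : x ∈ Q := (Finset.mem_union.1 hx).resolve_right hxl.2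
    rw [hcQ x hxQ]
    exact (hsize x hxQ).resolve_right fun h3 => hxl.1 ((hBmem x).2 ⟨hxQ, h3⟩)

/-! ### From packings to the forms -/

lemma isMinComodule_dual {T : Tournament V} {C : Set V} :
    T.dual.IsMinComodule C ↔ T.IsMinComodule C := by
  simp [IsMinComodule, isComodule_dual]

lemma MinPacking.dual {T : Tournament V} {X : Finset V} {P : V → Set V}
    (h : T.MinPacking X P) : T.dual.MinPacking X P :=
  ⟨h.mem, fun x hx => isMinComodule_dual.2 (h.min x hx), h.disj⟩

lemma MinPacking.mono {T : Tournament V} {X Y : Finset V} {P : V → Set V}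
    (h : T.MinPacking X P) (hY : Y ⊆ X) : T.MinPacking Y P :=
  ⟨fun x hx => h.mem x (hY hx), fun x hx => h.min x (hY hx),
    fun x hx y hy => h.disj x (hY hx) y (hY hy)⟩

lemma MinPacking.isModule {T : Tournament V} {X : Finset V} {P : V → Set V}
    (h : T.MinPacking X P) {x y : V} (hx : x ∈ X) (hy : y ∈ X) (hxy : x ≠ y)
    (hym : T.IsModule (P y)ᶜ) : T.IsModule (P x) := by
  rcases (h.min x hx).1 with h1 | h1
  · exact h1.1
  · exact isModule_of_compl_of_compl h1.1 hym (h.disj x hx y hy hxy) ⟨y, h.mem y hy⟩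

lemma source_or_sink {T : Tournament V} {x : V} (h : T.IsModule {x}ᶜ) :
    (∀ v, v ≠ x → T.Arc x v) ∨ (∀ v, v ≠ x → T.Arc v x) := by
  by_contra hcon
  push Not at hcon
  obtain ⟨⟨a, ha, h1⟩, b, hb, h2⟩ := hcon
  have h3 := h a ha b hb x (by simp)
  have h4 := T.arc_iff x b hb.symm
  tauto

open BundledTournament

lemma iso_transitive_two {T : Tournament V} {s : V} (hs : ∀ v, v ≠ s → T.Arc s v)
    {X : BundledTournament} (h : (T.induce {s}ᶜ).Iso X.2) :
    T.Iso ((transitive 2).lexSum ![one, X]).2 := by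
  refine iso_of_induce_univ (induce_iso_lexSum _ _ ![{s}, {s}ᶜ] ?_ ?_ ?_ ?_)
  · intro v
    simp [Fin.exists_fin_two, em]
  · intro i j hij
    fin_cases i <;> fin_cases j <;> simp at hij ⊢
  · intro i j hij a ha b hb
    change _ ↔ i < j
    fin_cases i <;> fin_cases j <;> simp at hij ha hb ⊢
    · subst ha; exact hs b hb
    · subst hb; exact (hs a ha).asymm
  · intro i
    fin_cases i
    · exact induce_iso_one s
    · exact h

lemma iso_transitive_three {T : Tournament V} {s t : V} (hst : s ≠ t)
    (hs : ∀ v, v ≠ s → T.Arc s v) (ht : ∀ v, v ≠ t → T.Arc v t)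
    {X : BundledTournament} (h : (T.induce {s, t}ᶜ).Iso X.2) :
    T.Iso ((transitive 3).lexSum ![one, X, one]).2 := by
  refine iso_of_induce_univ (induce_iso_lexSum _ _ ![{s}, {s, t}ᶜ, {t}] ?_ ?_ ?_ ?_)
  · intro v
    simp only [Set.mem_univ, true_iff]
    by_cases h1 : v = s
    · exact ⟨0, by simp [h1]⟩
    · by_cases h2 : v = t
      · exact ⟨2, by simp [h2]⟩
      · exact ⟨1, by simp [h1, h2]⟩
  · intro i j hij
    fin_cases i <;> fin_cases j <;> simp [hst, hst.symm] at hij ⊢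
  · intro i j hij a ha b hb
    change _ ↔ i < j
    fin_cases i <;> fin_cases j <;> simp at hij ha hb ⊢
    · subst ha; exact hs b hb.1
    · subst ha; subst hb; exact hs _ hst.symm
    · subst hb; exact (hs a ha.1).asymm
    · subst hb; exact ht a ha.2
    · subst ha; subst hb; exact (hs _ hst.symm).asymm
    · subst ha; exact (ht b hb.2).asymm
  · intro i
    fin_cases i
    · exact induce_iso_one s
    · exact h
    · exact induce_iso_one t

lemma iso_cycle3 {T : Tournament V} {p q : V} (hqp : T.Arc q p)
    (hp : ∀ v, v ≠ p → v ≠ q → T.Arc p v) (hq : ∀ v, v ≠ p → v ≠ q → T.Arc v q)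
    {X : BundledTournament} (h : (T.induce {q, p}ᶜ).Iso X.2) :
    T.Iso (cycle3.lexSum ![one, one, X]).2 := by
  have hne := hqp.ne
  refine iso_of_induce_univ (induce_iso_lexSum _ _ ![{q}, {p}, {q, p}ᶜ] ?_ ?_ ?_ ?_)
  · intro v
    simp only [Set.mem_univ, true_iff]
    by_cases h1 : v = q
    · exact ⟨0, by simp [h1]⟩
    · by_cases h2 : v = p
      · exact ⟨1, by simp [h2]⟩
      · exact ⟨2, by simp [h1, h2]⟩
  · intro i j hij
    fin_cases i <;> fin_cases j <;> simp [hne, hne.symm] at hij ⊢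
  · intro i j hij a ha b hb
    change _ ↔ j = i + 1
    fin_cases i <;> fin_cases j <;> simp at hij ha hb ⊢
    · subst ha; subst hb; exact hqp
    · subst ha; exact (hq b hb.2 hb.1).asymm
    · subst ha; subst hb; exact hqp.asymm
    · subst ha; exact hp b hb.2 hb.1
    · subst hb; exact hq a ha.2 ha.1
    · subst hb; exact (hp a ha.2 ha.1).asymm
  · intro i
    fin_cases i
    · exact induce_iso_one q
    · exact induce_iso_one p
    · exact h

/-- A packing without one-vertex members consists of pairs, and at most one of them is not a
module. -/
lemma MinPacking.form_of_no_singleton [Finite V] {T : Tournament V} {X : Finset V} {P : V → Set V}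
    {n : ℕ} (hV : Nat.card V = 4 * n + 2) (h : T.MinPacking X P)
    (hX : X.card = 2 * n + 1) (h2 : ∀ x ∈ X, 2 ≤ (P x).ncard) :
    (∃ R : Tournament (Fin (2 * n + 1)), T.Iso (R.lexSum fun _ => two).2) ∨
      (∃ R : Tournament (Fin (2 * n)),
        T.Iso (cycle3.lexSum ![one, one, R.lexSum fun _ => two]).2) := by
  classical
  by_cases hmod : ∀ x ∈ X, T.IsModule (P x)
  · left
    obtain ⟨i, j, hij, -, R, hR⟩ := h.exists_induce_iso_sumTwos hmod h2 (W := Set.univ)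
      (fun x _ => Set.subset_univ _) (e := 0) (by norm_num) (by rw [Set.ncard_univ]; omega)
    obtain ⟨rfl, rfl⟩ : i = 0 ∧ j = 0 := by omega
    rw [← hX]
    exact ⟨R, iso_of_induce_univ hR⟩
  · right
    push Not at hmod
    obtain ⟨y, hy, hym⟩ := hmod
    have hyc : T.IsNontrivialModule (P y)ᶜ := by
      rcases (h.min y hy).1 with h' | h'
      · exact absurd h'.1 hym
      · exact h'
    -- Equality holds in the count of vertices, so `P y` is a pair.
    have hy2 : (P y).ncard = 2 := by
      have e1 := sum_ncard_eq_ncard_biUnion X P h.disj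
      have e2 : (⋃ x ∈ X, P x).ncard ≤ Nat.card V := by
        rw [← Set.ncard_univ]; exact Set.ncard_le_ncard (Set.subset_univ _)
      have e3 : ∑ x ∈ X.erase y, 2 ≤ ∑ x ∈ X.erase y, (P x).ncard :=
        Finset.sum_le_sum fun x hx => h2 x (Finset.mem_of_mem_erase hx)
      rw [← Finset.add_sum_erase X _ hy] at e1
      simp [Finset.card_erase_of_mem hy] at e3
      have := h2 y hy
      omega
    have hcard : (P y)ᶜ.ncard = 4 * n := by
      have := Set.ncard_add_ncard_compl (P y)
      omega
    obtain ⟨i, j, hij, -, R, hR⟩ := (h.mono (Finset.erase_subset y X)).exists_induce_iso_sumTwos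
      (fun x hx => h.isModule (Finset.mem_of_mem_erase hx) hy (Finset.ne_of_mem_erase hx) hyc.1)
      (fun x hx => h2 x (Finset.mem_of_mem_erase hx)) (W := (P y)ᶜ)
      (fun x hx => (h.disj x (Finset.mem_of_mem_erase hx) y hy
        (Finset.ne_of_mem_erase hx)).subset_compl_right) (e := 0) (by norm_num)
      (by rw [Finset.card_erase_of_mem hy]; omega)
    obtain ⟨rfl, rfl⟩ : i = 0 ∧ j = 0 := by omega
    have hk : (X.erase y).card + 0 = 2 * n := by rw [Finset.card_erase_of_mem hy]; omega
    rw [← hk]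
    refine ⟨R, ?_⟩
    change (T.induce (P y)ᶜ).Iso (R.lexSum fun _ => two).2 at hR
    obtain ⟨a, b, hab, hPy⟩ := Set.ncard_eq_two.1 hy2
    rw [hPy] at hyc hym hR
    have hun : ∀ x ∈ ({a, b} : Set V), ∀ v ∉ ({a, b} : Set V), ∀ w ∉ ({a, b} : Set V),
        (T.Arc x v ↔ T.Arc x w) := fun x hx v hv w hw =>
      hyc.1 v hv w hw x (by rwa [Set.mem_compl_iff, not_not])
    obtain ⟨m, hm, -⟩ := hyc.2.1
    have hm' : m ≠ a ∧ m ≠ b := by simpa using hm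
    have hnot : ¬ (T.Arc a m ↔ T.Arc b m) := by
      intro hiff
      apply hym
      have key : ∀ v ∉ ({a, b} : Set V), (T.Arc v a ↔ T.Arc v b) := by
        intro v hv
        have hv' : v ≠ a ∧ v ≠ b := by simpa using hv
        have h1 := hun a (by simp) v hv m hm
        have h3 := hun b (by simp) v hv m hm
        have h4 := T.arc_iff v a hv'.1
        have h5 := T.arc_iff v b hv'.2
        tauto
      rintro x (rfl | rfl) z (rfl | rfl) v hv
      · rfl
      · exact key v hv
      · exact (key v hv).symm
      · rfl
    clear hcard hy2
    wlog hbm : T.Arc b m generalizing a b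
    · have e : ({a, b} : Set V) = {b, a} := Set.pair_comm a b
      rw [e] at hPy hym hyc hR hun hm
      apply this b a
      all_goals first | assumption | exact hab.symm | exact hm'.symm | tauto
    have hb : ∀ v, v ≠ b → v ≠ a → T.Arc b v := fun v hvb hva =>
      (hun b (by simp) v (by simp [hva, hvb]) m hm).2 hbm
    have ha : ∀ v, v ≠ b → v ≠ a → T.Arc v a := fun v hvb hva =>
      (T.arc_or_arc hva).resolve_right fun h' =>
        hnot (iff_of_true ((hun a (by simp) v (by simp [hva, hvb]) m hm).1 h') hbm)
    have harc : T.Arc a b := by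
      -- Otherwise `b` is a source, and `{b}` is a co-module contained in `P y`.
      refine (T.arc_or_arc hab).resolve_right fun hba => ?_
      have hsrc : ∀ v, v ≠ b → T.Arc b v := fun v hv => by
        by_cases hva : v = a
        · rw [hva]; exact hba
        · exact hb v hv hva
      have hco : T.IsComodule {b} := by
        refine Or.inr ⟨?_, ⟨a, hab, m, hm'.2, hm'.1.symm⟩, ⟨b, by simp⟩⟩
        intro p hp q hq v hv
        rw [Set.mem_compl_iff, not_not] at hv
        rw [hv]
        exact iff_of_true (hsrc p hp) (hsrc q hq)
      have := (h.min y hy).2 {b} hco (by rw [hPy]; simp)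
      have ha' : a ∈ ({b} : Set V) := by rw [this, hPy]; simp
      exact hab ha'
    exact iso_cycle3 harc hb ha hR

lemma MinPacking.form_of_source [Finite V] {T : Tournament V} {X : Finset V} {P : V → Set V}
    {n : ℕ} (hV : Nat.card V = 4 * n + 2) (h : T.MinPacking X P)
    (hX : X.card = 2 * n + 1) {s : V} (hs : s ∈ X) (hPs : P s = {s})
    (h2 : ∀ x ∈ X, x ≠ s → 2 ≤ (P x).ncard) (hsrc : ∀ v, v ≠ s → T.Arc s v) :
    (∃ R : Tournament (Fin (2 * n + 1)),
        T.Iso ((transitive 2).lexSum ![one, R.sumTwos [one]]).2) ∨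
      (∃ R : Tournament (Fin (2 * n)),
        T.Iso ((transitive 2).lexSum ![one, R.sumTwos [c3]]).2) := by
  classical
  have hsm : T.IsModule (P s)ᶜ := by
    rw [hPs]
    intro p hp q hq v hv
    rw [Set.mem_compl_iff, not_not] at hv
    rw [hv]
    exact iff_of_true (hsrc p hp) (hsrc q hq)
  have hcard : ({s}ᶜ : Set V).ncard = 4 * n + 1 := by
    have := Set.ncard_add_ncard_compl ({s} : Set V)
    rw [Set.ncard_singleton] at this
    omega
  have hk : (X.erase s).card = 2 * n := by rw [Finset.card_erase_of_mem hs]; omega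
  obtain ⟨i, j, hij, -, R, hR⟩ := (h.mono (Finset.erase_subset s X)).exists_induce_iso_sumTwos
    (fun x hx => h.isModule (Finset.mem_of_mem_erase hx) hs (Finset.ne_of_mem_erase hx) hsm)
    (fun x hx => h2 x (Finset.mem_of_mem_erase hx) (Finset.ne_of_mem_erase hx)) (W := {s}ᶜ)
    (fun x hx => by
      rw [← hPs]
      exact (h.disj x (Finset.mem_of_mem_erase hx) s hs
        (Finset.ne_of_mem_erase hx)).subset_compl_right) (e := 1) (by norm_num)
    (by omega)
  rcases (by omega : (i = 0 ∧ j = 1) ∨ (i = 1 ∧ j = 0)) with ⟨rfl, rfl⟩ | ⟨rfl, rfl⟩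
  · left
    rw [← hk]
    exact ⟨R, iso_transitive_two hsrc hR⟩
  · right
    rw [← hk]
    exact ⟨R, iso_transitive_two hsrc hR⟩

lemma MinPacking.form_of_source_sink [Finite V] {T : Tournament V} {X : Finset V} {P : V → Set V}
    {n : ℕ} (hn : 1 ≤ n) (hV : Nat.card V = 4 * n + 2) (h : T.MinPacking X P)
    (hX : X.card = 2 * n + 1) {s t : V} (hs : s ∈ X) (hPs : P s = {s}) (ht : t ∈ X)
    (hPt : P t = {t}) (hst : s ≠ t) (h2 : ∀ x ∈ X, x ≠ s → x ≠ t → 2 ≤ (P x).ncard)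
    (hsrc : ∀ v, v ≠ s → T.Arc s v) (hsnk : ∀ v, v ≠ t → T.Arc v t) :
    (∃ R : Tournament (Fin (2 * n + 1)),
        T.Iso ((transitive 3).lexSum ![one, R.sumTwos [one, one], one]).2) ∨
      (∃ R : Tournament (Fin (2 * n)),
        T.Iso ((transitive 3).lexSum ![one, R.sumTwos [c3, one], one]).2) ∨
      (2 ≤ n ∧ ∃ R : Tournament (Fin (2 * n - 1)),
        T.Iso ((transitive 3).lexSum ![one, R.sumTwos [c3, c3], one]).2) := by
  classical
  have hsm : T.IsModule (P s)ᶜ := by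
    rw [hPs]
    intro p hp q hq v hv
    rw [Set.mem_compl_iff, not_not] at hv
    rw [hv]
    exact iff_of_true (hsrc p hp) (hsrc q hq)
  have hcard : ({s, t}ᶜ : Set V).ncard = 4 * n := by
    have := Set.ncard_add_ncard_compl ({s, t} : Set V)
    rw [Set.ncard_pair hst] at this
    omega
  have hmem : ∀ x, x ∈ (X.erase s).erase t ↔ x ≠ t ∧ x ≠ s ∧ x ∈ X := fun x => by simp
  have hk : ((X.erase s).erase t).card = 2 * n - 1 := by
    rw [Finset.card_erase_of_mem (Finset.mem_erase.2 ⟨hst.symm, ht⟩), Finset.card_erase_of_mem hs]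
    omega
  obtain ⟨i, j, hij, hi, R, hR⟩ := (h.mono (Y := (X.erase s).erase t)
    fun x hx => ((hmem x).1 hx).2.2).exists_induce_iso_sumTwos
    (fun x hx => h.isModule ((hmem x).1 hx).2.2 hs ((hmem x).1 hx).2.1 hsm)
    (fun x hx => h2 x ((hmem x).1 hx).2.2 ((hmem x).1 hx).2.1 ((hmem x).1 hx).1) (W := {s, t}ᶜ)
    (fun x hx v hv => by
      have h1 := h.disj x ((hmem x).1 hx).2.2 s hs ((hmem x).1 hx).2.1
      have h2 := h.disj x ((hmem x).1 hx).2.2 t ht ((hmem x).1 hx).1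
      rw [hPs, Set.disjoint_singleton_right] at h1
      rw [hPt, Set.disjoint_singleton_right] at h2
      rintro (rfl | rfl)
      · exact h1 hv
      · exact h2 hv) (e := 2) (by norm_num) (by omega)
  rcases (by omega : (i = 0 ∧ j = 2) ∨ (i = 1 ∧ j = 1) ∨ (i = 2 ∧ j = 0)) with
    ⟨rfl, rfl⟩ | ⟨rfl, rfl⟩ | ⟨rfl, rfl⟩
  · left
    have hk' : ((X.erase s).erase t).card + 2 = 2 * n + 1 := by omega
    rw [← hk']
    exact ⟨R, iso_transitive_three hst hsrc hsnk hR⟩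
  · right; left
    have hk' : ((X.erase s).erase t).card + 1 = 2 * n := by omega
    rw [← hk']
    exact ⟨R, iso_transitive_three hst hsrc hsnk hR⟩
  · right; right
    refine ⟨by omega, ?_⟩
    rw [← hk]
    exact ⟨R, iso_transitive_three hst hsrc hsnk hR⟩

/-- The forms are told apart by the number of one-vertex members of the packing, that is, of
sources and sinks. -/
theorem MinPacking.forms [Finite V] {T : Tournament V} {X : Finset V} {P : V → Set V}
    {n : ℕ} (hn : 1 ≤ n) (hV : Nat.card V = 4 * n + 2) (h : T.MinPacking X P)
    (hX : X.card = 2 * n + 1) :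
    (∃ R : Tournament (Fin (2 * n + 1)), T.Iso (R.lexSum fun _ => two).2) ∨
    (∃ R : Tournament (Fin (2 * n)),
      T.Iso (cycle3.lexSum ![one, one, R.lexSum fun _ => two]).2) ∨
    (∃ R : Tournament (Fin (2 * n + 1)),
      T.Iso ((transitive 2).lexSum ![one, R.sumTwos [one]]).2 ∨
      T.Iso ((transitive 2).lexSum ![one, R.sumTwos [one]]).dual.2) ∨
    (∃ R : Tournament (Fin (2 * n)),
      T.Iso ((transitive 2).lexSum ![one, R.sumTwos [c3]]).2 ∨
      T.Iso ((transitive 2).lexSum ![one, R.sumTwos [c3]]).dual.2) ∨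
    (∃ R : Tournament (Fin (2 * n + 1)),
      T.Iso ((transitive 3).lexSum ![one, R.sumTwos [one, one], one]).2) ∨
    (∃ R : Tournament (Fin (2 * n)),
      T.Iso ((transitive 3).lexSum ![one, R.sumTwos [c3, one], one]).2) ∨
    (2 ≤ n ∧ ∃ R : Tournament (Fin (2 * n - 1)),
      T.Iso ((transitive 3).lexSum ![one, R.sumTwos [c3, c3], one]).2) := by
  classical
  set A := X.filter fun x => (P x).ncard = 1 with hA
  have hAmem : ∀ x, x ∈ A ↔ x ∈ X ∧ (P x).ncard = 1 := fun x => by simp [hA]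
  have hAcard : A.card ≤ 2 := h.card_singletons_le
  have hbig : ∀ x ∈ X, x ∉ A → 2 ≤ (P x).ncard := by
    intro x hx hxA
    have h1 := h.ncard_pos hx
    have h2 : (P x).ncard ≠ 1 := fun e => hxA ((hAmem x).2 ⟨hx, e⟩)
    omega
  have hsing : ∀ x ∈ A, x ∈ X ∧ P x = {x} := fun x hx =>
    ⟨((hAmem x).1 hx).1, h.eq_singleton ((hAmem x).1 hx).1 ((hAmem x).1 hx).2⟩
  have hss : ∀ x ∈ A, (∀ v, v ≠ x → T.Arc x v) ∨ (∀ v, v ≠ x → T.Arc v x) := by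
    intro x hx
    apply source_or_sink
    have h1 := (h.min x (hsing x hx).1).1
    rw [(hsing x hx).2] at h1
    rcases h1 with h1 | h1
    · exact absurd h1.2.1 Set.not_nontrivial_singleton
    · exact h1.1
  rcases (by omega : A.card = 0 ∨ A.card = 1 ∨ A.card = 2) with hc | hc | hc
  · rw [Finset.card_eq_zero] at hc
    have := h.form_of_no_singleton hV hX fun x hx => hbig x hx (by simp [hc])
    tauto
  · obtain ⟨s, hs⟩ := Finset.card_eq_one.1 hc
    have hsA : s ∈ A := by simp [hs]
    have hb : ∀ x ∈ X, x ≠ s → 2 ≤ (P x).ncard := fun x hx hxs => hbig x hx (by simp [hs, hxs])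
    rcases hss s hsA with hsrc | hsnk
    · rcases h.form_of_source hV hX (hsing s hsA).1 (hsing s hsA).2 hb hsrc with ⟨R, hR⟩ | ⟨R, hR⟩
      · exact Or.inr (Or.inr (Or.inl ⟨R, Or.inl hR⟩))
      · exact Or.inr (Or.inr (Or.inr (Or.inl ⟨R, Or.inl hR⟩)))
    · rcases h.dual.form_of_source hV hX (hsing s hsA).1 (hsing s hsA).2 hb hsnk with
        ⟨R, hR⟩ | ⟨R, hR⟩
      · exact Or.inr (Or.inr (Or.inl ⟨R, Or.inr (iso_dual hR)⟩))
      · exact Or.inr (Or.inr (Or.inr (Or.inl ⟨R, Or.inr (iso_dual hR)⟩)))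
  · obtain ⟨s, t, hst, hA2⟩ := Finset.card_eq_two.1 hc
    have hsA : s ∈ A := by simp [hA2]
    have htA : t ∈ A := by simp [hA2]
    have hb : ∀ x ∈ X, x ≠ s → x ≠ t → 2 ≤ (P x).ncard := fun x hx hxs hxt =>
      hbig x hx (by simp [hA2, hxs, hxt])
    have hsX := hsing s hsA
    have htX := hsing t htA
    right; right; right; right
    rcases hss s hsA with h1 | h1 <;> rcases hss t htA with h2 | h2
    · exact absurd (h2 s hst) (h1 t hst.symm).asymm
    · exact h.form_of_source_sink hn hV hX hsX.1 hsX.2 htX.1 htX.2 hst hb h1 h2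
    · exact h.form_of_source_sink hn hV hX htX.1 htX.2 hsX.1 hsX.2 hst.symm
        (fun x hx hxt hxs => hb x hx hxs hxt) h2 h1
    · exact absurd (h2 s hst) (h1 t hst.symm).asymm

/-! ### From the forms to packings -/

lemma HasPacking.of_iso {T : Tournament V} {W : Type*} {R : Tournament W} {k : ℕ}
    (e : T.Iso R) (h : R.HasPacking k) : T.HasPacking k := by
  obtain ⟨e⟩ := e
  obtain ⟨P, hP, hd⟩ := h
  have key : ∀ M, R.IsNontrivialModule M → T.IsNontrivialModule (e ⁻¹' M) := by
    intro M hM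
    refine ⟨fun x hx y hy v hv => ?_, hM.2.1.preimage e.surjective, ?_⟩
    · rw [← e.map_rel_iff, ← e.map_rel_iff]
      exact hM.1 _ hx _ hy _ hv
    · obtain ⟨v, hv⟩ := hM.2.2
      exact ⟨e.symm v, by simpa using hv⟩
  refine ⟨fun i => e ⁻¹' P i, fun i => ?_, fun i j hij => (hd hij).preimage e⟩
  rcases hP i with h | h
  · exact Or.inl (key _ h)
  · exact Or.inr (key _ h)

lemma HasPacking.dual {T : Tournament V} {k : ℕ} (h : T.HasPacking k) : T.dual.HasPacking k := by
  obtain ⟨P, hP, hd⟩ := h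
  exact ⟨P, fun i => isComodule_dual.2 (hP i), hd⟩

lemma hasPacking_append {T : Tournament V} {k m : ℕ} (P : Fin k → Set V) (E : Fin m → Set V)
    (hP : ∀ a, T.IsComodule (P a)) (hE : ∀ a, T.IsComodule (E a))
    (hPd : Pairwise fun a b => Disjoint (P a) (P b))
    (hEd : Pairwise fun a b => Disjoint (E a) (E b))
    (hd : ∀ a b, Disjoint (P a) (E b)) : T.HasPacking (k + m) := by
  refine ⟨Fin.append P E, fun a => ?_, fun a b hab => ?_⟩
  · induction a using Fin.addCases with
    | left a => rw [Fin.append_left]; exact hP a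
    | right a => rw [Fin.append_right]; exact hE a
  · induction a using Fin.addCases with
    | left a =>
      induction b using Fin.addCases with
      | left b =>
        rw [Fin.append_left, Fin.append_left]
        exact hPd fun e => hab (by rw [e])
      | right b =>
        rw [Fin.append_left, Fin.append_right]
        exact hd a b
    | right a =>
      induction b using Fin.addCases with
      | left b =>
        rw [Fin.append_left, Fin.append_right]
        exact (hd b a).symm
      | right b =>
        rw [Fin.append_right, Fin.append_right]
        exact hEd fun e => hab (by rw [e])

/-- `T` has `k` pairwise disjoint modules with at least two elements. -/
def HasModulePacking (T : Tournament V) (k : ℕ) : Prop :=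
  ∃ P : Fin k → Set V, (∀ i, T.IsModule (P i) ∧ (P i).Nontrivial) ∧
    Pairwise fun i j => Disjoint (P i) (P j)

lemma HasModulePacking.hasPacking {T : Tournament V} {k : ℕ} (h : T.HasModulePacking k)
    (hk : 2 ≤ k) : T.HasPacking k := by
  obtain ⟨P, hP, hd⟩ := h
  refine ⟨P, fun i => Or.inl ⟨(hP i).1, (hP i).2, ?_⟩, hd⟩
  have : Nontrivial (Fin k) := Fin.nontrivial_iff_two_le.2 hk
  obtain ⟨j, hj⟩ := exists_ne i
  obtain ⟨v, hv⟩ := (hP j).2.nonempty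
  exact ⟨v, Set.disjoint_left.1 (hd hj) hv⟩

section lexSum

variable {I : Type} {R : Tournament I} {F : I → BundledTournament}

lemma lexSum_arc {i j : I} {x : (F i).1} {y : (F j).1} (h : i ≠ j) :
    (R.lexSum F).2.Arc ⟨i, x⟩ ⟨j, y⟩ ↔ R.Arc i j := by
  change Sigma.Lex _ _ _ _ ↔ _
  rw [Sigma.lex_iff]
  simp [h]

lemma lexSum_arc_self {i : I} {x y : (F i).1} :
    (R.lexSum F).2.Arc ⟨i, x⟩ ⟨i, y⟩ ↔ (F i).2.Arc x y := by
  change Sigma.Lex _ _ _ _ ↔ _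
  rw [Sigma.lex_iff]
  simp [R.irrefl]

lemma isModule_lexSum_image {i : I} {Q : Set (F i).1} (hQ : (F i).2.IsModule Q) :
    (R.lexSum F).2.IsModule (Sigma.mk i '' Q) := by
  rintro _ ⟨x, hx, rfl⟩ _ ⟨y, hy, rfl⟩ ⟨j, z⟩ hv
  by_cases hji : j = i
  · subst hji
    rw [lexSum_arc_self, lexSum_arc_self]
    exact hQ x hx y hy z fun hz => hv ⟨z, hz, rfl⟩
  · rw [lexSum_arc hji, lexSum_arc hji]

lemma isModule_lexSum_fibre (i : I) :
    (R.lexSum F).2.IsModule {z : Σ i, (F i).1 | z.1 = i} := by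
  rintro ⟨j, x⟩ rfl ⟨j', y⟩ h ⟨k, z⟩ hv
  obtain rfl : j' = j := h
  have hkj : k ≠ j' := hv
  rw [lexSum_arc hkj, lexSum_arc hkj]

lemma isModule_lexSum_compl_fibre {i : I}
    (h : (∀ j, j ≠ i → R.Arc i j) ∨ (∀ j, j ≠ i → R.Arc j i)) :
    (R.lexSum F).2.IsModule {z : Σ i, (F i).1 | z.1 = i}ᶜ := by
  rintro ⟨j, x⟩ hj ⟨j', y⟩ hj' ⟨k, z⟩ hv
  obtain rfl : k = i := not_not.1 hv
  have hj : j ≠ k := hj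
  have hj' : j' ≠ k := hj'
  rw [lexSum_arc hj.symm, lexSum_arc hj'.symm]
  rcases h with h | h
  · exact iff_of_true (h j hj) (h j' hj')
  · exact iff_of_false (h j hj).asymm (h j' hj').asymm

lemma hasModulePacking_lexSum {k : ℕ} (j : Fin k → I) (hj : Function.Injective j)
    (hn : ∀ i, Nontrivial (F (j i)).1) : (R.lexSum F).2.HasModulePacking k := by
  refine ⟨fun i => {z : Σ i, (F i).1 | z.1 = j i}, fun i => ⟨isModule_lexSum_fibre _, ?_⟩, ?_⟩
  · obtain ⟨x, y, hxy⟩ := (hn i).exists_pair_ne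
    exact ⟨⟨j i, x⟩, rfl, ⟨j i, y⟩, rfl, fun e => hxy (eq_of_heq (Sigma.mk.inj e).2)⟩
  · intro i i' hii
    rw [Set.disjoint_left]
    intro z hz hz'
    exact hii (hj (hz.symm.trans hz'))

/-- A packing of a summand by modules extends by disjoint complements of modules outside
the summand. -/
lemma hasPacking_lexSum {i : I} {k m : ℕ} (hk : (F i).2.HasModulePacking k) (hk1 : 1 ≤ k)
    (E : Fin m → Set (Σ i, (F i).1)) (hm : 1 ≤ m)
    (hE : ∀ j, (R.lexSum F).2.IsModule (E j)ᶜ ∧ (E j).Nonempty ∧ ∀ z ∈ E j, z.1 ≠ i)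
    (hd : Pairwise fun j j' => Disjoint (E j) (E j')) : (R.lexSum F).2.HasPacking (k + m) := by
  obtain ⟨P, hP, hPd⟩ := hk
  have hinj : Function.Injective (Sigma.mk (β := fun i => (F i).1) i) := by
    intro x y e
    cases e
    rfl
  have hout : ∀ j a, Disjoint (Sigma.mk i '' P a) (E j) := by
    intro j a
    rw [Set.disjoint_left]
    rintro _ ⟨x, -, rfl⟩ hx
    exact (hE j).2.2 _ hx rfl
  refine hasPacking_append (fun a => Sigma.mk i '' P a) E (fun a => ?_) (fun a => ?_)
    (fun a b hab => (Set.disjoint_image_iff hinj).2 (hPd hab)) hd fun a b => hout b a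
  · obtain ⟨z, hz⟩ := (hE ⟨0, hm⟩).2.1
    exact Or.inl ⟨isModule_lexSum_image (hP a).1, (hP a).2.image hinj,
      ⟨z, Set.disjoint_right.1 (hout _ a) hz⟩⟩
  · refine Or.inr ⟨(hE a).1, ?_, (hE a).2.1.imp fun _ h => not_not.2 h⟩
    exact ((hP ⟨0, hk1⟩).2.image hinj).mono (hout a _).subset_compl_right

end lexSum

instance : Nontrivial two.1 := inferInstanceAs (Nontrivial (Fin 2))

instance : Nontrivial c3.1 := inferInstanceAs (Nontrivial (Fin 3))

lemma card_one : Nat.card one.1 = 1 := by simp [one]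

lemma card_two : Nat.card two.1 = 2 := by simp [two]

lemma card_c3 : Nat.card c3.1 = 3 := by simp [c3]

lemma card_lexSum {k : ℕ} {R : Tournament (Fin k)} {F : Fin k → BundledTournament}
    (h : ∀ i, 0 < Nat.card (F i).1) :
    Nat.card (R.lexSum F).1 = ∑ i, Nat.card (F i).1 := by
  have : ∀ i, Finite (F i).1 := fun i => (Nat.card_pos_iff.1 (h i)).2
  exact Nat.card_sigma

lemma card_lexSum_two {k : ℕ} {R : Tournament (Fin k)} :
    Nat.card (R.lexSum fun _ => two).1 = 2 * k := by
  rw [card_lexSum (fun _ => by rw [card_two]; norm_num)]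
  simp [card_two, mul_comm]

lemma card_transitive_two {X : BundledTournament} (hX : 0 < Nat.card X.1) :
    Nat.card ((transitive 2).lexSum ![one, X]).1 = Nat.card X.1 + 1 := by
  rw [card_lexSum]
  · rw [Fin.sum_univ_two]
    change Nat.card one.1 + Nat.card X.1 = _
    rw [card_one]; omega
  · intro i
    fin_cases i
    · exact card_one.symm ▸ one_pos
    · exact hX

lemma card_lexSum_three {R : Tournament (Fin 3)} {X Y Z : BundledTournament}
    (hX : 0 < Nat.card X.1) (hY : 0 < Nat.card Y.1) (hZ : 0 < Nat.card Z.1) :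
    Nat.card (R.lexSum ![X, Y, Z]).1 = Nat.card X.1 + Nat.card Y.1 + Nat.card Z.1 := by
  rw [card_lexSum]
  · rw [Fin.sum_univ_three]
    rfl
  · intro i
    fin_cases i
    · exact hX
    · exact hY
    · exact hZ

/-- The data of a summand that the outer sum needs: its size and a packing by modules. -/
lemma sumTwos_one {m : ℕ} (R : Tournament (Fin (m + 1))) :
    Nat.card (R.sumTwos [one]).1 = 2 * m + 1 ∧ (R.sumTwos [one]).2.HasModulePacking m := by
  constructor
  · rw [sumTwos, card_lexSum]
    · rw [Fin.sum_univ_succ]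
      simp [card_one, card_two]; omega
    · intro i
      cases i using Fin.cases <;> simp [card_one, card_two]
  · exact hasModulePacking_lexSum Fin.succ (Fin.succ_injective m)
      fun i => inferInstanceAs (Nontrivial two.1)

lemma sumTwos_c3 {m : ℕ} (R : Tournament (Fin (m + 1))) :
    Nat.card (R.sumTwos [c3]).1 = 2 * m + 3 ∧ (R.sumTwos [c3]).2.HasModulePacking (m + 1) := by
  constructor
  · rw [sumTwos, card_lexSum]
    · rw [Fin.sum_univ_succ]
      simp [card_c3, card_two]; omega
    · intro i
      cases i using Fin.cases <;> simp [card_c3, card_two]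
  · refine hasModulePacking_lexSum id Function.injective_id fun i => ?_
    cases i using Fin.cases
    · exact inferInstanceAs (Nontrivial c3.1)
    · exact inferInstanceAs (Nontrivial two.1)

lemma sumTwos_one_one {m : ℕ} (R : Tournament (Fin (m + 2))) :
    Nat.card (R.sumTwos [one, one]).1 = 2 * m + 2 ∧
      (R.sumTwos [one, one]).2.HasModulePacking m := by
  constructor
  · rw [sumTwos, card_lexSum]
    · rw [Fin.sum_univ_succ, Fin.sum_univ_succ]
      simp [card_one, card_two]; omega
    · intro i
      cases i using Fin.cases with
      | zero => simp [card_one]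
      | succ i => cases i using Fin.cases <;> simp [card_one, card_two]
  · exact hasModulePacking_lexSum (fun i => i.succ.succ)
      ((Fin.succ_injective _).comp (Fin.succ_injective _))
      fun i => inferInstanceAs (Nontrivial two.1)

lemma sumTwos_c3_one {m : ℕ} (R : Tournament (Fin (m + 2))) :
    Nat.card (R.sumTwos [c3, one]).1 = 2 * m + 4 ∧
      (R.sumTwos [c3, one]).2.HasModulePacking (m + 1) := by
  constructor
  · rw [sumTwos, card_lexSum]
    · rw [Fin.sum_univ_succ, Fin.sum_univ_succ]
      simp [card_one, card_two, card_c3]; omega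
    · intro i
      cases i using Fin.cases with
      | zero => simp [card_c3]
      | succ i => cases i using Fin.cases <;> simp [card_one, card_two]
  · refine hasModulePacking_lexSum (Fin.succAbove 1) Fin.succAbove_right_injective fun i => ?_
    cases i using Fin.cases with
    | zero => exact inferInstanceAs (Nontrivial c3.1)
    | succ i =>
      have h : Fin.succAbove (1 : Fin (m + 2)) i.succ = i.succ.succ := by
        rw [Fin.succAbove_of_le_castSucc]
        simp [Fin.le_def]
      rw [h]
      exact inferInstanceAs (Nontrivial two.1)

lemma sumTwos_c3_c3 {m : ℕ} (R : Tournament (Fin (m + 2))) :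
    Nat.card (R.sumTwos [c3, c3]).1 = 2 * m + 6 ∧
      (R.sumTwos [c3, c3]).2.HasModulePacking (m + 2) := by
  constructor
  · rw [sumTwos, card_lexSum]
    · rw [Fin.sum_univ_succ, Fin.sum_univ_succ]
      simp [card_two, card_c3]; omega
    · intro i
      cases i using Fin.cases with
      | zero => simp [card_c3]
      | succ i => cases i using Fin.cases <;> simp [card_c3, card_two]
  · refine hasModulePacking_lexSum id Function.injective_id fun i => ?_
    cases i using Fin.cases with
    | zero => exact inferInstanceAs (Nontrivial c3.1)
    | succ i =>
      cases i using Fin.cases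
      · exact inferInstanceAs (Nontrivial c3.1)
      · exact inferInstanceAs (Nontrivial two.1)

lemma hasPacking_transitive_two {X : BundledTournament} {k : ℕ} (h : X.2.HasModulePacking k)
    (hk : 1 ≤ k) : ((transitive 2).lexSum ![one, X]).2.HasPacking (k + 1) := by
  refine hasPacking_lexSum (i := 1) (F := ![one, X]) h hk
    (fun _ : Fin 1 => {z | z.1 = 0}) le_rfl (fun _ => ⟨?_, ⟨⟨0, (0 : Fin 1)⟩, rfl⟩, ?_⟩) ?_
  · exact isModule_lexSum_compl_fibre (Or.inl fun j hj => Fin.pos_iff_ne_zero.2 hj)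
  · intro z (hz : z.1 = 0)
    simp [hz]
  · exact fun i j hij => absurd (Subsingleton.elim i j) hij

lemma hasPacking_transitive_three {X : BundledTournament} {k : ℕ} (h : X.2.HasModulePacking k)
    (hk : 1 ≤ k) : ((transitive 3).lexSum ![one, X, one]).2.HasPacking (k + 2) := by
  refine hasPacking_lexSum (i := 1) (F := ![one, X, one]) h hk
    (![{z | z.1 = 0}, {z | z.1 = 2}] : Fin 2 → Set _) (by norm_num) (fun j => ?_) ?_
  · fin_cases j
    · refine ⟨isModule_lexSum_compl_fibre (Or.inl fun j hj => Fin.pos_iff_ne_zero.2 hj),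
        ⟨⟨0, (0 : Fin 1)⟩, rfl⟩, ?_⟩
      intro z (hz : z.1 = 0)
      simp [hz]
    · refine ⟨isModule_lexSum_compl_fibre (Or.inr fun j hj => ?_),
        ⟨⟨2, (0 : Fin 1)⟩, rfl⟩, ?_⟩
      · exact lt_of_le_of_ne (Fin.le_last j) hj
      · intro z (hz : z.1 = 2)
        simp [hz]
  · have hd : Disjoint {z : Σ i, ((![one, X, one] : Fin 3 → BundledTournament) i).1 | z.1 = 0}
        {z | z.1 = 2} := by
      rw [Set.disjoint_left]
      intro z (hz : z.1 = 0) (hz' : z.1 = 2)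
      rw [hz] at hz'
      exact absurd hz' (by decide)
    intro i j hij
    fin_cases i <;> fin_cases j
    · exact absurd rfl hij
    · exact hd
    · exact hd.symm
    · exact absurd rfl hij

lemma hasPacking_cycle3 {X : BundledTournament} {k : ℕ} (h : X.2.HasModulePacking k)
    (hk : 1 ≤ k) : (cycle3.lexSum ![one, one, X]).2.HasPacking (k + 1) := by
  refine hasPacking_lexSum (i := 2) (F := ![one, one, X]) h hk
    (fun _ : Fin 1 => {z | z.1 = 2}ᶜ) le_rfl (fun _ => ⟨?_, ⟨⟨0, (0 : Fin 1)⟩, ?_⟩, ?_⟩) ?_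
  · intro x hx y hy v hv
    exact isModule_lexSum_fibre 2 x (not_not.1 hx) y (not_not.1 hy) v fun e => hv (not_not.2 e)
  · simp
  · intro z hz
    exact hz
  · exact fun i j hij => absurd (Subsingleton.elim i j) hij

/-- Each of the forms has `4n + 2` vertices and `2n + 1` disjoint nontrivial co-modules. -/
theorem card_and_hasPacking_of_forms {n : ℕ} (hn : 1 ≤ n) {T : Tournament V}
    (h : (∃ R : Tournament (Fin (2 * n + 1)), T.Iso (R.lexSum fun _ => two).2) ∨
    (∃ R : Tournament (Fin (2 * n)),
      T.Iso (cycle3.lexSum ![one, one, R.lexSum fun _ => two]).2) ∨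
    (∃ R : Tournament (Fin (2 * n + 1)),
      T.Iso ((transitive 2).lexSum ![one, R.sumTwos [one]]).2 ∨
      T.Iso ((transitive 2).lexSum ![one, R.sumTwos [one]]).dual.2) ∨
    (∃ R : Tournament (Fin (2 * n)),
      T.Iso ((transitive 2).lexSum ![one, R.sumTwos [c3]]).2 ∨
      T.Iso ((transitive 2).lexSum ![one, R.sumTwos [c3]]).dual.2) ∨
    (∃ R : Tournament (Fin (2 * n + 1)),
      T.Iso ((transitive 3).lexSum ![one, R.sumTwos [one, one], one]).2) ∨
    (∃ R : Tournament (Fin (2 * n)),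
      T.Iso ((transitive 3).lexSum ![one, R.sumTwos [c3, one], one]).2) ∨
    (2 ≤ n ∧ ∃ R : Tournament (Fin (2 * n - 1)),
      T.Iso ((transitive 3).lexSum ![one, R.sumTwos [c3, c3], one]).2)) :
    Nat.card V = 4 * n + 2 ∧ T.HasPacking (2 * n + 1) := by
  have main : ∀ {W : Type} {S : Tournament W}, T.Iso S →
      Nat.card W = 4 * n + 2 → S.HasPacking (2 * n + 1) →
      Nat.card V = 4 * n + 2 ∧ T.HasPacking (2 * n + 1) := by
    intro W S e h1 h2
    refine ⟨?_, h2.of_iso e⟩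
    rw [← h1]
    exact Nat.card_congr e.some.toEquiv
  obtain ⟨m, rfl⟩ : ∃ m, n = m + 1 := ⟨n - 1, by omega⟩
  rcases h with ⟨R, hR⟩ | ⟨R, hR⟩ | ⟨R, hR⟩ | ⟨R, hR⟩ | ⟨R, hR⟩ | ⟨R, hR⟩ | ⟨hm, hR⟩
  · refine main hR (by rw [card_lexSum_two]; omega) ?_
    exact (hasModulePacking_lexSum id Function.injective_id
      fun _ => inferInstanceAs (Nontrivial two.1)).hasPacking (by omega)
  · refine main hR ?_ (hasPacking_cycle3 (hasModulePacking_lexSum id Function.injective_id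
      fun _ => inferInstanceAs (Nontrivial two.1)) (by omega))
    rw [card_lexSum_three (by rw [card_one]; norm_num) (by rw [card_one]; norm_num)
      (by rw [card_lexSum_two]; omega), card_one, card_lexSum_two]
    omega
  · obtain ⟨h1, h2⟩ := sumTwos_one R
    have h3 : Nat.card ((transitive 2).lexSum ![one, R.sumTwos [one]]).1 = 4 * (m + 1) + 2 := by
      rw [card_transitive_two (by omega)]; omega
    have h4 := hasPacking_transitive_two h2 (by omega)
    rcases hR with hR | hR
    · exact main hR h3 h4
    · exact main hR h3 h4.dual
  · obtain ⟨h1, h2⟩ := sumTwos_c3 (m := 2 * m + 1) R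
    have h3 : Nat.card ((transitive 2).lexSum ![one, R.sumTwos [c3]]).1 = 4 * (m + 1) + 2 := by
      rw [card_transitive_two]
      · exact (congrArg (· + 1) h1).trans (by omega)
      · exact h1.symm ▸ (by omega)
    have h4 := hasPacking_transitive_two h2 (by omega)
    rcases hR with hR | hR
    · exact main hR h3 h4
    · exact main hR h3 h4.dual
  · obtain ⟨h1, h2⟩ := sumTwos_one_one (m := 2 * m + 1) R
    refine main hR ?_ (hasPacking_transitive_three h2 (by omega))
    rw [card_lexSum_three (by rw [card_one]; norm_num) (h1.symm ▸ (by omega))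
      (by rw [card_one]; norm_num), card_one]
    exact (congrArg (1 + · + 1) h1).trans (by omega)
  · obtain ⟨h1, h2⟩ := sumTwos_c3_one (m := 2 * m) R
    refine main hR ?_ (hasPacking_transitive_three h2 (by omega))
    rw [card_lexSum_three (by rw [card_one]; norm_num) (h1.symm ▸ (by omega))
      (by rw [card_one]; norm_num), card_one]
    exact (congrArg (1 + · + 1) h1).trans (by omega)
  · obtain ⟨p, rfl⟩ : ∃ p, m = p + 1 := ⟨m - 1, by omega⟩
    obtain ⟨R, hR⟩ := hR
    obtain ⟨h1, h2⟩ := sumTwos_c3_c3 (m := 2 * p + 1) R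
    refine main hR ?_ (hasPacking_transitive_three h2 (by omega))
    rw [card_lexSum_three (by rw [card_one]; norm_num) (h1.symm ▸ (by omega))
      (by rw [card_one]; norm_num), card_one]
    exact (congrArg (1 + · + 1) h1).trans (by omega)

end Tournament

open Tournament BundledTournament in
theorem theorem6p3 (n : ℕ) (hn : 1 ≤ n) {V : Type*} [Finite V] (T : Tournament V) :
    (Nat.card V = 4 * n + 2 ∧ T.HasMaximalDecomposability) ↔
      -- the form (a)
      (∃ R : Tournament (Fin (2 * n + 1)), T.Iso (R.lexSum fun _ => two).2) ∨
      -- the form (b)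
      (∃ R : Tournament (Fin (2 * n)),
        T.Iso (cycle3.lexSum ![one, one, R.lexSum fun _ => two]).2) ∨
      -- the form (c)
      (∃ R : Tournament (Fin (2 * n + 1)),
        T.Iso ((transitive 2).lexSum ![one, R.sumTwos [one]]).2 ∨
        T.Iso ((transitive 2).lexSum ![one, R.sumTwos [one]]).dual.2) ∨
      -- the form (d)
      (∃ R : Tournament (Fin (2 * n)),
        T.Iso ((transitive 2).lexSum ![one, R.sumTwos [c3]]).2 ∨
        T.Iso ((transitive 2).lexSum ![one, R.sumTwos [c3]]).dual.2) ∨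
      -- the form (e)
      (∃ R : Tournament (Fin (2 * n + 1)),
        T.Iso ((transitive 3).lexSum ![one, R.sumTwos [one, one], one]).2) ∨
      -- the form (f)
      (∃ R : Tournament (Fin (2 * n)),
        T.Iso ((transitive 3).lexSum ![one, R.sumTwos [c3, one], one]).2) ∨
      -- the form (g)
      (2 ≤ n ∧ ∃ R : Tournament (Fin (2 * n - 1)),
        T.Iso ((transitive 3).lexSum ![one, R.sumTwos [c3, c3], one]).2) := by
  constructor
  · rintro ⟨hV, hT⟩
    obtain ⟨X, P, hXP, hX⟩ := hT.exists_minPacking hn hV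
    exact hXP.forms hn hV hX
  · intro h
    obtain ⟨hV, hP⟩ := card_and_hasPacking_of_forms hn h
    exact ⟨hV, hasMaximalDecomposability_of_hasPacking hn hV hP⟩
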